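/- For $u \in H^1(\mathbb{R}^2)$ (real- or complex-valued) with $u \neq 0$ and $0<\alpha<\infty$, put $$F_\alpha(u)=\frac{\|\nabla u\|_{L^2}^{\frac{2}{1+\alpha}}\,\|u\|_{L^2}^{\frac{2+\alpha}{1+\alpha}}\,\|u\|_{L^6}^{\frac{3\alpha}{1+\alpha}}}{\|u\|_{L^4}^{4}},\qquad C_\alpha=\inf_{u\in H^1(\mathbb{R}^2)\setminus\{0\}}F_\alpha(u),$$ where all norms are over $\mathbb{R}^2$. **Theorem 3.1.** For every $\alpha\in(0,\infty)$ the infimum $C_\alpha$ is attained at a nonnegative, radially symmetric function: there is a nonnegative radially symmetric $v\in H^1(\mathbb{R}^2)\setminus\{0\}$ with $$F_\alpha(v)=C_\alpha=\min_{u\in H^1(\mathbb{R}^2)\setminus\{0\}}F_\alpha(u).$$ -/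

import Mathlib

open MeasureTheory
open scoped ContDiff

noncomputable section

namespace GagliardoNirenberg

/-- The Euclidean plane `ℝ²`, with its Euclidean norm and Lebesgue measure `volume`. -/
abbrev Plane : Type := EuclideanSpace ℝ (Fin 2)

/-- `g = (g₁, g₂)` is a weak gradient of `u`: for every test function `φ ∈ C_c^∞(ℝ²)` and each
coordinate direction `eᵢ` one has `∫ (∂ᵢ φ) u = - ∫ φ gᵢ`. -/
def IsWeakGradient {𝕜 : Type*} [RCLike 𝕜] (u : Plane → 𝕜) (g : Plane → EuclideanSpace 𝕜 (Fin 2)) :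
    Prop :=
  ∀ φ : Plane → ℝ, ContDiff ℝ ∞ φ → HasCompactSupport φ → ∀ i : Fin 2,
    ∫ x, (fderiv ℝ φ x (EuclideanSpace.single i 1)) • u x = - ∫ x, φ x • g x i

/-- `u ∈ H¹(ℝ²)`: `u` is in `L²` and has a weak gradient in `L²`. Elements of `H¹` are represented
by functions; two functions that agree almost everywhere are the same element. -/
def MemH1 {𝕜 : Type*} [RCLike 𝕜] (u : Plane → 𝕜) : Prop :=
  MemLp u 2 volume ∧
    ∃ g : Plane → EuclideanSpace 𝕜 (Fin 2), MemLp g 2 volume ∧ IsWeakGradient u g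

open Classical in
/-- The weak gradient `∇u` of a function `u ∈ H¹(ℝ²)`, which is unique up to null sets (see
`IsWeakGradient.ae_eq`); by convention `0` when there is no square integrable weak gradient. -/
def weakGradient {𝕜 : Type*} [RCLike 𝕜] (u : Plane → 𝕜) : Plane → EuclideanSpace 𝕜 (Fin 2) :=
  if h : ∃ g : Plane → EuclideanSpace 𝕜 (Fin 2), MemLp g 2 volume ∧ IsWeakGradient u g
  then h.choose else 0

/-- Square integrable weak gradients are unique almost everywhere, so that `‖∇u‖_{L²}` does not
depend on the choice made in `weakGradient`. -/
theorem IsWeakGradient.ae_eq {𝕜 : Type*} [RCLike 𝕜] {u : Plane → 𝕜}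
    {g g' : Plane → EuclideanSpace 𝕜 (Fin 2)} (hg : IsWeakGradient u g)
    (hg' : IsWeakGradient u g') (h2 : MemLp g 2 volume) (h2' : MemLp g' 2 volume) :
    g =ᵐ[volume] g' := by
  have key : ∀ i : Fin 2, ∀ᵐ x ∂(volume : Measure Plane), g x i = g' x i := by
    intro i
    have loc : ∀ f : Plane → EuclideanSpace 𝕜 (Fin 2), MemLp f 2 volume →
        LocallyIntegrable (fun x => f x i) volume := fun f hf =>
      ((EuclideanSpace.proj i : EuclideanSpace 𝕜 (Fin 2) →L[𝕜] 𝕜).comp_memLp' hf).locallyIntegrable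
        (by norm_num)
    refine ae_eq_of_integral_contDiff_smul_eq (loc g h2) (loc g' h2') fun φ hφ hc => ?_
    have h := (hg φ hφ hc i).symm.trans (hg' φ hφ hc i)
    exact neg_injective h
  filter_upwards [key 0, key 1] with x h0 h1
  ext i
  fin_cases i
  · exact h0
  · exact h1

/-- The `L^p(ℝ²)` norm as a real number. -/
def LpNorm {F : Type*} [NormedAddCommGroup F] (p : ENNReal) (f : Plane → F) : ℝ :=
  (eLpNorm f p volume).toReal

/-- The functional `F_α(u) = ‖∇u‖₂^{2/(1+α)} ‖u‖₂^{(2+α)/(1+α)} ‖u‖₆^{3α/(1+α)} / ‖u‖₄⁴`. -/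
def functionalF {𝕜 : Type*} [RCLike 𝕜] (α : ℝ) (u : Plane → 𝕜) : ℝ :=
  LpNorm 2 (weakGradient u) ^ (2 / (1 + α)) * LpNorm 2 u ^ ((2 + α) / (1 + α)) *
    LpNorm 6 u ^ (3 * α / (1 + α)) / LpNorm 4 u ^ 4

/-- `H¹(ℝ²) ∖ {0}`, for `𝕜`-valued functions; `u = 0` in `H¹` means `u = 0` almost everywhere. -/
def nonzeroH1 (𝕜 : Type*) [RCLike 𝕜] : Set (Plane → 𝕜) :=
  {u | MemH1 u ∧ ¬ u =ᵐ[volume] 0}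

/-- `C_α`, the infimum of `F_α` over `H¹(ℝ²) ∖ {0}`. -/
def infimumC (𝕜 : Type*) [RCLike 𝕜] (α : ℝ) : ℝ :=
  sInf (functionalF α '' nonzeroH1 𝕜)

end GagliardoNirenberg

end

open MeasureTheory
open scoped ContDiff

noncomputable section

namespace GagliardoNirenberg

/-! The functional is invariant under `u ↦ l * u (m • ·)`, so a minimizing sequence can be
normalized to `∫ u² = ∫ u⁴ = 1`. If it also consists of nonnegative radially nonincreasing
functions, it is compact enough. Monotonicity gives almost everywhere convergence along a
subsequence, by Helly's selection theorem. Interpolation between `L²` and `L⁶`, together with the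
decay forced by monotonicity, prevents any loss of `∫ u⁴`. The other three norms are lower
semicontinuous, so the limit is a minimizer.

The gradient norm is handled through a nonlocal substitute. `EnergyLE u A` bounds the integral of
`|u(x+h) - u(x)|²` over `|h| < ε` by the second moment of the disc times `A²`, for every `ε`. A weak
gradient gives this by integration along segments and Jensen's inequality
(`IsWeakGradient.energyLE`). Conversely, testing against divergences, letting `ε → 0` and applying
Riesz representation recovers a weak gradient with norm at most `A` and no loss in the constant
(`EnergyLE.exists_isWeakGradient`). Every operation below is transparent for gap energies: absolute
values and truncations contract differences, mollification is Jensen, lower semicontinuity is Fatou,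
dilations are a change of variables, and reflections act on a symmetric kernel.

A weak-type comparison of the super-level sets at heights `t` and `2t` gives `∫ w^(q+2) ≤ K A² ∫
w^q` (`lintegral_pow_add_two_le`). Hence `L⁴` and `L⁶` integrals are finite, and a normalized
function cannot have small gradient.

Symmetrization is obtained from polarization, the two-point rearrangement across a line.
Polarization preserves power integrals and Lipschitz constants and does not increase gap energies
(`gapEnergy_polarize_le`). Among all Lipschitz competitors one minimizes `∫ |x|² v`. Polarizing the
minimizer across a line missing the origin cannot lower this moment, so the minimizer is already
larger on the side of the origin. Applied to all perpendicular bisectors, this says that it is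
radially nonincreasing (`exists_radial_of_lipschitz`). General `H¹` functions are first replaced by
`|u|` and approximated by Lipschitz functions of compact support (`exists_lipschitz_approx`). -/

/-! ### Gap energies and second moments of discs -/

/-- The energy of the differences of `u` over pairs of points at distance less than `ε`. -/
def gapEnergy {F : Type*} [NormedAddCommGroup F] (ε : ℝ) (u : Plane → F) : ENNReal :=
  ∫⁻ h in Metric.ball (0 : Plane) ε, ∫⁻ x, ‖u (x + h) - u x‖ₑ ^ 2

/-- The second moment of the disc of radius `ε` in a coordinate direction. -/
def secondMoment (ε : ℝ) : ℝ := ∫ h in Metric.ball (0 : Plane) ε, h 0 ^ 2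

/-- The bound on all gap energies of `u` that is equivalent to `‖∇u‖_{L²} ≤ A`. -/
def EnergyLE {F : Type*} [NormedAddCommGroup F] (u : Plane → F) (A : ℝ) : Prop :=
  ∀ ε, 0 < ε → gapEnergy ε u ≤ ENNReal.ofReal (secondMoment ε * A ^ 2)

theorem enorm_sq_eq_ofReal {F : Type*} [NormedAddCommGroup F] (a : F) :
    ‖a‖ₑ ^ 2 = ENNReal.ofReal (‖a‖ ^ 2) := by
  rw [← ofReal_norm, ENNReal.ofReal_pow (norm_nonneg a)]

theorem enorm_sq_eq_ofReal_sq (a : ℝ) : ‖a‖ₑ ^ 2 = ENNReal.ofReal (a ^ 2) := by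
  rw [enorm_sq_eq_ofReal, Real.norm_eq_abs, sq_abs]

theorem integrableOn_ball_of_continuous {F : Type*} [NormedAddCommGroup F] {f : Plane → F}
    (hf : Continuous f) (x : Plane) (ε : ℝ) : IntegrableOn f (Metric.ball x ε) :=
  (hf.continuousOn.integrableOn_compact (isCompact_closedBall x ε)).mono_set
    Metric.ball_subset_closedBall

theorem setIntegral_ball_comp_isometry {F : Type*} [NormedAddCommGroup F] [NormedSpace ℝ F]
    (e : Plane ≃ₗᵢ[ℝ] Plane) (f : Plane → F) (ε : ℝ) :
    ∫ h in Metric.ball (0 : Plane) ε, f (e h) = ∫ h in Metric.ball (0 : Plane) ε, f h := by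
  have := e.measurePreserving.setIntegral_preimage_emb
    e.toHomeomorph.measurableEmbedding f (Metric.ball 0 ε)
  simpa using this

/-- The coordinate swap. -/
def swapIso : Plane ≃ₗᵢ[ℝ] Plane :=
  LinearIsometryEquiv.piLpCongrLeft 2 ℝ ℝ (Equiv.swap 0 1)

/-- The reflection in the second coordinate axis. -/
def flipIso : Plane ≃ₗᵢ[ℝ] Plane :=
  LinearIsometryEquiv.piLpCongrRight 2
    (fun i => if i = 0 then LinearIsometryEquiv.neg ℝ else LinearIsometryEquiv.refl ℝ ℝ)

theorem setIntegral_ball_sq_one (ε : ℝ) :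
    ∫ h in Metric.ball (0 : Plane) ε, h 1 ^ 2 = secondMoment ε := by
  rw [secondMoment, ← setIntegral_ball_comp_isometry swapIso]
  simp [swapIso]

/-- The reflection `flipIso` preserves the disc and changes the sign of the integrand. -/
theorem setIntegral_ball_mul (ε : ℝ) :
    ∫ h in Metric.ball (0 : Plane) ε, h 0 * h 1 = 0 := by
  have := setIntegral_ball_comp_isometry flipIso (fun h => h 0 * h 1) ε
  simp only [flipIso, LinearIsometryEquiv.piLpCongrRight_apply] at this
  simp [integral_neg] at this
  linarith

/-- Two powers of `ε` come from the integrand and two from the Jacobian. -/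
theorem secondMoment_eq (ε : ℝ) (hε : 0 < ε) : secondMoment ε = ε ^ 4 * secondMoment 1 := by
  have h := Measure.setIntegral_comp_smul (volume : Measure Plane) (fun h => h 0 ^ 2)
    (Metric.ball 0 1) hε.ne'
  rw [smul_unitBall hε.ne'] at h
  simp [mul_pow, integral_const_mul] at h
  simp only [secondMoment, abs_of_pos hε] at *
  field_simp at h
  linarith

theorem secondMoment_one_pos : 0 < secondMoment 1 := by
  rw [secondMoment, setIntegral_pos_iff_support_of_nonneg_ae
    (Filter.Eventually.of_forall fun _ => sq_nonneg _)
    (integrableOn_ball_of_continuous (by fun_prop) _ _)]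
  have ho : IsOpen ((Function.support fun h : Plane => h 0 ^ 2) ∩ Metric.ball 0 1) :=
    (Continuous.isOpen_support (by fun_prop)).inter Metric.isOpen_ball
  refine ho.measure_pos _ ⟨EuclideanSpace.single 0 (1 / 2), ?_, ?_⟩
  · simp
  · simp; norm_num

theorem secondMoment_pos {ε : ℝ} (hε : 0 < ε) : 0 < secondMoment ε := by
  rw [secondMoment_eq ε hε]
  have := secondMoment_one_pos
  positivity

/-- By symmetry the second-moment matrix of a disc is a multiple of the identity, so averaging the
squared directional derivative over `h` returns the full `‖b‖²`. This isotropy is why the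
equivalence with the gradient norm is exact. -/
theorem setLIntegral_ball_enorm_sq {𝕜 : Type*} [RCLike 𝕜] (ε : ℝ)
    (b : EuclideanSpace 𝕜 (Fin 2)) :
    ∫⁻ h in Metric.ball (0 : Plane) ε, ‖∑ i, h i • b i‖ₑ ^ 2 =
      ENNReal.ofReal (secondMoment ε) * ‖b‖ₑ ^ 2 := by
  have key : ∀ h : Plane, ‖∑ i, h i • b i‖ ^ 2 =
      h 0 ^ 2 * ‖b 0‖ ^ 2 + h 1 ^ 2 * ‖b 1‖ ^ 2 + h 0 * h 1 * (2 * inner ℝ (b 0) (b 1)) := by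
    intro h
    rw [Fin.sum_univ_two, norm_add_sq_real, real_inner_smul_left, real_inner_smul_right,
      norm_smul, norm_smul]
    simp only [mul_pow, Real.norm_eq_abs, sq_abs]
    ring
  simp_rw [enorm_sq_eq_ofReal]
  rw [← ofReal_integral_eq_lintegral_ofReal
    (integrableOn_ball_of_continuous (by fun_prop) _ _)
    (Filter.Eventually.of_forall fun _ => by positivity)]
  have i0 : IntegrableOn (fun h : Plane => h 0 ^ 2 * ‖b 0‖ ^ 2) (Metric.ball 0 ε) :=
    integrableOn_ball_of_continuous (by fun_prop) _ _
  have i1 : IntegrableOn (fun h : Plane => h 1 ^ 2 * ‖b 1‖ ^ 2) (Metric.ball 0 ε) :=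
    integrableOn_ball_of_continuous (by fun_prop) _ _
  have i2 : IntegrableOn (fun h : Plane => h 0 * h 1 * (2 * inner ℝ (b 0) (b 1)))
      (Metric.ball 0 ε) :=
    integrableOn_ball_of_continuous (by fun_prop) _ _
  have hm : 0 ≤ secondMoment ε := integral_nonneg fun _ => sq_nonneg _
  rw [← ENNReal.ofReal_mul hm]
  congr 1
  simp_rw [key]
  rw [integral_add (by exact i0.add i1) i2, integral_add i0 i1, integral_mul_const, integral_mul_const,
    integral_mul_const, setIntegral_ball_mul, setIntegral_ball_sq_one, EuclideanSpace.norm_sq_eq,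
    Fin.sum_univ_two, secondMoment]
  ring

theorem gapEnergy_congr_ae {F : Type*} [NormedAddCommGroup F] {u v : Plane → F}
    (h : u =ᵐ[volume] v) (ε : ℝ) : gapEnergy ε u = gapEnergy ε v := by
  refine lintegral_congr fun k => lintegral_congr_ae ?_
  have hk := (measurePreserving_add_right volume k).quasiMeasurePreserving.ae_eq_comp h
  filter_upwards [h, hk] with x hx hxk
  simp only [Function.comp_apply] at hxk
  rw [hx, hxk]

/-- Serves for passing to the absolute value and for truncation, both of which contract differences.
-/
theorem gapEnergy_mono {F G : Type*} [NormedAddCommGroup F] [NormedAddCommGroup G] {u : Plane → F}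
    {v : Plane → G} (h : ∀ x y, ‖u x - u y‖ ≤ ‖v x - v y‖) (ε : ℝ) :
    gapEnergy ε u ≤ gapEnergy ε v := by
  refine lintegral_mono fun k => lintegral_mono fun x => ?_
  gcongr
  exact enorm_le_iff_norm_le.2 (h _ _)

theorem EnergyLE.of_gapEnergy_le {F G : Type*} [NormedAddCommGroup F] [NormedAddCommGroup G]
    {u : Plane → F} {v : Plane → G} {A : ℝ} (hv : EnergyLE v A)
    (h : ∀ ε, gapEnergy ε u ≤ gapEnergy ε v) : EnergyLE u A :=
  fun ε hε => (h ε).trans (hv ε hε)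

theorem lintegral_comp_smul {r : ℝ} (hr : r ≠ 0) (f : Plane → ENNReal) :
    ∫⁻ x, f (r • x) = ENNReal.ofReal (r⁻¹ ^ 2) * ∫⁻ x, f x := by
  have h := lintegral_map_equiv f (μ := (volume : Measure Plane))
    (Homeomorph.smulOfNeZero r hr).toMeasurableEquiv
  have h2 := Measure.map_addHaar_smul (volume : Measure Plane) hr
  simp only [finrank_euclideanSpace, Fintype.card_fin] at h2
  rw [abs_of_nonneg (by positivity)] at h2
  have h3 : Measure.map (⇑(Homeomorph.smulOfNeZero r hr).toMeasurableEquiv)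
      (volume : Measure Plane) = ENNReal.ofReal (r ^ 2)⁻¹ • volume := h2
  rw [h3, lintegral_smul_measure] at h
  rw [inv_pow]
  exact h.symm

theorem gapEnergy_comp_smul {F : Type*} [NormedAddCommGroup F] {u : Plane → F}
    {r : ℝ} (hr : 0 < r) (ε : ℝ) :
    gapEnergy ε (fun x => u (r • x)) = ENNReal.ofReal (r⁻¹ ^ 4) * gapEnergy (r * ε) u := by
  have h1 : ∀ h : Plane, ∫⁻ x, ‖u (r • (x + h)) - u (r • x)‖ₑ ^ 2 =
      ENNReal.ofReal (r⁻¹ ^ 2) * ∫⁻ x, ‖u (x + r • h) - u x‖ₑ ^ 2 := by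
    intro h
    rw [← lintegral_comp_smul hr.ne' (fun x => ‖u (x + r • h) - u x‖ₑ ^ 2)]
    simp only [smul_add]
  simp only [gapEnergy, h1]
  rw [lintegral_const_mul' _ _ ENNReal.ofReal_ne_top, ← lintegral_indicator measurableSet_ball,
    ← lintegral_indicator measurableSet_ball]
  have h2 : (fun h : Plane => (Metric.ball (0 : Plane) ε).indicator
      (fun h => ∫⁻ x, ‖u (x + r • h) - u x‖ₑ ^ 2) h) = fun h =>
      (Metric.ball (0 : Plane) (r * ε)).indicator
        (fun h => ∫⁻ x, ‖u (x + h) - u x‖ₑ ^ 2) (r • h) := by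
    funext h
    have : r • h ∈ Metric.ball (0 : Plane) (r * ε) ↔ h ∈ Metric.ball (0 : Plane) ε := by
      simp [norm_smul, abs_of_pos hr, hr]
    by_cases hh : h ∈ Metric.ball (0 : Plane) ε
    · rw [Set.indicator_of_mem hh, Set.indicator_of_mem (this.2 hh)]
    · rw [Set.indicator_of_notMem hh, Set.indicator_of_notMem (this.not.2 hh)]
  rw [h2, lintegral_comp_smul hr.ne', ← mul_assoc, ← ENNReal.ofReal_mul (by positivity)]
  congr 2
  ring

/-- In dimension two the gradient norm is dilation invariant: the factor `r⁻¹ ^ 4` from the two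
changes of variables cancels the fourth-power homogeneity of `secondMoment`. -/
theorem EnergyLE.comp_smul {F : Type*} [NormedAddCommGroup F] {u : Plane → F} {A r : ℝ}
    (h : EnergyLE u A) (hr : 0 < r) : EnergyLE (fun x => u (r • x)) A := by
  intro ε hε
  rw [gapEnergy_comp_smul hr]
  calc _ ≤ ENNReal.ofReal (r⁻¹ ^ 4) * ENNReal.ofReal (secondMoment (r * ε) * A ^ 2) := by
        gcongr; exact h _ (by positivity)
    _ = _ := by
        rw [← ENNReal.ofReal_mul (by positivity), secondMoment_eq ε hε,
          secondMoment_eq (r * ε) (by positivity)]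
        congr 1
        field_simp

theorem EnergyLE.const_mul {u : Plane → ℝ} {A : ℝ} (h : EnergyLE u A) (c : ℝ) :
    EnergyLE (fun x => c * u x) (c * A) := by
  intro ε hε
  have h1 : gapEnergy ε (fun x => c * u x) = ‖c‖ₑ ^ 2 * gapEnergy ε u := by
    simp only [gapEnergy, ← mul_sub, enorm_mul, mul_pow]
    simp_rw [lintegral_const_mul' _ _ (ENNReal.pow_ne_top enorm_ne_top)]
  rw [h1, enorm_sq_eq_ofReal_sq]
  calc _ ≤ ENNReal.ofReal (c ^ 2) * ENNReal.ofReal (secondMoment ε * A ^ 2) := by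
        gcongr; exact h _ hε
    _ = _ := by
        rw [← ENNReal.ofReal_mul (by positivity)]
        congr 1
        ring

/-! ### From a weak gradient to bounds on gap energies -/

/-- Hölder's inequality against the constant `1`, which has norm one for a probability measure. -/
theorem lintegral_pow_le_lintegral_pow {Ω : Type*} [MeasurableSpace Ω] {ν : Measure Ω}
    [IsProbabilityMeasure ν] {f : Ω → ENNReal} (hf : AEMeasurable f ν) {p : ℕ} (hp : 2 ≤ p) :
    (∫⁻ a, f a ∂ν) ^ p ≤ ∫⁻ a, f a ^ p ∂ν := by
  have hp1 : (1 : ℝ) < p := by exact_mod_cast hp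
  have h := ENNReal.lintegral_mul_le_Lp_mul_Lq ν (Real.HolderConjugate.conjExponent hp1) hf
    (aemeasurable_const (b := (1 : ENNReal)))
  simp only [Pi.mul_apply, mul_one, ENNReal.one_rpow, lintegral_const, measure_univ,
    ENNReal.rpow_natCast] at h
  calc (∫⁻ a, f a ∂ν) ^ p ≤ ((∫⁻ a, f a ^ p ∂ν) ^ (1 / (p : ℝ))) ^ p := by gcongr
    _ = _ := by
      rw [← ENNReal.rpow_natCast, ← ENNReal.rpow_mul, one_div_mul_cancel (by positivity),
        ENNReal.rpow_one]

theorem enorm_integral_pow_le {Ω F : Type*} [MeasurableSpace Ω] {ν : Measure Ω}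
    [IsProbabilityMeasure ν] [NormedAddCommGroup F] [NormedSpace ℝ F] {f : Ω → F}
    (hf : AEStronglyMeasurable f ν) {p : ℕ} (hp : 2 ≤ p) :
    ‖∫ a, f a ∂ν‖ₑ ^ p ≤ ∫⁻ a, ‖f a‖ₑ ^ p ∂ν :=
  (pow_le_pow_left' (enorm_integral_le_lintegral_enorm f) p).trans
    (lintegral_pow_le_lintegral_pow hf.enorm hp)

theorem sub_eq_integral_fderiv {φ : Plane → ℝ} (hφ : ContDiff ℝ ∞ φ) (x h : Plane) :
    φ (x - h) - φ x = - ∫ s : unitInterval, fderiv ℝ φ (x - (s : ℝ) • h) h := by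
  have hd : ∀ s ∈ Set.uIcc (0 : ℝ) 1, HasDerivAt (fun s : ℝ => φ (x - s • h))
      (- fderiv ℝ φ (x - s • h) h) s := by
    intro s _
    have h1 : HasDerivAt (fun s : ℝ => x - s • h) (-h) s := by
      simpa using ((hasDerivAt_id s).smul_const h).const_sub x
    have h2 := ((hφ.differentiable (by simp)) (x - s • h)).hasFDerivAt.comp_hasDerivAt s h1
    simpa [Function.comp_def] using h2
  have hc : Continuous fun s : ℝ => - fderiv ℝ φ (x - s • h) h := by
    have := hφ.continuous_fderiv (by simp)
    fun_prop
  have h3 := intervalIntegral.integral_eq_sub_of_hasDerivAt hd (hc.intervalIntegrable 0 1)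
  rw [intervalIntegral.integral_of_le zero_le_one, ← integral_Icc_eq_integral_Ioc,
    integral_neg] at h3
  rw [integral_subtype measurableSet_Icc (fun s : ℝ => fderiv ℝ φ (x - s • h) h)]
  simpa using h3.symm

/-- For each fixed `s` the map is a translation. It transfers integrability of a function of `x` to
`(s, x) ↦ k (x + s • h)`, as Fubini's theorem requires. -/
theorem measurePreserving_shear (h : Plane) :
    MeasurePreserving (fun p : unitInterval × Plane => (p.1, p.2 + (p.1 : ℝ) • h))
      ((volume : Measure unitInterval).prod volume) (volume.prod volume) := by
  refine (MeasurePreserving.id _).skew_product (g := fun (s : unitInterval) (x : Plane) =>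
    x + (s : ℝ) • h) (by fun_prop) (Filter.Eventually.of_forall fun s => ?_)
  exact map_add_right_eq_self volume _

/-- A function with weak directional derivative `k` along `h` is the integral of `k` over segments
in the direction `h`. -/
theorem translate_sub_ae_eq_integral {𝕜 : Type*} [RCLike 𝕜] {u k : Plane → 𝕜} {h : Plane}
    (hu : LocallyIntegrable u) (hk : LocallyIntegrable k)
    (hw : ∀ φ : Plane → ℝ, ContDiff ℝ ∞ φ → HasCompactSupport φ →
      ∫ x, fderiv ℝ φ x h • u x = - ∫ x, φ x • k x) :
    ∀ᵐ x, u (x + h) - u x = ∫ s : unitInterval, k (x + (s : ℝ) • h) := by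
  -- The functions are only locally integrable, so joint integrability is obtained after cutting off
  -- to a disc. The disc is later taken so large that the compact support of `φ` hides the cutoff.
  have hball : ∀ (f : Plane → 𝕜) (R : ℝ), LocallyIntegrable f →
      Integrable (fun p : unitInterval × Plane => (Metric.closedBall 0 R).indicator f p.2)
        (volume.prod volume) := fun f R hf =>
    (((hf.integrableOn_isCompact (isCompact_closedBall 0 R)).integrable_indicator
      measurableSet_closedBall).comp_snd _)
  have hshift : ∀ R : ℝ, Integrable (fun p : unitInterval × Plane =>
      (Metric.closedBall 0 R).indicator k (p.2 + (p.1 : ℝ) • h)) (volume.prod volume) :=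
    fun R => (measurePreserving_shear h).integrable_comp_of_integrable (hball k R hk)
  have hnorm : ∀ s : unitInterval, ‖(s : ℝ) • h‖ ≤ ‖h‖ := fun s => by
    rw [norm_smul, Real.norm_of_nonneg s.2.1]
    exact mul_le_of_le_one_left (norm_nonneg _) s.2.2
  refine ae_eq_of_integral_contDiff_smul_eq (f := fun x => u (x + h) - u x) ?_ ?_ ?_
  · refine LocallyIntegrable.sub ?_ hu
    have := (measurePreserving_add_right (volume : Measure Plane) h)
    rw [locallyIntegrable_iff] at hu ⊢
    intro K hK
    have hK' := hu ((Homeomorph.addRight h) '' K) (hK.image (Homeomorph.addRight h).continuous)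
    have := this.integrableOn_comp_preimage
      (Homeomorph.addRight h).measurableEmbedding (f := u) (s := (Homeomorph.addRight h) '' K)
    rw [Homeomorph.coe_addRight, Set.preimage_image_eq _ (add_left_injective h)] at this
    exact this.2 hK'
  · rw [locallyIntegrable_iff]
    intro K hK
    obtain ⟨R, hR⟩ := hK.isBounded.subset_closedBall (0 : Plane)
    refine IntegrableOn.mono_set ?_ hR
    have h1 := (hshift (R + ‖h‖)).integral_prod_right.integrableOn
      (s := Metric.closedBall (0 : Plane) R)
    refine h1.congr_fun (fun x hx => ?_) measurableSet_closedBall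
    refine integral_congr_ae (Filter.Eventually.of_forall fun s => ?_)
    refine Set.indicator_of_mem ?_ _
    rw [mem_closedBall_zero_iff] at hx ⊢
    exact (norm_add_le _ _).trans (add_le_add hx (hnorm s))
  intro φ hφ hc
  obtain ⟨R, hR⟩ := hc.isBounded.subset_closedBall (0 : Plane)
  have hφ0 : ∀ x, x ∉ Metric.closedBall (0 : Plane) R → φ x = 0 := fun x hx =>
    image_eq_zero_of_notMem_tsupport fun h => hx (hR h)
  have hφ1 : ∀ x, x ∉ Metric.closedBall (0 : Plane) R → fderiv ℝ φ x = 0 := fun x hx =>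
    fderiv_of_notMem_tsupport ℝ fun h => hx (hR h)
  obtain ⟨C, hC⟩ := hc.exists_bound_of_continuous hφ.continuous
  have hfc := hφ.continuous_fderiv (by simp)
  obtain ⟨C', hC'⟩ := (hc.fderiv ℝ).exists_bound_of_continuous hfc
  have hsub : ∀ (x : Plane) (s : unitInterval), x ∉ Metric.closedBall (0 : Plane) (R + ‖h‖) →
      x - (s : ℝ) • h ∉ Metric.closedBall (0 : Plane) R := by
    intro x s hx hx'
    rw [mem_closedBall_zero_iff] at hx hx'
    have := norm_add_le (x - (s : ℝ) • h) ((s : ℝ) • h)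
    rw [sub_add_cancel] at this
    linarith [hnorm s]
  have iu : ∀ a : Plane, Integrable (fun x => φ (x - a) • u x) := by
    intro a
    refine hu.integrable_smul_left_of_hasCompactSupport (by fun_prop) ?_
    exact hc.comp_homeomorph (Homeomorph.subRight a)
  -- The identity is tested against `φ`: the translation moves onto `φ`, the difference of `φ`
  -- becomes an integral of its derivative along the segment, Fubini isolates each `s`, the weak
  -- derivative applies to the shifted test function, and Fubini is undone.
  have e1 : ∫ x, φ x • (u (x + h) - u x) = ∫ x, (φ (x - h) - φ x) • u x := by
    have i0 := iu 0
    have ih := (iu h).comp_add_right h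
    simp only [sub_zero, add_sub_cancel_right] at i0 ih
    simp only [smul_sub, sub_smul]
    rw [integral_sub ih i0, integral_sub (iu h) i0]
    congr 1
    rw [← integral_add_right_eq_self (fun x => φ (x - h) • u x) h]
    simp only [add_sub_cancel_right]
  have e2 : ∫ x, (φ (x - h) - φ x) • u x =
      - ∫ x, ∫ s : unitInterval, fderiv ℝ φ (x - (s : ℝ) • h) h • u x := by
    rw [← integral_neg]
    congr 1 with x
    rw [sub_eq_integral_fderiv hφ, neg_smul, integral_smul_const]
  have e3 : ∫ x, ∫ s : unitInterval, fderiv ℝ φ (x - (s : ℝ) • h) h • u x =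
      ∫ s : unitInterval, ∫ x, fderiv ℝ φ (x - (s : ℝ) • h) h • u x := by
    rw [integral_integral_swap]
    have h1 : Integrable (fun p : unitInterval × Plane => fderiv ℝ φ (p.2 - (p.1 : ℝ) • h) h •
        (Metric.closedBall 0 (R + ‖h‖)).indicator u p.2) (volume.prod volume) := by
      refine (hball u (R + ‖h‖) hu).bdd_smul (φ := fun p : unitInterval × Plane =>
        fderiv ℝ φ (p.2 - (p.1 : ℝ) • h) h) (C' * ‖h‖) ?_ ?_
      · exact Continuous.aestronglyMeasurable (by fun_prop)
      · exact Filter.Eventually.of_forall fun p => (ContinuousLinearMap.le_opNorm _ _).trans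
          (mul_le_mul_of_nonneg_right (hC' _) (norm_nonneg _))
    refine h1.swap.congr (Filter.Eventually.of_forall fun p => ?_)
    by_cases hp : p.1 ∈ Metric.closedBall (0 : Plane) (R + ‖h‖)
    · simp [Function.uncurry, Set.indicator_of_mem hp]
    · simp [Function.uncurry, hφ1 _ (hsub _ _ hp)]
  have e4 : ∀ s : unitInterval, ∫ x, fderiv ℝ φ (x - (s : ℝ) • h) h • u x =
      - ∫ x, φ x • k (x + (s : ℝ) • h) := by
    intro s
    have h1 := hw (fun x => φ (x - (s : ℝ) • h)) (by fun_prop)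
      (hc.comp_homeomorph (Homeomorph.subRight ((s : ℝ) • h)))
    simp only [fderiv_comp_sub] at h1
    rw [h1, ← integral_add_right_eq_self _ ((s : ℝ) • h)]
    simp
  have e5 : ∫ s : unitInterval, ∫ x, φ x • k (x + (s : ℝ) • h) =
      ∫ x, φ x • ∫ s : unitInterval, k (x + (s : ℝ) • h) := by
    rw [integral_integral_swap]
    · simp only [integral_smul]
    have h1 : Integrable (fun p : unitInterval × Plane => φ p.2 •
        (Metric.closedBall 0 (R + ‖h‖)).indicator k (p.2 + (p.1 : ℝ) • h)) (volume.prod volume) := by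
      refine (hshift (R + ‖h‖)).bdd_smul (φ := fun p : unitInterval × Plane => φ p.2) C ?_ ?_
      · exact Continuous.aestronglyMeasurable (by fun_prop)
      · exact Filter.Eventually.of_forall fun p => hC _
    refine h1.congr (Filter.Eventually.of_forall fun p => ?_)
    by_cases hp : p.2 ∈ Metric.closedBall (0 : Plane) R
    · rw [mem_closedBall_zero_iff] at hp
      have : p.2 + (p.1 : ℝ) • h ∈ Metric.closedBall (0 : Plane) (R + ‖h‖) := by
        rw [mem_closedBall_zero_iff]
        exact (norm_add_le _ _).trans (add_le_add hp (hnorm _))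
      simp [Function.uncurry, Set.indicator_of_mem this]
    · simp [Function.uncurry, hφ0 _ hp]
  rw [e1, e2, e3]
  simp only [e4]
  rw [integral_neg, neg_neg, e5]

/-- The difference `u (x + h) - u x` is the mean of `h · ∇u` over a segment. Jensen's inequality and
translation invariance bound its square integral by that of `h · ∇u`, and integrating over the disc
of `h` turns this into `‖∇u‖²` times the second moment. -/
theorem IsWeakGradient.energyLE {𝕜 : Type*} [RCLike 𝕜] {u : Plane → 𝕜}
    {g : Plane → EuclideanSpace 𝕜 (Fin 2)} (hw : IsWeakGradient u g) (hu : MemLp u 2 volume)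
    (hg : MemLp g 2 volume) : EnergyLE u (LpNorm 2 g) := by
  -- A strongly measurable representative, so that the integrands of two variables below are jointly
  -- measurable.
  obtain ⟨g', hg'm, hgg'⟩ := hg.1
  have hg' : MemLp g' 2 volume := hg.ae_eq hgg'
  have hw' : IsWeakGradient u g' := by
    intro φ hφ hc i
    rw [hw φ hφ hc i]
    congr 1
    refine integral_congr_ae ?_
    filter_upwards [hgg'] with x hx
    rw [hx]
  have hk : ∀ h : Plane, MemLp (fun x => ∑ i, h i • g' x i) 2 volume := fun h =>
    memLp_finsetSum _ fun i _ =>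
      ((EuclideanSpace.proj i : EuclideanSpace 𝕜 (Fin 2) →L[𝕜] 𝕜).comp_memLp' hg').const_smul (h i)
  have hcoord : ∀ i, LocallyIntegrable (fun x => g' x i) volume := fun i =>
    ((EuclideanSpace.proj i : EuclideanSpace 𝕜 (Fin 2) →L[𝕜] 𝕜).comp_memLp' hg').locallyIntegrable
      (by norm_num)
  have hkm : ∀ h : Plane, StronglyMeasurable (fun x => ∑ i, h i • g' x i) := fun h =>
    Finset.stronglyMeasurable_fun_sum _ fun i _ =>
      ((EuclideanSpace.proj i : EuclideanSpace 𝕜 (Fin 2) →L[𝕜] 𝕜).continuous.comp_stronglyMeasurable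
        hg'm).const_smul (h i)
  have hdir : ∀ h : Plane, ∀ φ : Plane → ℝ, ContDiff ℝ ∞ φ → HasCompactSupport φ →
      ∫ x, fderiv ℝ φ x h • u x = - ∫ x, φ x • ∑ i, h i • g' x i := by
    intro h φ hφ hc
    have hfc := hφ.continuous_fderiv (by simp)
    have hh : h = ∑ i, h i • EuclideanSpace.single i (1 : ℝ) := by
      ext j; fin_cases j <;> simp
    have h1 : ∀ x, fderiv ℝ φ x h • u x =
        ∑ i, h i • (fderiv ℝ φ x (EuclideanSpace.single i 1) • u x) := by
      intro x
      conv_lhs => rw [hh]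
      simp only [map_sum, map_smul, smul_eq_mul, Finset.sum_smul, mul_smul]
    simp only [h1, Finset.smul_sum]
    rw [integral_finsetSum, integral_finsetSum, ← Finset.sum_neg_distrib]
    · refine Finset.sum_congr rfl fun i _ => ?_
      rw [integral_smul, hw' φ hφ hc i, smul_neg, ← integral_smul]
      congr 2 with x
      rw [smul_comm]
    · intro i _
      simp only [smul_comm _ (h i)]
      exact ((hcoord i).integrable_smul_left_of_hasCompactSupport hφ.continuous hc).smul (h i)
    · intro i _
      refine Integrable.smul (h i) ?_
      exact (hu.locallyIntegrable (by norm_num)).integrable_smul_left_of_hasCompactSupport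
        (hfc.clm_apply continuous_const) (hc.fderiv_apply ℝ _)
  intro ε hε
  have hpt : ∀ h : Plane, ∫⁻ x, ‖u (x + h) - u x‖ₑ ^ 2 ≤ ∫⁻ x, ‖∑ i, h i • g' x i‖ₑ ^ 2 := by
    intro h
    have h1 := translate_sub_ae_eq_integral (hu.locallyIntegrable (by norm_num))
      ((hk h).locallyIntegrable (by norm_num)) (hdir h)
    calc ∫⁻ x, ‖u (x + h) - u x‖ₑ ^ 2
        = ∫⁻ x, ‖∫ s : unitInterval, ∑ i, h i • g' (x + (s : ℝ) • h) i‖ₑ ^ 2 := by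
          refine lintegral_congr_ae ?_
          filter_upwards [h1] with x hx
          rw [hx]
      _ ≤ ∫⁻ x, ∫⁻ s : unitInterval, ‖∑ i, h i • g' (x + (s : ℝ) • h) i‖ₑ ^ 2 := by
          refine lintegral_mono fun x => enorm_integral_pow_le ?_ le_rfl
          exact ((hkm h).comp_measurable (g := fun s : unitInterval => x + (s : ℝ) • h)
            (by fun_prop)).aestronglyMeasurable
      _ = ∫⁻ s : unitInterval, ∫⁻ x, ‖∑ i, h i • g' (x + (s : ℝ) • h) i‖ₑ ^ 2 := by
          refine lintegral_lintegral_swap ?_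
          exact (((hkm h).comp_measurable (g := fun p : Plane × unitInterval =>
            p.1 + (p.2 : ℝ) • h) (by fun_prop)).enorm.pow_const 2).aemeasurable
      _ = ∫⁻ _ : unitInterval, ∫⁻ x, ‖∑ i, h i • g' x i‖ₑ ^ 2 := by
          refine lintegral_congr fun s => ?_
          exact lintegral_add_right_eq_self (fun x => ‖∑ i, h i • g' x i‖ₑ ^ 2) _
      _ = _ := by simp
  calc gapEnergy ε u ≤ ∫⁻ h in Metric.ball (0 : Plane) ε, ∫⁻ x, ‖∑ i, h i • g' x i‖ₑ ^ 2 :=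
        lintegral_mono hpt
    _ = ∫⁻ x, ∫⁻ h in Metric.ball (0 : Plane) ε, ‖∑ i, h i • g' x i‖ₑ ^ 2 := by
        refine lintegral_lintegral_swap ?_
        have : StronglyMeasurable (fun p : Plane × Plane => ∑ i, p.1 i • g' p.2 i) := by
          refine Finset.stronglyMeasurable_fun_sum _ fun i _ => ?_
          refine StronglyMeasurable.smul (f := fun p : Plane × Plane => p.1 i)
            (g := fun p : Plane × Plane => g' p.2 i) (by fun_prop) ?_
          exact ((EuclideanSpace.proj i : EuclideanSpace 𝕜 (Fin 2) →L[𝕜] 𝕜).continuous.comp_stronglyMeasurable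
            hg'm).comp_measurable measurable_snd
        exact (this.enorm.pow_const 2).aemeasurable
    _ = ENNReal.ofReal (secondMoment ε) * ∫⁻ x, ‖g' x‖ₑ ^ 2 := by
        simp_rw [setLIntegral_ball_enorm_sq]
        rw [lintegral_const_mul' _ _ ENNReal.ofReal_ne_top]
    _ = _ := by
        rw [ENNReal.ofReal_mul (secondMoment_pos hε).le, LpNorm, eLpNorm_congr_ae hgg',
          ENNReal.ofReal_pow ENNReal.toReal_nonneg, ENNReal.ofReal_toReal hg'.2.ne]
        congr 1
        have := eLpNorm_nnreal_pow_eq_lintegral (μ := (volume : Measure Plane)) (f := g')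
          (p := 2) (by norm_num)
        simpa using this.symm

/-! ### From bounds on gap energies to a weak gradient -/

/-- A linear functional bounded by `A ‖L x‖`, with values of `L` in a Hilbert space, is represented
by a vector of norm at most `A`. -/
theorem exists_inner_eq_of_abs_le {V H : Type*} [AddCommGroup V] [Module ℝ V]
    [NormedAddCommGroup H] [InnerProductSpace ℝ H] [CompleteSpace H] (L : V →ₗ[ℝ] H)
    (T : V →ₗ[ℝ] ℝ) {A : ℝ} (hA : 0 ≤ A) (h : ∀ x, |T x| ≤ A * ‖L x‖) :
    ∃ g : H, ‖g‖ ≤ A ∧ ∀ x, T x = inner ℝ g (L x) := by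
  -- The bound makes `T` vanish where `L` does, so `T` descends to a bounded functional on the range
  -- of `L`. Hahn–Banach extends it with the same norm, and Riesz represents the extension.
  have hker : LinearMap.ker L ≤ LinearMap.ker T := by
    intro x hx
    have := h x
    rw [LinearMap.mem_ker] at hx ⊢
    rw [hx, norm_zero, mul_zero] at this
    exact abs_nonpos_iff.1 this
  set S : LinearMap.range L →ₗ[ℝ] ℝ :=
    ((LinearMap.ker L).liftQ T hker).comp L.quotKerEquivRange.symm.toLinearMap with hS
  have hSL : ∀ x, S ⟨L x, LinearMap.mem_range_self L x⟩ = T x := by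
    intro x
    have : L.quotKerEquivRange.symm ⟨L x, LinearMap.mem_range_self L x⟩ =
        Submodule.Quotient.mk x := by
      rw [LinearEquiv.symm_apply_eq]
      rfl
    simp [hS, this]
  have hSb : ∀ y, ‖S y‖ ≤ A * ‖y‖ := by
    rintro ⟨y, x, rfl⟩
    rw [hSL]
    exact h x
  obtain ⟨f, hf, hfn⟩ := exists_extension_norm_eq _ (S.mkContinuous A hSb)
  refine ⟨(InnerProductSpace.toDual ℝ H).symm f, ?_, fun x => ?_⟩
  · rw [LinearIsometryEquiv.norm_map, hfn]
    exact LinearMap.mkContinuous_norm_le _ hA _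
  · rw [InnerProductSpace.toDual_symm_apply]
    have := hf ⟨L x, LinearMap.mem_range_self L x⟩
    rw [this, LinearMap.mkContinuous_apply, hSL]

theorem two_mul_ofReal (a : ℝ) : 2 * ENNReal.ofReal a = ENNReal.ofReal (2 * a) := by
  rw [ENNReal.ofReal_mul zero_le_two, ENNReal.ofReal_ofNat]

/-- The divergence of a vector field. -/
def divergence (Φ : Plane → Plane) (x : Plane) : ℝ :=
  ∑ i, fderiv ℝ Φ x (EuclideanSpace.single i 1) i

/-- The derivative of `Φ` is globally Lipschitz, being smooth with compact support, so the
first-order Taylor error is quadratic uniformly in `x`. -/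
theorem exists_taylor_bound {Φ : Plane → Plane} (hΦ : ContDiff ℝ ∞ Φ) (hc : HasCompactSupport Φ) :
    ∃ C : ℝ, 0 ≤ C ∧ ∀ x h, ‖Φ (x - h) - Φ x + fderiv ℝ Φ x h‖ ≤ C * ‖h‖ ^ 2 := by
  obtain ⟨C, hC⟩ := ContDiff.lipschitzWith_of_hasCompactSupport (𝕂 := ℝ) (n := 1) (hc.fderiv ℝ)
    (hΦ.fderiv_right (m := 1) (by norm_cast)) one_ne_zero
  refine ⟨C, C.2, fun x h => ?_⟩
  have hd : ∀ y ∈ Metric.closedBall x ‖h‖, HasFDerivWithinAt Φ (fderiv ℝ Φ y)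
      (Metric.closedBall x ‖h‖) y := fun y _ =>
    ((hΦ.differentiable (by simp)) y).hasFDerivAt.hasFDerivWithinAt
  have hb : ∀ y ∈ Metric.closedBall x ‖h‖, ‖fderiv ℝ Φ y - fderiv ℝ Φ x‖ ≤ C * ‖h‖ := by
    intro y hy
    rw [← dist_eq_norm]
    exact (hC.dist_le_mul y x).trans (mul_le_mul_of_nonneg_left hy C.2)
  have := (convex_closedBall x ‖h‖).norm_image_sub_le_of_norm_hasFDerivWithin_le' hd hb
    (x := x) (y := x - h) (by simp) (by simp)
  simp only [sub_sub_cancel_left, map_neg, sub_neg_eq_add, norm_neg] at this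
  linarith [this]

theorem norm_sum_mul_le (a b : Plane) : |∑ i, a i * b i| ≤ ‖a‖ * ‖b‖ := by
  have := abs_real_inner_le_norm b a
  simpa [PiLp.inner_apply, mul_comm] using this

theorem fderiv_apply_eq_sum (Φ : Plane → Plane) (x h : Plane) (i : Fin 2) :
    fderiv ℝ Φ x h i = ∑ j, h j * fderiv ℝ Φ x (EuclideanSpace.single j 1) i := by
  have hh : h = ∑ j, h j • EuclideanSpace.single j (1 : ℝ) := by
    ext j; fin_cases j <;> simp
  conv_lhs => rw [hh]
  simp [map_smul]

theorem setIntegral_ball_mul_eq (ε : ℝ) (i j : Fin 2) :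
    ∫ h in Metric.ball (0 : Plane) ε, h i * h j = if i = j then secondMoment ε else 0 := by
  fin_cases i <;> fin_cases j
  · simp [secondMoment, sq]
  · simpa using setIntegral_ball_mul ε
  · simpa [mul_comm] using setIntegral_ball_mul ε
  · simpa [sq] using setIntegral_ball_sq_one ε

/-- Only the trace survives averaging over a disc. Applied to the quadratic form `h · DΦ(x) h` it
produces the divergence. -/
theorem setIntegral_ball_quadratic (ε : ℝ) (c : Fin 2 → Fin 2 → ℝ) :
    ∫ h in Metric.ball (0 : Plane) ε, ∑ i, ∑ j, h i * h j * c i j =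
      secondMoment ε * ∑ i, c i i := by
  have hi : ∀ i j, IntegrableOn (fun h : Plane => h i * h j * c i j) (Metric.ball 0 ε) :=
    fun i j => integrableOn_ball_of_continuous (by fun_prop) _ _
  rw [integral_finsetSum _ fun i _ => integrable_finsetSum _ fun j _ => hi i j]
  simp_rw [integral_finsetSum _ fun j _ => hi _ j, integral_mul_const, setIntegral_ball_mul_eq]
  simp [mul_add]

/-- Averaged over `|h| < ε`, the form `h · DΦ(x) h` gives the divergence times the second moment. Up
to a Taylor error this form is the difference quotient `-h · (Φ(x-h) - Φ(x))`, and a translation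
moves the difference onto `v`, paired with `h · Φ`. Young's inequality `2ab ≤ a² + b²` then leaves
the gap energy of `v` and, by isotropy, the second moment times `‖Φ‖²`. The Taylor error is cubic in
`h` and disappears after division by the second moment as `ε → 0`. -/
theorem EnergyLE.abs_integral_mul_divergence_le_half {v : Plane → ℝ} {A : ℝ}
    (hv : MemLp v 2 volume) (hA : EnergyLE v A) {Φ : Plane → Plane} (hΦ : ContDiff ℝ ∞ Φ)
    (hc : HasCompactSupport Φ) :
    2 * |∫ x, v x * divergence Φ x| ≤ A ^ 2 + LpNorm 2 Φ ^ 2 := by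
  have hvl : LocallyIntegrable v := hv.locallyIntegrable (by norm_num)
  have hfc := hΦ.continuous_fderiv (by simp)
  obtain ⟨C, hC0, hC⟩ := exists_taylor_bound hΦ hc
  obtain ⟨R, hR⟩ := hc.isBounded.subset_closedBall (0 : Plane)
  have hΦ0 : ∀ x, x ∉ Metric.closedBall (0 : Plane) R → Φ x = 0 := fun x hx =>
    image_eq_zero_of_notMem_tsupport fun h => hx (hR h)
  have hΦ1 : ∀ x, x ∉ Metric.closedBall (0 : Plane) R → fderiv ℝ Φ x = 0 := fun x hx =>
    fderiv_of_notMem_tsupport ℝ fun h => hx (hR h)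
  -- The margin `1` accommodates the supports of all translates of `Φ` by `h` with `‖h‖ < 1`.
  set B := Metric.closedBall (0 : Plane) (R + 1) with hB
  have hvB : IntegrableOn v B := hvl.integrableOn_isCompact (isCompact_closedBall _ _)
  set W := ∫ x in B, |v x| with hW
  set Q : Plane → ℝ := fun h => ∫ x, v x * ∑ i, h i * fderiv ℝ Φ x h i with hQ
  set τ := ∫ x, v x * divergence Φ x with hτ
  have hcd : ∀ i j : Fin 2, Integrable (fun x => v x *
      fderiv ℝ Φ x (EuclideanSpace.single j 1) i) := fun i j => by
    refine hvl.integrable_smul_right_of_hasCompactSupport (f := v) (g := fun x =>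
      fderiv ℝ Φ x (EuclideanSpace.single j 1) i) (by fun_prop) ?_
    exact (hc.fderiv_apply ℝ (EuclideanSpace.single j 1)).comp_left (g := fun y : Plane => y i) rfl
  have hQe : ∀ h, Q h = ∑ i, ∑ j, h i * h j *
      ∫ x, v x * fderiv ℝ Φ x (EuclideanSpace.single j 1) i := by
    intro h
    have : ∀ x, v x * ∑ i, h i * fderiv ℝ Φ x h i = ∑ i, ∑ j, h i * h j *
        (v x * fderiv ℝ Φ x (EuclideanSpace.single j 1) i) := by
      intro x
      simp only [fderiv_apply_eq_sum Φ x h, Finset.mul_sum]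
      refine Finset.sum_congr rfl fun i _ => Finset.sum_congr rfl fun j _ => by ring
    simp only [hQ, this]
    rw [integral_finsetSum _ fun i _ => integrable_finsetSum _ fun j _ => (hcd i j).const_mul _]
    simp_rw [integral_finsetSum _ fun j _ => (hcd _ j).const_mul _, integral_const_mul]
  have hQint : ∀ ε, ∫ h in Metric.ball (0 : Plane) ε, Q h = secondMoment ε * τ := by
    intro ε
    simp_rw [hQe]
    rw [setIntegral_ball_quadratic]
    congr 1
    simp only [hτ, divergence, Finset.mul_sum]
    rw [integral_finsetSum _ fun i _ => hcd i i]
  have hQb : ∀ h : Plane, ‖h‖ < 1 → ‖Q h‖ₑ ≤ ENNReal.ofReal (C * W * ‖h‖ ^ 3) +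
      ∫⁻ x, ‖v (x + h) - v x‖ₑ * ‖∑ i, h i • Φ x i‖ₑ := by
    intro h hh
    have hdot : ∀ a : Plane, HasCompactSupport fun x => ∑ i, h i * Φ (x - a) i := fun a =>
      (hc.comp_homeomorph (Homeomorph.subRight a)).comp_left
        (g := fun y : Plane => ∑ i, h i * y i) (by simp)
    have hi : ∀ a : Plane, Integrable fun x => v x * ∑ i, h i * Φ (x - a) i := fun a =>
      hvl.integrable_smul_right_of_hasCompactSupport (f := v) (by
        have := hΦ.continuous
        fun_prop) (hdot a)
    have i0 := hi 0
    have ih := hi h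
    have ih' := ih.comp_add_right h
    simp only [sub_zero, add_sub_cancel_right] at i0 ih'
    have iD : Integrable fun x => v x * ∑ i, h i * fderiv ℝ Φ x h i :=
      hvl.integrable_smul_right_of_hasCompactSupport (f := v) (by fun_prop)
        ((hc.fderiv_apply ℝ h).comp_left (g := fun y : Plane => ∑ i, h i * y i) (by simp))
    have hsplit : Q h = (∫ x, v x * ∑ i, h i * (Φ (x - h) - Φ x + fderiv ℝ Φ x h) i) -
        ∫ x, (v (x + h) - v x) * ∑ i, h i * Φ x i := by
      have e1 : ∫ x, (v (x + h) - v x) * ∑ i, h i * Φ x i =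
          (∫ x, v x * ∑ i, h i * Φ (x - h) i) - ∫ x, v x * ∑ i, h i * Φ x i := by
        simp only [sub_mul]
        rw [integral_sub ih' i0, ← integral_add_right_eq_self
          (fun x => v x * ∑ i, h i * Φ (x - h) i) h]
        simp only [add_sub_cancel_right]
      have e2 : ∫ x, v x * ∑ i, h i * (Φ (x - h) - Φ x + fderiv ℝ Φ x h) i =
          (∫ x, v x * ∑ i, h i * Φ (x - h) i) - (∫ x, v x * ∑ i, h i * Φ x i) + Q h := by
        rw [← integral_sub ih i0, hQ, ← integral_add (by exact ih.sub i0) iD]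
        congr 1 with x
        simp only [PiLp.add_apply, PiLp.sub_apply, Fin.sum_univ_two]
        ring
      rw [e1, e2]
      ring
    have hP : |∫ x, v x * ∑ i, h i * (Φ (x - h) - Φ x + fderiv ℝ Φ x h) i| ≤ C * W * ‖h‖ ^ 3 := by
      rw [← setIntegral_eq_integral_of_forall_compl_eq_zero (s := B)]
      · calc |∫ x in B, v x * ∑ i, h i * (Φ (x - h) - Φ x + fderiv ℝ Φ x h) i|
            ≤ ∫ x in B, |v x| * (C * ‖h‖ ^ 3) := by
              refine norm_integral_le_of_norm_le (G := ℝ) (hvB.norm.mul_const _)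
                (Filter.Eventually.of_forall fun x => ?_)
              rw [Real.norm_eq_abs, abs_mul]
              refine mul_le_mul_of_nonneg_left ?_ (abs_nonneg _)
              refine (norm_sum_mul_le _ _).trans ?_
              calc _ ≤ ‖h‖ * (C * ‖h‖ ^ 2) := by gcongr; exact hC x h
                _ = _ := by ring
          _ = _ := by rw [integral_mul_const]; ring
      · intro x hx
        rw [hB, mem_closedBall_zero_iff, not_le] at hx
        have h1 : x ∉ Metric.closedBall (0 : Plane) R := by
          rw [mem_closedBall_zero_iff]; linarith
        have h2 : x - h ∉ Metric.closedBall (0 : Plane) R := by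
          rw [mem_closedBall_zero_iff]
          have := norm_add_le (x - h) h
          rw [sub_add_cancel] at this
          linarith
        simp [hΦ0 _ h1, hΦ0 _ h2, hΦ1 _ h1]
    rw [hsplit]
    refine enorm_sub_le.trans (add_le_add ?_ ?_)
    · rw [← ofReal_norm]
      exact ENNReal.ofReal_le_ofReal hP
    · refine (enorm_integral_le_lintegral_enorm _).trans (le_of_eq ?_)
      simp [enorm_mul]
  have hN : ∫⁻ x, ‖Φ x‖ₑ ^ 2 = ENNReal.ofReal (LpNorm 2 Φ ^ 2) := by
    have hΦ2 : MemLp Φ 2 volume := hΦ.continuous.memLp_of_hasCompactSupport hc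
    rw [LpNorm, ENNReal.ofReal_pow ENNReal.toReal_nonneg, ENNReal.ofReal_toReal hΦ2.2.ne]
    have := eLpNorm_nnreal_pow_eq_lintegral (μ := (volume : Measure Plane)) (f := Φ)
      (p := 2) (by norm_num)
    simpa using this.symm
  -- In `4 * C * W * ε`, one factor `2` is the one on the left-hand side. The other arises because
  -- `‖h‖ ^ 2` integrates to twice the second moment.
  have hmain : ∀ ε, 0 < ε → ε < 1 → 2 * |τ| ≤ A ^ 2 + LpNorm 2 Φ ^ 2 + 4 * C * W * ε := by
    intro ε hε hε1
    have hm := secondMoment_pos hε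
    have hW0 : 0 ≤ W := integral_nonneg fun _ => abs_nonneg _
    have key : 2 * ‖secondMoment ε * τ‖ₑ ≤
        ENNReal.ofReal (4 * C * W * ε * secondMoment ε) + (ENNReal.ofReal (secondMoment ε * A ^ 2) +
          ENNReal.ofReal (secondMoment ε) * ENNReal.ofReal (LpNorm 2 Φ ^ 2)) := by
      calc 2 * ‖secondMoment ε * τ‖ₑ = 2 * ‖∫ h in Metric.ball (0 : Plane) ε, Q h‖ₑ := by
            rw [hQint]
        _ ≤ 2 * ∫⁻ h in Metric.ball (0 : Plane) ε, ‖Q h‖ₑ := by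
            gcongr; exact enorm_integral_le_lintegral_enorm _
        _ = ∫⁻ h in Metric.ball (0 : Plane) ε, 2 * ‖Q h‖ₑ := by
            rw [lintegral_const_mul' _ _ (by norm_num)]
        _ ≤ ∫⁻ h in Metric.ball (0 : Plane) ε, (ENNReal.ofReal (2 * C * W * ε * ‖h‖ ^ 2) +
              ((∫⁻ x, ‖∑ i, h i • Φ x i‖ₑ ^ 2) + ∫⁻ x, ‖v (x + h) - v x‖ₑ ^ 2)) := by
            refine setLIntegral_mono' measurableSet_ball fun h hh => ?_
            rw [mem_ball_zero_iff] at hh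
            have h1 := hQb h (hh.trans hε1)
            calc 2 * ‖Q h‖ₑ ≤ 2 * (ENNReal.ofReal (C * W * ‖h‖ ^ 3) +
                ∫⁻ x, ‖v (x + h) - v x‖ₑ * ‖∑ i, h i • Φ x i‖ₑ) := by gcongr
              _ = ENNReal.ofReal (2 * (C * W * ‖h‖ ^ 3)) +
                  ∫⁻ x, 2 * (‖v (x + h) - v x‖ₑ * ‖∑ i, h i • Φ x i‖ₑ) := by
                  rw [mul_add, lintegral_const_mul' _ _ (by norm_num), two_mul_ofReal]
              _ ≤ _ := by
                  refine add_le_add (ENNReal.ofReal_le_ofReal ?_) ?_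
                  · have : ‖h‖ ^ 3 ≤ ε * ‖h‖ ^ 2 := by
                      rw [pow_succ']
                      gcongr
                    calc 2 * (C * W * ‖h‖ ^ 3) ≤ 2 * (C * W * (ε * ‖h‖ ^ 2)) := by gcongr
                      _ = _ := by ring
                  · have hmeas : Measurable fun x => ‖∑ i, h i • Φ x i‖ₑ ^ 2 := by
                      have := hΦ.continuous
                      exact Continuous.measurable (by fun_prop)
                    rw [← lintegral_add_left hmeas]
                    refine lintegral_mono fun x => ?_
                    rw [enorm_sq_eq_ofReal, enorm_sq_eq_ofReal, ← ENNReal.ofReal_add (by positivity)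
                      (by positivity), ← ofReal_norm, ← ofReal_norm,
                      ← ENNReal.ofReal_mul (norm_nonneg _), two_mul_ofReal]
                    refine ENNReal.ofReal_le_ofReal ?_
                    nlinarith [sq_nonneg (‖v (x + h) - v x‖ - ‖∑ i, h i • Φ x i‖)]
        _ = (∫⁻ h in Metric.ball (0 : Plane) ε, ENNReal.ofReal (2 * C * W * ε * ‖h‖ ^ 2)) +
              ((∫⁻ h in Metric.ball (0 : Plane) ε, ∫⁻ x, ‖∑ i, h i • Φ x i‖ₑ ^ 2) +
                gapEnergy ε v) := by
            have hmeas : Measurable fun p : Plane × Plane => ‖∑ i, p.1 i • Φ p.2 i‖ₑ ^ 2 := by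
              have := hΦ.continuous
              exact Continuous.measurable (by fun_prop)
            rw [lintegral_add_left (by fun_prop), lintegral_add_left hmeas.lintegral_prod_right']
            rfl
        _ ≤ _ := by
            refine add_le_add ?_ ?_
            · rw [← ofReal_integral_eq_lintegral_ofReal
                (integrableOn_ball_of_continuous (by fun_prop) _ _)
                (Filter.Eventually.of_forall fun _ => by positivity)]
              refine ENNReal.ofReal_le_ofReal (le_of_eq ?_)
              rw [integral_const_mul]
              have h2 := setIntegral_ball_quadratic ε (fun i j => if i = j then 1 else 0)
              have h3 : ∀ h : Plane, ‖h‖ ^ 2 = ∑ i, ∑ j, h i * h j * (if i = j then 1 else 0) := by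
                intro h
                rw [EuclideanSpace.norm_sq_eq]
                simp [sq]
              simp_rw [h3, h2]
              simp
              ring
            · rw [add_comm]
              refine add_le_add (hA ε hε) (le_of_eq ?_)
              rw [lintegral_lintegral_swap]
              · simp_rw [setLIntegral_ball_enorm_sq]
                rw [lintegral_const_mul' _ _ ENNReal.ofReal_ne_top, hN]
              · have := hΦ.continuous
                exact (Continuous.measurable (by fun_prop)).aemeasurable
    rw [← ENNReal.ofReal_mul hm.le, ← ENNReal.ofReal_add (by positivity) (by positivity),
      ← ENNReal.ofReal_add (by positivity) (by positivity), ← ofReal_norm,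
      two_mul_ofReal, ENNReal.ofReal_le_ofReal_iff (by positivity), norm_mul, Real.norm_of_nonneg hm.le,
      Real.norm_eq_abs] at key
    refine le_of_mul_le_mul_left ?_ hm
    linarith [key]
  have hlim : Filter.Tendsto (fun ε : ℝ => A ^ 2 + LpNorm 2 Φ ^ 2 + 4 * C * W * ε)
      (nhdsWithin 0 (Set.Ioi 0)) (nhds (A ^ 2 + LpNorm 2 Φ ^ 2 + 4 * C * W * 0)) := by
    refine Filter.Tendsto.mono_left ?_ nhdsWithin_le_nhds
    exact Continuous.tendsto (by fun_prop) _
  rw [mul_zero, add_zero] at hlim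
  refine ge_of_tendsto hlim ?_
  filter_upwards [Ioo_mem_nhdsGT (zero_lt_one' ℝ)] with ε hε
  exact hmain ε hε.1 hε.2

/-- The space of smooth compactly supported vector fields. -/
def testFields : Submodule ℝ (Plane → Plane) where
  carrier := {Φ | ContDiff ℝ ∞ Φ ∧ HasCompactSupport Φ}
  add_mem' h h' := ⟨h.1.add h'.1, h.2.add h'.2⟩
  zero_mem' := ⟨contDiff_const, HasCompactSupport.zero⟩
  smul_mem' c _ h := ⟨contDiff_const.smul h.1, h.2.smul_left (f := fun _ => c)⟩

theorem testFields.memLp (Φ : testFields) : MemLp (Φ : Plane → Plane) 2 volume :=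
  Φ.2.1.continuous.memLp_of_hasCompactSupport Φ.2.2

theorem testFields.integrable {v : Plane → ℝ} (hv : LocallyIntegrable v) (Φ : testFields) :
    Integrable fun x => v x * divergence Φ x := by
  have hfc := Φ.2.1.continuous_fderiv (by simp)
  refine hv.integrable_smul_right_of_hasCompactSupport (f := v) (by unfold divergence; fun_prop) ?_
  exact (Φ.2.2.fderiv ℝ).comp_left (g := fun D : Plane →L[ℝ] Plane =>
    ∑ i, D (EuclideanSpace.single i 1) i) (by simp)

/-- Replacing `Φ` by `s • Φ` in the previous bound makes a quadratic polynomial in `s` nonnegative.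
Its discriminant condition is the product form of the estimate. -/
theorem EnergyLE.abs_integral_mul_divergence_le {v : Plane → ℝ} {A : ℝ} (hA0 : 0 ≤ A)
    (hv : MemLp v 2 volume) (hA : EnergyLE v A) (Φ : testFields) :
    |∫ x, v x * divergence Φ x| ≤ A * LpNorm 2 (Φ : Plane → Plane) := by
  set τ := ∫ x, v x * divergence Φ x with hτ
  set N := LpNorm 2 (Φ : Plane → Plane) with hN
  have key : ∀ s : ℝ, 0 ≤ N ^ 2 * (s * s) + (-2 * τ) * s + A ^ 2 := by
    intro s
    have h := hA.abs_integral_mul_divergence_le_half hv (s • Φ).2.1 (s • Φ).2.2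
    have h1 : ∀ x, v x * divergence (s • Φ : testFields) x = s * (v x * divergence Φ x) := by
      intro x
      have : fderiv ℝ ((s • Φ : testFields) : Plane → Plane) x = s • fderiv ℝ Φ x :=
        fderiv_const_smul ((Φ.2.1.differentiable (by simp)) x) s
      simp only [divergence, this, smul_apply, PiLp.smul_apply, smul_eq_mul,
        Fin.sum_univ_two]
      ring
    have h2 : LpNorm 2 ((s • Φ : testFields) : Plane → Plane) ^ 2 = s ^ 2 * N ^ 2 := by
      simp only [LpNorm, Submodule.coe_smul, eLpNorm_const_smul, ENNReal.toReal_mul, hN]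
      rw [mul_pow, toReal_enorm, Real.norm_eq_abs, sq_abs]
    simp only [h1, integral_const_mul, h2] at h
    have := le_abs_self (s * τ)
    nlinarith
  have hd := discrim_le_zero key
  rw [discrim] at hd
  refine abs_le_of_sq_le_sq ?_ (mul_nonneg hA0 ENNReal.toReal_nonneg)
  nlinarith

/-- A square integrable function whose gap energies are bounded as those of a function with
`‖∇v‖_{L²} ≤ A` has a weak gradient of norm at most `A`. -/
theorem EnergyLE.exists_isWeakGradient {v : Plane → ℝ} {A : ℝ} (hA0 : 0 ≤ A)
    (hv : MemLp v 2 volume) (hA : EnergyLE v A) :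
    ∃ g : Plane → Plane, MemLp g 2 volume ∧ IsWeakGradient v g ∧ LpNorm 2 g ≤ A := by
  have hvl : LocallyIntegrable v := hv.locallyIntegrable (by norm_num)
  let L : testFields →ₗ[ℝ] Lp Plane 2 (volume : Measure Plane) :=
    { toFun := fun Φ => (testFields.memLp Φ).toLp
      map_add' := fun Φ Ψ => MemLp.toLp_add _ _
      map_smul' := fun c Φ => MemLp.toLp_const_smul c (testFields.memLp Φ) }
  let T : testFields →ₗ[ℝ] ℝ :=
    { toFun := fun Φ => - ∫ x, v x * divergence Φ x
      map_add' := fun Φ Ψ => by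
        rw [← neg_add, ← integral_add (testFields.integrable hvl Φ) (testFields.integrable hvl Ψ)]
        congr 2 with x
        have : fderiv ℝ ((Φ + Ψ : testFields) : Plane → Plane) x = fderiv ℝ Φ x + fderiv ℝ Ψ x :=
          fderiv_add ((Φ.2.1.differentiable (by simp)) x) ((Ψ.2.1.differentiable (by simp)) x)
        simp only [divergence, this, add_apply, PiLp.add_apply,
          Fin.sum_univ_two]
        ring
      map_smul' := fun c Φ => by
        rw [RingHom.id_apply, smul_neg, smul_eq_mul, ← integral_const_mul]
        congr 2 with x
        have : fderiv ℝ ((c • Φ : testFields) : Plane → Plane) x = c • fderiv ℝ Φ x :=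
          fderiv_const_smul ((Φ.2.1.differentiable (by simp)) x) c
        simp only [divergence, this, smul_apply, PiLp.smul_apply, smul_eq_mul,
          Fin.sum_univ_two]
        ring }
  obtain ⟨g, hg, hT⟩ := exists_inner_eq_of_abs_le L T hA0 fun Φ => by
    have := hA.abs_integral_mul_divergence_le hA0 hv Φ
    simpa [L, T, Lp.norm_toLp, LpNorm] using this
  refine ⟨g, Lp.memLp g, fun φ hφ hc i => ?_, by simpa [Lp.norm_def, LpNorm] using hg⟩
  -- The field `φ eᵢ` has divergence `∂ᵢφ`, so the representation of `T` becomes the defining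
  -- identity of a weak gradient.
  let Φ : testFields := ⟨fun x => φ x • (EuclideanSpace.single i (1 : ℝ) : Plane),
    hφ.smul contDiff_const, hc.smul_right (f' := fun _ => (EuclideanSpace.single i (1 : ℝ) : Plane))⟩
  have hdiv : ∀ x, divergence Φ x = fderiv ℝ φ x (EuclideanSpace.single i 1) := by
    intro x
    simp only [divergence, Φ]
    rw [fderiv_smul_const ((hφ.differentiable (by simp)) x)]
    simp
  have h := hT Φ
  rw [L2.inner_def] at h
  have h1 : ∫ x, inner ℝ (g x) (L Φ x) = ∫ x, φ x • g x i := by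
    refine integral_congr_ae ?_
    filter_upwards [(testFields.memLp Φ).coeFn_toLp] with x hx
    have : L Φ x = φ x • (EuclideanSpace.single i (1 : ℝ) : Plane) := hx
    rw [this, inner_smul_right, EuclideanSpace.inner_single_right]
    simp
  rw [h1] at h
  simp only [T, LinearMap.coe_mk, AddHom.coe_mk, hdiv] at h
  rw [← h, neg_neg]
  simp only [smul_eq_mul, mul_comm]

/-- The inclusion `ℝ² → 𝕜²`. -/
def castVec (𝕜 : Type*) [RCLike 𝕜] (y : Plane) : EuclideanSpace 𝕜 (Fin 2) :=
  WithLp.toLp 2 fun i => (y i : 𝕜)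

theorem norm_castVec (𝕜 : Type*) [RCLike 𝕜] (y : Plane) : ‖castVec 𝕜 y‖ = ‖y‖ := by
  simp [castVec, EuclideanSpace.norm_eq]

theorem LpNorm_weakGradient {𝕜 : Type*} [RCLike 𝕜] {u : Plane → 𝕜}
    {g : Plane → EuclideanSpace 𝕜 (Fin 2)} (hg : MemLp g 2 volume) (hw : IsWeakGradient u g) :
    LpNorm 2 (weakGradient u) = LpNorm 2 g := by
  have h : ∃ g : Plane → EuclideanSpace 𝕜 (Fin 2), MemLp g 2 volume ∧ IsWeakGradient u g :=
    ⟨g, hg, hw⟩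
  rw [weakGradient, dif_pos h, LpNorm, LpNorm,
    eLpNorm_congr_ae (h.choose_spec.2.ae_eq hw h.choose_spec.1 hg)]

/-- The real weak gradient, included coordinatewise in `𝕜²`, has unchanged norm. Thus one real
function serves for real and complex scalars. -/
theorem EnergyLE.memH1_ofReal (𝕜 : Type*) [RCLike 𝕜] {v : Plane → ℝ} {A : ℝ} (hA0 : 0 ≤ A)
    (hv : MemLp v 2 volume) (hA : EnergyLE v A) :
    MemH1 (fun x => (v x : 𝕜)) ∧ LpNorm 2 (weakGradient fun x => (v x : 𝕜)) ≤ A := by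
  obtain ⟨g, hg, hw, hgA⟩ := hA.exists_isWeakGradient hA0 hv
  have hcont : Continuous (castVec 𝕜) := by
    unfold castVec
    fun_prop
  have hg' : MemLp (fun x => castVec 𝕜 (g x)) 2 volume :=
    hg.of_le (hcont.comp_aestronglyMeasurable hg.1)
      (Filter.Eventually.of_forall fun x => (norm_castVec 𝕜 _).le)
  have hw' : IsWeakGradient (fun x => (v x : 𝕜)) (fun x => castVec 𝕜 (g x)) := by
    intro φ hφ hc i
    have h := congrArg (fun t : ℝ => (t : 𝕜)) (hw φ hφ hc i)
    simp only [RCLike.ofReal_neg] at h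
    rw [← integral_ofReal, ← integral_ofReal] at h
    simpa [castVec, RCLike.real_smul_eq_coe_mul] using h
  have hv' : MemLp (fun x => (v x : 𝕜)) 2 volume := hv.ofReal
  refine ⟨⟨hv', _, hg', hw'⟩, ?_⟩
  rw [LpNorm_weakGradient hg' hw', LpNorm, eLpNorm_congr_norm_ae (g := g)
    (Filter.Eventually.of_forall fun x => norm_castVec 𝕜 _)]
  exact hgA

/-! ### A Gagliardo–Nirenberg inequality from super-level sets -/

theorem volume_ball_eq (x : Plane) {r : ℝ} (hr : 0 ≤ r) :
    volume (Metric.ball x r) = ENNReal.ofReal (Real.pi * r ^ 2) := by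
  rw [EuclideanSpace.volume_ball_fin_two, mul_comm, ENNReal.ofReal_mul Real.pi_pos.le,
    ENNReal.ofReal_pow hr]

/-- The constant in the weak-type estimate `volume_superlevel_le`. -/
def levelConst : ℝ := 4 * secondMoment 1 / Real.pi ^ 2

theorem levelConst_pos : 0 < levelConst := by
  have := secondMoment_one_pos
  have := Real.pi_pos
  unfold levelConst
  positivity

/-- The super-level sets of a function of finite energy shrink at a definite rate. -/
theorem volume_superlevel_le {w : Plane → ℝ} (hw : Measurable w) {A : ℝ} (hA : EnergyLE w A)
    {t : ℝ} (ht : 0 < t) (hfin : volume {x | t < w x} ≠ ⊤) :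
    volume {x | 2 * t < w x} * ENNReal.ofReal (t ^ 2) ≤
      ENNReal.ofReal (levelConst * A ^ 2) * volume {x | t < w x} := by
  set μ := volume {x | t < w x} with hμ
  rcases eq_or_ne μ 0 with h0 | h0
  · have : volume {x | 2 * t < w x} ≤ μ := measure_mono fun x hx => by
      simp only [Set.mem_ofPred_eq] at hx ⊢
      linarith
    rw [h0, nonpos_iff_eq_zero] at this
    simp [this]
  set M := μ.toReal with hM
  have hMμ : ENNReal.ofReal M = μ := ENNReal.ofReal_toReal hfin
  have hM0 : 0 < M := ENNReal.toReal_pos h0 hfin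
  -- The disc has twice the area of `{t < w}`, so around any `x` an area of at least `μ` of
  -- displacements `h` lands where `w ≤ t`. If `w x > 2 * t`, each of them contributes a gap larger
  -- than `t`.
  set r := Real.sqrt (2 * M / Real.pi) with hr
  have hr2 : Real.pi * r ^ 2 = 2 * M := by
    rw [hr, Real.sq_sqrt (by have := Real.pi_pos; positivity)]
    field_simp
  have hr0 : 0 < r := Real.sqrt_pos.2 (by have := Real.pi_pos; positivity)
  have hball : volume (Metric.ball (0 : Plane) r) = 2 * μ := by
    rw [volume_ball_eq _ hr0.le, hr2, ← hMμ, two_mul_ofReal]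
  have hmeas : Measurable fun p : Plane × Plane => ‖w (p.2 + p.1) - w p.2‖ₑ ^ 2 := by fun_prop
  have hpt : ∀ x, 2 * t < w x → ENNReal.ofReal (t ^ 2) * μ ≤
      ∫⁻ h in Metric.ball (0 : Plane) r, ‖w (x + h) - w x‖ₑ ^ 2 := by
    intro x hx
    have hs : MeasurableSet {h : Plane | t < w (x + h)} :=
      measurableSet_lt measurable_const (by fun_prop)
    have hvol : volume {h : Plane | t < w (x + h)} = μ := by
      rw [hμ, ← measure_preimage_add volume x {y | t < w y}]
      rfl
    have hge : μ ≤ volume (Metric.ball (0 : Plane) r \ {h : Plane | t < w (x + h)}) := by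
      refine le_trans ?_ (le_measure_sdiff)
      rw [hball, hvol, two_mul, ENNReal.add_sub_cancel_right hfin]
    calc ENNReal.ofReal (t ^ 2) * μ
        ≤ ∫⁻ h in Metric.ball (0 : Plane) r \ {h : Plane | t < w (x + h)},
            ENNReal.ofReal (t ^ 2) := by
          rw [setLIntegral_const]
          gcongr
      _ ≤ ∫⁻ h in Metric.ball (0 : Plane) r \ {h : Plane | t < w (x + h)},
            ‖w (x + h) - w x‖ₑ ^ 2 := by
          refine setLIntegral_mono' (measurableSet_ball.diff hs) fun h hh => ?_
          rw [enorm_sq_eq_ofReal_sq]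
          refine ENNReal.ofReal_le_ofReal ?_
          have : w (x + h) ≤ t := not_lt.1 hh.2
          nlinarith
      _ ≤ _ := lintegral_mono_set Set.sdiff_subset
  have hlow : volume {x | 2 * t < w x} * (ENNReal.ofReal (t ^ 2) * μ) ≤ gapEnergy r w := by
    rw [gapEnergy, lintegral_lintegral_swap hmeas.aemeasurable]
    calc _ = ∫⁻ _ in {x | 2 * t < w x}, ENNReal.ofReal (t ^ 2) * μ := by
          rw [setLIntegral_const, mul_comm]
      _ ≤ ∫⁻ x in {x | 2 * t < w x}, ∫⁻ h in Metric.ball (0 : Plane) r,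
            ‖w (x + h) - w x‖ₑ ^ 2 :=
          setLIntegral_mono' (measurableSet_lt measurable_const hw) hpt
      _ ≤ _ := setLIntegral_le_lintegral _ _
  have hup := hA r hr0
  -- The choice of `r` makes its fourth power `4 * M ^ 2 / π ^ 2`, which is the origin of
  -- `levelConst`. One factor `M` is cancelled at the end.
  have heq : secondMoment r * A ^ 2 = levelConst * A ^ 2 * M * M := by
    have : r ^ 2 = 2 * M / Real.pi := by
      have := Real.pi_pos
      field_simp
      linarith
    rw [secondMoment_eq r hr0, levelConst, show r ^ 4 = (r ^ 2) ^ 2 by ring, this]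
    field_simp
    ring
  rw [heq, ENNReal.ofReal_mul (by have := levelConst_pos; positivity), hMμ,
    ENNReal.ofReal_mul (by have := levelConst_pos; positivity), hMμ] at hup
  refine (ENNReal.mul_le_mul_iff_left h0 hfin).1 ?_
  rw [mul_assoc]
  exact hlow.trans hup

/-- The constant in `lintegral_pow_add_two_le`. -/
def sobolevConst (q : ℕ) : ℝ := 2 ^ (q + 2) * ((q + 2) / q) * levelConst

theorem lintegral_ofReal_pow_eq {w : Plane → ℝ} (hw : Measurable w) (hw0 : ∀ x, 0 ≤ w x) {n : ℕ}
    (hn : 0 < n) : ∫⁻ x, ENNReal.ofReal (w x ^ n) = ENNReal.ofReal n *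
      ∫⁻ t in Set.Ioi (0 : ℝ), volume {x | t < w x} * ENNReal.ofReal (t ^ (n - 1)) := by
  have h := lintegral_rpow_eq_lintegral_meas_lt_mul (volume : Measure Plane)
    (Filter.Eventually.of_forall hw0) hw.aemeasurable (p := n) (by positivity)
  simp only [Real.rpow_natCast] at h
  rw [h]
  congr 1
  refine lintegral_congr fun t => ?_
  rw [← Real.rpow_natCast t (n - 1), Nat.cast_pred hn]

theorem volume_superlevel_ne_top {w : Plane → ℝ} (hw : Measurable w)
    (h2 : ∫⁻ x, ENNReal.ofReal (w x ^ 2) ≠ ⊤) {t : ℝ} (ht : 0 < t) :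
    volume {x | t < w x} ≠ ⊤ := by
  have h := mul_meas_ge_le_lintegral (μ := (volume : Measure Plane))
    (f := fun x => ENNReal.ofReal (w x ^ 2)) (by fun_prop) (ENNReal.ofReal (t ^ 2))
  have h1 : volume {x | ENNReal.ofReal (t ^ 2) ≤ ENNReal.ofReal (w x ^ 2)} ≠ ⊤ := by
    intro htop
    rw [htop, ENNReal.mul_top (by simpa using ht.ne')] at h
    exact h2 (top_le_iff.1 h)
  refine measure_ne_top_of_subset (fun x hx => ?_) h1
  simp only [Set.mem_ofPred_eq] at hx ⊢
  exact ENNReal.ofReal_le_ofReal (by gcongr)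

/-- An inequality of Gagliardo–Nirenberg type. -/
theorem lintegral_pow_add_two_le {w : Plane → ℝ} (hw : Measurable w) (hw0 : ∀ x, 0 ≤ w x) {A : ℝ}
    (hA : EnergyLE w A) (h2 : ∫⁻ x, ENNReal.ofReal (w x ^ 2) ≠ ⊤) {q : ℕ} (hq : 0 < q) :
    ∫⁻ x, ENNReal.ofReal (w x ^ (q + 2)) ≤
      ENNReal.ofReal (sobolevConst q * A ^ 2) * ∫⁻ x, ENNReal.ofReal (w x ^ q) := by
  have hK := levelConst_pos
  -- The layer-cake formula is applied to `w / 2`, whose super-level sets are the `{2 * t < w}` of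
  -- the weak-type estimate. This costs `2 ^ (q + 2)`; the ratio `(q + 2) / q` comes from the two
  -- layer-cake formulas.
  have hhalf : ∀ x, ENNReal.ofReal (w x ^ (q + 2)) =
      ENNReal.ofReal (2 ^ (q + 2)) * ENNReal.ofReal ((w x / 2) ^ (q + 2)) := by
    intro x
    rw [← ENNReal.ofReal_mul (by positivity), ← mul_pow, mul_div_cancel₀ _ two_ne_zero]
  have hset : ∀ t : ℝ, {x | t < w x / 2} = {x | 2 * t < w x} := by
    intro t
    ext x
    simp only [Set.mem_ofPred_eq]
    constructor <;> intro h <;> linarith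
  calc ∫⁻ x, ENNReal.ofReal (w x ^ (q + 2))
      = ENNReal.ofReal (2 ^ (q + 2)) * (ENNReal.ofReal (q + 2 : ℕ) * ∫⁻ t in Set.Ioi (0 : ℝ),
          volume {x | 2 * t < w x} * ENNReal.ofReal (t ^ (q + 1))) := by
        simp_rw [hhalf]
        rw [lintegral_const_mul' _ _ ENNReal.ofReal_ne_top, lintegral_ofReal_pow_eq
          (w := fun x => w x / 2) (by fun_prop) (fun x => by have := hw0 x; positivity) (by positivity)]
        simp_rw [hset]
        rfl
    _ ≤ ENNReal.ofReal (2 ^ (q + 2)) * (ENNReal.ofReal (q + 2 : ℕ) * ∫⁻ t in Set.Ioi (0 : ℝ),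
          ENNReal.ofReal (levelConst * A ^ 2) *
            (volume {x | t < w x} * ENNReal.ofReal (t ^ (q - 1)))) := by
        refine mul_le_mul_right (mul_le_mul_right (setLIntegral_mono' measurableSet_Ioi
          fun t ht => ?_) _) _
        have ht' : (0 : ℝ) < t := ht
        have h := volume_superlevel_le hw hA ht' (volume_superlevel_ne_top hw h2 ht')
        have : t ^ (q + 1) = t ^ 2 * t ^ (q - 1) := by
          rw [← pow_add]
          congr 1
          omega
        rw [this, ENNReal.ofReal_mul (by positivity), ← mul_assoc, ← mul_assoc]
        gcongr
    _ = _ := by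
        rw [lintegral_const_mul' _ _ ENNReal.ofReal_ne_top, lintegral_ofReal_pow_eq hw hw0 hq]
        simp only [← mul_assoc]
        congr 1
        rw [← ENNReal.ofReal_mul (by positivity), ← ENNReal.ofReal_mul (by positivity),
          ← ENNReal.ofReal_mul (by unfold sobolevConst; positivity)]
        congr 1
        have : (q : ℝ) ≠ 0 := by positivity
        simp only [sobolevConst]
        push_cast
        field_simp

/-! ### Kernel form and lower semicontinuity of the gap energy -/

/-- The substitution `y = x + h` yields a kernel that depends only on `dist x y`, on which
reflections act separately in `x` and `y`. -/
theorem gapEnergy_eq_lintegral_lintegral {w : Plane → ℝ} (hw : Measurable w) (ε : ℝ) :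
    gapEnergy ε w = ∫⁻ x, ∫⁻ y, ENNReal.ofReal ((if dist x y < ε then 1 else 0) *
      (w x - w y) ^ 2) := by
  have hmeas : Measurable fun p : Plane × Plane => ‖w (p.2 + p.1) - w p.2‖ₑ ^ 2 := by fun_prop
  rw [gapEnergy, lintegral_lintegral_swap hmeas.aemeasurable]
  refine lintegral_congr fun x => ?_
  rw [← lintegral_add_left_eq_self (μ := (volume : Measure Plane)) (fun y => ENNReal.ofReal
    ((if dist x y < ε then 1 else 0) * (w x - w y) ^ 2)) x, ← lintegral_indicator measurableSet_ball]
  refine lintegral_congr fun h => ?_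
  by_cases hh : ‖h‖ < ε
  · rw [Set.indicator_of_mem (by simpa using hh), enorm_sq_eq_ofReal_sq, if_pos (by simpa using hh)]
    congr 1
    ring
  · rw [Set.indicator_of_notMem (by simpa using hh), if_neg (by simpa using hh)]
    simp

/-- Lower semicontinuity of the gap energy. -/
theorem gapEnergy_le_of_tendsto {v : Plane → ℝ} {f : ℕ → Plane → ℝ} (hf : ∀ n, Measurable (f n))
    (hlim : ∀ᵐ x, Filter.Tendsto (fun n => f n x) Filter.atTop (nhds (v x))) {ε : ℝ}
    {c : ℕ → ENNReal} {b : ENNReal} (hc : ∀ n, gapEnergy ε (f n) ≤ c n)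
    (hcb : Filter.Tendsto c Filter.atTop (nhds b)) : gapEnergy ε v ≤ b := by
  have hlim' : ∀ h : Plane, ∀ᵐ x, Filter.Tendsto (fun n => f n (x + h)) Filter.atTop
      (nhds (v (x + h))) := fun h =>
    (measurePreserving_add_right volume h).quasiMeasurePreserving.ae hlim
  calc gapEnergy ε v
      ≤ ∫⁻ h in Metric.ball (0 : Plane) ε, Filter.liminf
          (fun n => ∫⁻ x, ‖f n (x + h) - f n x‖ₑ ^ 2) Filter.atTop := by
        refine lintegral_mono fun h => ?_
        refine le_trans (le_of_eq ?_) (lintegral_liminf_le fun n => by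
          have := hf n
          fun_prop)
        refine lintegral_congr_ae ?_
        filter_upwards [hlim, hlim' h] with x hx hxh
        have : Filter.Tendsto (fun n => ‖f n (x + h) - f n x‖ₑ ^ 2) Filter.atTop
            (nhds (‖v (x + h) - v x‖ₑ ^ 2)) := 
          ((ENNReal.continuous_pow 2).tendsto _).comp (hxh.sub hx).enorm
        exact this.liminf_eq.symm
    _ ≤ Filter.liminf (fun n => gapEnergy ε (f n)) Filter.atTop := by
        refine lintegral_liminf_le fun n => ?_
        have := hf n
        have hmeas : Measurable fun p : Plane × Plane => ‖f n (p.2 + p.1) - f n p.2‖ₑ ^ 2 := by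
          fun_prop
        exact hmeas.lintegral_prod_right'
    _ ≤ Filter.liminf c Filter.atTop := Filter.liminf_le_liminf (Filter.Eventually.of_forall hc)
    _ = b := hcb.liminf_eq

/-! ### Line reflections and polarization -/

/-- The reflection in the line `⟨e, z⟩ = d`, for a unit vector `e`. -/
def lineReflection (e : Plane) (d : ℝ) (z : Plane) : Plane := z - (2 * (inner ℝ e z - d)) • e

theorem inner_lineReflection {e : Plane} (he : ‖e‖ = 1) (d : ℝ) (z : Plane) :
    inner ℝ e (lineReflection e d z) = 2 * d - inner ℝ e z := by
  rw [lineReflection, inner_sub_right, inner_smul_right, real_inner_self_eq_norm_sq, he]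
  ring

theorem lineReflection_lineReflection {e : Plane} (he : ‖e‖ = 1) (d : ℝ) (z : Plane) :
    lineReflection e d (lineReflection e d z) = z := by
  conv_lhs => rw [lineReflection, inner_lineReflection he, lineReflection]
  module

theorem lineReflection_of_inner_eq {e : Plane} {d : ℝ} {z : Plane} (h : inner ℝ e z = d) :
    lineReflection e d z = z := by
  simp [lineReflection, h]

/-- The sign of the product tells whether `x` and `y` lie on the same side of the line: reflecting
one of them increases the distance in that case and decreases it otherwise. -/
theorem dist_lineReflection_sq {e : Plane} (he : ‖e‖ = 1) (d : ℝ) (x y : Plane) :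
    dist (lineReflection e d x) y ^ 2 =
      dist x y ^ 2 + 4 * ((inner ℝ e x - d) * (inner ℝ e y - d)) := by
  have h : lineReflection e d x - y = (x - y) - (2 * (inner ℝ e x - d)) • e := by
    rw [lineReflection]; abel
  rw [dist_eq_norm, dist_eq_norm, h, norm_sub_sq_real, norm_smul, he, inner_smul_right,
    real_inner_comm e (x - y), inner_sub_right, mul_one, Real.norm_eq_abs, sq_abs]
  ring

theorem dist_lineReflection_lineReflection {e : Plane} (he : ‖e‖ = 1) (d : ℝ) (x y : Plane) :
    dist (lineReflection e d x) (lineReflection e d y) = dist x y := by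
  have h := dist_lineReflection_sq he d x (lineReflection e d y)
  rw [dist_comm x (lineReflection e d y), dist_lineReflection_sq he d y x, inner_lineReflection he,
    dist_comm y x] at h
  refine (sq_eq_sq₀ dist_nonneg dist_nonneg).1 ?_
  rw [h]
  ring

theorem dist_lineReflection_right {e : Plane} (he : ‖e‖ = 1) (d : ℝ) (x y : Plane) :
    dist x (lineReflection e d y) = dist (lineReflection e d x) y := by
  rw [← dist_lineReflection_lineReflection he d, lineReflection_lineReflection he]

theorem norm_lineReflection_sq {e : Plane} (he : ‖e‖ = 1) (d : ℝ) (z : Plane) :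
    ‖lineReflection e d z‖ ^ 2 = ‖z‖ ^ 2 - 4 * d * (inner ℝ e z - d) := by
  have := dist_lineReflection_sq he d z 0
  simp only [dist_zero_right, inner_zero_right] at this
  rw [this]
  ring

theorem continuous_lineReflection (e : Plane) (d : ℝ) : Continuous (lineReflection e d) := by
  unfold lineReflection
  fun_prop

theorem measurePreserving_lineReflection {e : Plane} (he : ‖e‖ = 1) (d : ℝ) :
    MeasurePreserving (lineReflection e d) := by
  have h := (measurePreserving_add_right (volume : Measure Plane) ((2 * d) • e)).comp
    (Submodule.reflection (ℝ ∙ e)ᗮ).measurePreserving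
  have hz : lineReflection e d = (fun x => x + (2 * d) • e) ∘ (Submodule.reflection (ℝ ∙ e)ᗮ) := by
    funext z
    simp only [Function.comp_apply, Submodule.reflection_orthogonal_apply,
      Submodule.reflection_singleton_apply, he, lineReflection]
    simp
    module
  rw [hz]
  exact h

/-- The homeomorphism underlying a line reflection. -/
def lineReflectionHomeo {e : Plane} (he : ‖e‖ = 1) (d : ℝ) : Plane ≃ₜ Plane where
  toFun := lineReflection e d
  invFun := lineReflection e d
  left_inv := lineReflection_lineReflection he d
  right_inv := lineReflection_lineReflection he d
  continuous_toFun := continuous_lineReflection e d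
  continuous_invFun := continuous_lineReflection e d

theorem lintegral_comp_lineReflection {e : Plane} (he : ‖e‖ = 1) (d : ℝ) (f : Plane → ENNReal) :
    ∫⁻ x, f (lineReflection e d x) = ∫⁻ x, f x :=
  (measurePreserving_lineReflection he d).lintegral_comp_emb
    (lineReflectionHomeo he d).measurableEmbedding f

theorem integral_comp_lineReflection {e : Plane} (he : ‖e‖ = 1) (d : ℝ) (f : Plane → ℝ) :
    ∫ x, f (lineReflection e d x) = ∫ x, f x :=
  (measurePreserving_lineReflection he d).integral_comp
    (lineReflectionHomeo he d).measurableEmbedding f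

/-- The two-point symmetrization of `w` with respect to the half-plane `⟨e, z⟩ ≤ d`. -/
def polarize (e : Plane) (d : ℝ) (w : Plane → ℝ) (z : Plane) : ℝ :=
  if inner ℝ e z ≤ d then max (w z) (w (lineReflection e d z))
  else min (w z) (w (lineReflection e d z))

theorem polarize_of_le {e : Plane} {d : ℝ} {w : Plane → ℝ} {z : Plane} (h : inner ℝ e z ≤ d) :
    polarize e d w z = max (w z) (w (lineReflection e d z)) := if_pos h

/-- On the line itself the reflection is the identity and maximum and minimum coincide, so both
formulas are valid on closed half-planes. -/
theorem polarize_of_ge {e : Plane} {d : ℝ} {w : Plane → ℝ} {z : Plane} (h : d ≤ inner ℝ e z) :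
    polarize e d w z = min (w z) (w (lineReflection e d z)) := by
  rcases h.eq_or_lt with h | h
  · rw [polarize_of_le h.ge, lineReflection_of_inner_eq h.symm, max_self, min_self]
  · exact if_neg (not_le.2 h)

theorem polarize_lineReflection_of_le {e : Plane} (he : ‖e‖ = 1) {d : ℝ} {w : Plane → ℝ}
    {z : Plane} (h : inner ℝ e z ≤ d) :
    polarize e d w (lineReflection e d z) = min (w z) (w (lineReflection e d z)) := by
  rw [polarize_of_ge (by rw [inner_lineReflection he]; linarith),
    lineReflection_lineReflection he, min_comm]

theorem polarize_lineReflection_of_ge {e : Plane} (he : ‖e‖ = 1) {d : ℝ} {w : Plane → ℝ}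
    {z : Plane} (h : d ≤ inner ℝ e z) :
    polarize e d w (lineReflection e d z) = max (w z) (w (lineReflection e d z)) := by
  rw [polarize_of_le (by rw [inner_lineReflection he]; linarith),
    lineReflection_lineReflection he, max_comm]

theorem measurable_polarize (e : Plane) (d : ℝ) {w : Plane → ℝ} (hw : Measurable w) :
    Measurable (polarize e d w) := by
  have h := hw.comp (continuous_lineReflection e d).measurable
  refine Measurable.ite (measurableSet_le (by fun_prop) measurable_const) ?_ ?_
  · exact hw.max h
  · exact hw.min h

/-- On each pair `{x, σ x}` polarization keeps or exchanges the two values, so the sum over the pair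
is unchanged. Integrating such sums counts everything twice. -/
theorem lintegral_comp_polarize {e : Plane} (he : ‖e‖ = 1) (d : ℝ) {w : Plane → ℝ}
    (hw : Measurable w) {f : ℝ → ENNReal} (hf : Measurable f) :
    ∫⁻ x, f (polarize e d w x) = ∫⁻ x, f (w x) := by
  have h2 : ∀ g : Plane → ENNReal, Measurable g →
      ∫⁻ x, (g x + g (lineReflection e d x)) = 2 * ∫⁻ x, g x := by
    intro g hg
    rw [lintegral_add_left hg, lintegral_comp_lineReflection he, two_mul]
  refine (ENNReal.mul_right_inj two_ne_zero ENNReal.ofNat_ne_top).1 ?_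
  rw [← h2 (fun x => f (polarize e d w x)) (hf.comp (measurable_polarize e d hw)),
    ← h2 (fun x => f (w x)) (hf.comp hw)]
  refine lintegral_congr fun x => ?_
  rcases le_total (inner ℝ e x) d with h | h
  · rw [polarize_of_le h, polarize_lineReflection_of_le he h]
    rcases le_total (w x) (w (lineReflection e d x)) with h' | h'
    · rw [max_eq_right h', min_eq_left h', add_comm]
    · rw [max_eq_left h', min_eq_right h']
  · rw [polarize_of_ge h, polarize_lineReflection_of_ge he h]
    rcases le_total (w x) (w (lineReflection e d x)) with h' | h'
    · rw [max_eq_right h', min_eq_left h']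
    · rw [max_eq_left h', min_eq_right h', add_comm]

/-- If the pairs `(a, a')` and `(b, b')` are ordered alike, both sides agree. If they are ordered
oppositely, the right side exceeds the left by `2 (k - l) |a - a'| |b - b'|`. -/
theorem four_point_aux {a a' b b' k l : ℝ} (hkl : l ≤ k) :
    k * (max a a' - max b b') ^ 2 + l * (min a a' - max b b') ^ 2 +
        l * (max a a' - min b b') ^ 2 + k * (min a a' - min b b') ^ 2 ≤
      k * (a - b) ^ 2 + l * (a' - b) ^ 2 + l * (a - b') ^ 2 + k * (a' - b') ^ 2 := by
  rcases le_total a a' with h | h <;> rcases le_total b b' with h' | h' <;>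
    simp only [max_eq_left, max_eq_right, min_eq_left, min_eq_right, h, h'] <;>
    nlinarith [mul_nonneg (sub_nonneg.2 hkl) (mul_nonneg (sub_nonneg.2 h) (sub_nonneg.2 h'))]

/-- The kernel is nonincreasing in the distance, so points on the same side of the line carry the
larger weight, as `four_point_aux` requires. When `x` and `y` lie on opposite sides, `y` and its
reflection exchange roles. -/
theorem four_point_polarize {e : Plane} (he : ‖e‖ = 1) (d : ℝ) (w : Plane → ℝ) (ε : ℝ)
    (x y : Plane) :
    let σ := lineReflection e d
    let k : Plane → Plane → ℝ := fun x y => if dist x y < ε then 1 else 0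
    let p := polarize e d w
    k x y * (p x - p y) ^ 2 + k (σ x) y * (p (σ x) - p y) ^ 2 + k x (σ y) * (p x - p (σ y)) ^ 2 +
        k (σ x) (σ y) * (p (σ x) - p (σ y)) ^ 2 ≤
      k x y * (w x - w y) ^ 2 + k (σ x) y * (w (σ x) - w y) ^ 2 + k x (σ y) * (w x - w (σ y)) ^ 2 +
        k (σ x) (σ y) * (w (σ x) - w (σ y)) ^ 2 := by
  intro σ k p
  have hk1 : k (σ x) (σ y) = k x y := by
    simp only [k, σ, dist_lineReflection_lineReflection he]
  have hk2 : k x (σ y) = k (σ x) y := by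
    simp only [k, σ, dist_lineReflection_right he]
  have hmono : ∀ {x y x' y' : Plane}, dist x y ^ 2 ≤ dist x' y' ^ 2 → k x' y' ≤ k x y := by
    intro x y x' y' h
    have h' : dist x y ≤ dist x' y' := (sq_le_sq₀ dist_nonneg dist_nonneg).1 h
    simp only [k]
    by_cases h1 : dist x' y' < ε
    · rw [if_pos h1, if_pos (h'.trans_lt h1)]
    · rw [if_neg h1]
      split_ifs <;> norm_num
  have hd := dist_lineReflection_sq he d x y
  rw [hk1, hk2]
  rcases le_total (inner ℝ e x) d with hx | hx <;> rcases le_total (inner ℝ e y) d with hy | hy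
  · have hle : k (σ x) y ≤ k x y := hmono (by
      have := mul_nonneg (sub_nonneg.2 hx) (sub_nonneg.2 hy)
      nlinarith)
    simp only [p, σ, polarize_of_le hx, polarize_of_le hy, polarize_lineReflection_of_le he hx,
      polarize_lineReflection_of_le he hy]
    exact four_point_aux hle
  · have hle : k x y ≤ k (σ x) y := hmono (by
      have := mul_nonneg (sub_nonneg.2 hx) (sub_nonneg.2 hy)
      nlinarith)
    simp only [p, σ, polarize_of_le hx, polarize_of_ge hy, polarize_lineReflection_of_le he hx,
      polarize_lineReflection_of_ge he hy]
    have := four_point_aux (a := w x) (a' := w (lineReflection e d x)) (b := w (lineReflection e d y))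
      (b' := w y) hle
    rw [max_comm (w (lineReflection e d y)), min_comm (w (lineReflection e d y))] at this
    linarith
  · have hle : k x y ≤ k (σ x) y := hmono (by
      have := mul_nonneg (sub_nonneg.2 hx) (sub_nonneg.2 hy)
      nlinarith)
    simp only [p, σ, polarize_of_ge hx, polarize_of_le hy, polarize_lineReflection_of_ge he hx,
      polarize_lineReflection_of_le he hy]
    have := four_point_aux (a := w x) (a' := w (lineReflection e d x)) (b := w (lineReflection e d y))
      (b' := w y) hle
    rw [max_comm (w (lineReflection e d y)), min_comm (w (lineReflection e d y))] at this
    linarith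
  · have hle : k (σ x) y ≤ k x y := hmono (by
      have := mul_nonneg (sub_nonneg.2 hx) (sub_nonneg.2 hy)
      nlinarith)
    simp only [p, σ, polarize_of_ge hx, polarize_of_ge hy, polarize_lineReflection_of_ge he hx,
      polarize_lineReflection_of_ge he hy]
    have := four_point_aux (a := w x) (a' := w (lineReflection e d x)) (b := w y)
      (b' := w (lineReflection e d y)) hle
    linarith

/-- Either variable may be reflected without changing the integral. Summing the four choices exposes
the four-point expression pointwise. -/
theorem four_mul_lintegral_lintegral {e : Plane} (he : ‖e‖ = 1) (d : ℝ)
    {G : Plane → Plane → ENNReal} (hG : Measurable (Function.uncurry G)) :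
    4 * ∫⁻ x, ∫⁻ y, G x y = ∫⁻ x, ∫⁻ y, ((G x y + G x (lineReflection e d y)) +
      (G (lineReflection e d x) y + G (lineReflection e d x) (lineReflection e d y))) := by
  have hσ := (continuous_lineReflection e d).measurable
  have hGy : ∀ x, Measurable (G x) := fun x => hG.comp measurable_prodMk_left
  have hGx : Measurable fun x => ∫⁻ y, G x y := hG.lintegral_prod_right'
  have hy : ∀ x, ∫⁻ y, (G x y + G x (lineReflection e d y)) = 2 * ∫⁻ y, G x y := by
    intro x
    rw [lintegral_add_left (hGy x), lintegral_comp_lineReflection he d (G x), two_mul]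
  have h1 : ∀ x, ∫⁻ y, ((G x y + G x (lineReflection e d y)) +
      (G (lineReflection e d x) y + G (lineReflection e d x) (lineReflection e d y))) =
      2 * (∫⁻ y, G x y) + 2 * ∫⁻ y, G (lineReflection e d x) y := by
    intro x
    rw [lintegral_add_left, hy, hy]
    exact (hGy x).add ((hGy x).comp hσ)
  have h4 : ∫⁻ x, ∫⁻ y, G (lineReflection e d x) y = ∫⁻ x, ∫⁻ y, G x y :=
    lintegral_comp_lineReflection he d (fun x => ∫⁻ y, G x y)
  simp_rw [h1]
  rw [lintegral_add_left (hGx.const_mul 2), lintegral_const_mul _ hGx,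
    lintegral_const_mul' _ _ (by norm_num), h4, ← add_mul]
  norm_num

theorem gapEnergy_polarize_le {e : Plane} (he : ‖e‖ = 1) (d : ℝ) {w : Plane → ℝ}
    (hw : Measurable w) (ε : ℝ) : gapEnergy ε (polarize e d w) ≤ gapEnergy ε w := by
  have hp := measurable_polarize e d hw
  have hGm : ∀ {w : Plane → ℝ}, Measurable w → Measurable (Function.uncurry fun x y : Plane =>
      ENNReal.ofReal ((if dist x y < ε then 1 else 0) * (w x - w y) ^ 2)) := by
    intro w hw
    have hkm : Measurable fun q : Plane × Plane => (if dist q.1 q.2 < ε then 1 else 0 : ℝ) :=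
      Measurable.ite (measurableSet_lt (by fun_prop) measurable_const) measurable_const
        measurable_const
    simp only [Function.uncurry_def]
    fun_prop
  refine (ENNReal.mul_le_mul_iff_right (a := 4) (by norm_num) (by norm_num)).1 ?_
  rw [gapEnergy_eq_lintegral_lintegral hp, gapEnergy_eq_lintegral_lintegral hw,
    four_mul_lintegral_lintegral he d (hGm hp), four_mul_lintegral_lintegral he d (hGm hw)]
  refine lintegral_mono fun x => lintegral_mono fun y => ?_
  have h0 : ∀ (w : Plane → ℝ) (x y : Plane),
      0 ≤ (if dist x y < ε then 1 else 0 : ℝ) * (w x - w y) ^ 2 := fun w x y =>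
    mul_nonneg (by split_ifs <;> norm_num) (sq_nonneg _)
  have h := ENNReal.ofReal_le_ofReal (four_point_polarize he d w ε x y)
  have hsum : ∀ (w : Plane → ℝ) {x y x' y' : Plane},
      ENNReal.ofReal ((if dist x y < ε then 1 else 0) * (w x - w y) ^ 2 +
        (if dist x' y < ε then 1 else 0) * (w x' - w y) ^ 2 +
        (if dist x y' < ε then 1 else 0) * (w x - w y') ^ 2 +
        (if dist x' y' < ε then 1 else 0) * (w x' - w y') ^ 2) =
      ENNReal.ofReal ((if dist x y < ε then 1 else 0) * (w x - w y) ^ 2) +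
        ENNReal.ofReal ((if dist x y' < ε then 1 else 0) * (w x - w y') ^ 2) +
        (ENNReal.ofReal ((if dist x' y < ε then 1 else 0) * (w x' - w y) ^ 2) +
        ENNReal.ofReal ((if dist x' y' < ε then 1 else 0) * (w x' - w y') ^ 2)) := by
    intro w x y x' y'
    rw [← ENNReal.ofReal_add (h0 _ _ _) (h0 _ _ _), ← ENNReal.ofReal_add (h0 _ _ _) (h0 _ _ _),
      ← ENNReal.ofReal_add (add_nonneg (h0 _ _ _) (h0 _ _ _)) (add_nonneg (h0 _ _ _) (h0 _ _ _))]
    congr 1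
    ring
  rw [hsum, hsum] at h
  exact h

/-- On one side of the line this is the stability of Lipschitz bounds under maxima and minima.
Across the line a maximum is compared with a minimum, possibly through one reflected point, and the
reflected distance is then no larger. -/
theorem lipschitzWith_polarize {e : Plane} (he : ‖e‖ = 1) (d : ℝ) {w : Plane → ℝ} {L : NNReal}
    (hw : LipschitzWith L w) : LipschitzWith L (polarize e d w) := by
  refine LipschitzWith.of_dist_le_mul fun x y => ?_
  have h1 := abs_le.1 (hw.dist_le_mul x y)
  have h2 := abs_le.1 (hw.dist_le_mul (lineReflection e d x) (lineReflection e d y))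
  rw [dist_lineReflection_lineReflection he] at h2
  have hcross : ∀ h : (inner ℝ e x - d) * (inner ℝ e y - d) ≤ 0,
      dist (lineReflection e d x) y ≤ dist x y := by
    intro h
    refine (sq_le_sq₀ dist_nonneg dist_nonneg).1 ?_
    rw [dist_lineReflection_sq he]
    linarith
  have hcross1 : ∀ h : (inner ℝ e x - d) * (inner ℝ e y - d) ≤ 0,
      |w (lineReflection e d x) - w y| ≤ L * dist x y := fun h =>
    (hw.dist_le_mul _ _).trans (mul_le_mul_of_nonneg_left (hcross h) L.2)
  have hcross2 : ∀ h : (inner ℝ e x - d) * (inner ℝ e y - d) ≤ 0,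
      |w x - w (lineReflection e d y)| ≤ L * dist x y := fun h => by
    refine (hw.dist_le_mul _ _).trans (mul_le_mul_of_nonneg_left ?_ L.2)
    rw [dist_lineReflection_right he]
    exact hcross h
  rw [Real.dist_eq, abs_le]
  rcases le_total (inner ℝ e x) d with hx | hx <;> rcases le_total (inner ℝ e y) d with hy | hy
  · rw [polarize_of_le hx, polarize_of_le hy]
    rcases max_cases (w x) (w (lineReflection e d x)) with h | h <;>
      rcases max_cases (w y) (w (lineReflection e d y)) with h' | h' <;>
      constructor <;> linarith
  · have hn : (inner ℝ e x - d) * (inner ℝ e y - d) ≤ 0 :=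
      mul_nonpos_of_nonpos_of_nonneg (by linarith) (by linarith)
    have h3 := abs_le.1 (hcross1 hn)
    have h4 := abs_le.1 (hcross2 hn)
    rw [polarize_of_le hx, polarize_of_ge hy]
    rcases max_cases (w x) (w (lineReflection e d x)) with h | h <;>
      rcases min_cases (w y) (w (lineReflection e d y)) with h' | h' <;>
      constructor <;> linarith
  · have hn : (inner ℝ e x - d) * (inner ℝ e y - d) ≤ 0 :=
      mul_nonpos_of_nonneg_of_nonpos (by linarith) (by linarith)
    have h3 := abs_le.1 (hcross1 hn)
    have h4 := abs_le.1 (hcross2 hn)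
    rw [polarize_of_ge hx, polarize_of_le hy]
    rcases min_cases (w x) (w (lineReflection e d x)) with h | h <;>
      rcases max_cases (w y) (w (lineReflection e d y)) with h' | h' <;>
      constructor <;> linarith
  · rw [polarize_of_ge hx, polarize_of_ge hy]
    rcases min_cases (w x) (w (lineReflection e d x)) with h | h <;>
      rcases min_cases (w y) (w (lineReflection e d y)) with h' | h' <;>
      constructor <;> linarith

/-! ### Symmetrization by minimizing the second moment -/

/-- The nonnegative `L`-Lipschitz functions supported in the disc of radius `R` that are
equimeasurable with `w` (through their power integrals) and have no larger gap energies. -/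
structure IsCompetitor (w : Plane → ℝ) (L : NNReal) (R B : ℝ) (v : Plane → ℝ) : Prop where
  nonneg : ∀ x, 0 ≤ v x
  le_bound : ∀ x, v x ≤ B
  lipschitz : LipschitzWith L v
  support : ∀ x, R < ‖x‖ → v x = 0
  lintegral_pow : ∀ n : ℕ, 0 < n →
    ∫⁻ x, ENNReal.ofReal (v x ^ n) = ∫⁻ x, ENNReal.ofReal (w x ^ n)
  gapEnergy_le : ∀ ε, gapEnergy ε v ≤ gapEnergy ε w

namespace IsCompetitor

variable {w v : Plane → ℝ} {L : NNReal} {R B : ℝ}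

/-- The condition `0 < d` puts the origin in the half-plane receiving the larger values. Reflecting
a point of that half-plane does not decrease its norm, so the support stays in the disc. -/
theorem polarize (h : IsCompetitor w L R B v) {e : Plane} (he : ‖e‖ = 1) {d : ℝ} (hd : 0 < d) :
    IsCompetitor w L R B (polarize e d v) := by
  have hm := h.lipschitz.continuous.measurable
  refine ⟨fun x => ?_, fun x => ?_, lipschitzWith_polarize he d h.lipschitz, fun x hx => ?_,
    fun n hn => ?_, fun ε => (gapEnergy_polarize_le he d hm ε).trans (h.gapEnergy_le ε)⟩
  · rcases le_total (inner ℝ e x) d with hs | hs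
    · rw [polarize_of_le hs]; exact le_max_of_le_left (h.nonneg _)
    · rw [polarize_of_ge hs]; exact le_min (h.nonneg _) (h.nonneg _)
  · rcases le_total (inner ℝ e x) d with hs | hs
    · rw [polarize_of_le hs]; exact max_le (h.le_bound _) (h.le_bound _)
    · rw [polarize_of_ge hs]; exact min_le_of_left_le (h.le_bound _)
  · rcases le_total (inner ℝ e x) d with hs | hs
    · have h1 : ‖x‖ ≤ ‖lineReflection e d x‖ := by
        refine (sq_le_sq₀ (norm_nonneg _) (norm_nonneg _)).1 ?_
        rw [norm_lineReflection_sq he]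
        nlinarith
      rw [polarize_of_le hs, h.support x hx, h.support _ (hx.trans_le h1), max_self]
    · rw [polarize_of_ge hs, h.support x hx, min_eq_left (h.nonneg _)]
  · rw [← h.lintegral_pow n hn]
    exact lintegral_comp_polarize he d hm (f := fun t => ENNReal.ofReal (t ^ n)) (by fun_prop)

/-- The common bound and support give dominated convergence of the power integrals, and Fatou's
lemma gives the gap energies. -/
theorem of_tendsto {f : ℕ → Plane → ℝ} (hf : ∀ n, IsCompetitor w L R B (f n))
    (hv : ∀ x, Filter.Tendsto (fun n => f n x) Filter.atTop (nhds (v x))) :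
    IsCompetitor w L R B v := by
  have hm : ∀ n, Measurable (f n) := fun n => (hf n).lipschitz.continuous.measurable
  refine ⟨fun x => ge_of_tendsto' (hv x) fun n => (hf n).nonneg x,
    fun x => le_of_tendsto' (hv x) fun n => (hf n).le_bound x,
    LipschitzWith.of_dist_le_mul fun x y => le_of_tendsto' ((hv x).dist (hv y)) fun n =>
      (hf n).lipschitz.dist_le_mul x y, fun x hx => ?_, fun n hn => ?_, fun ε => ?_⟩
  · refine tendsto_nhds_unique (hv x) ?_
    simp only [fun n => (hf n).support x hx]
    exact tendsto_const_nhds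
  · refine tendsto_nhds_unique (tendsto_lintegral_of_dominated_convergence
      (F := fun k x => ENNReal.ofReal (f k x ^ n))
      ((Metric.closedBall (0 : Plane) R).indicator fun _ => ENNReal.ofReal (B ^ n))
      (fun k => by have := hm k; fun_prop) (fun k => Filter.Eventually.of_forall fun x => ?_)
      ?_ (Filter.Eventually.of_forall fun x => ?_)) ?_
    · by_cases hx : x ∈ Metric.closedBall (0 : Plane) R
      · rw [Set.indicator_of_mem hx]
        exact ENNReal.ofReal_le_ofReal
          (pow_le_pow_left₀ ((hf k).nonneg x) ((hf k).le_bound x) n)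
      · have := (hf k).support x (by simpa using hx)
        simp [this, hn.ne']
    · rw [lintegral_indicator measurableSet_closedBall, setLIntegral_const]
      exact ENNReal.mul_ne_top ENNReal.ofReal_ne_top measure_closedBall_lt_top.ne
    · exact (ENNReal.continuous_ofReal.tendsto _).comp ((hv x).pow n)
    · simp only [fun k => (hf k).lintegral_pow n hn]
      exact tendsto_const_nhds
  · exact gapEnergy_le_of_tendsto hm (Filter.Eventually.of_forall hv)
      (fun n => (hf n).gapEnergy_le ε) tendsto_const_nhds

theorem integrable_norm_sq_mul (h : IsCompetitor w L R B v) :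
    Integrable fun x => ‖x‖ ^ 2 * v x := by
  have hc := h.lipschitz.continuous
  refine Continuous.integrable_of_hasCompactSupport (by fun_prop) ?_
  refine HasCompactSupport.of_support_subset_isCompact (isCompact_closedBall (0 : Plane) R) ?_
  intro x hx
  by_contra hx'
  exact hx (by simp [h.support x (by simpa using hx')])

end IsCompetitor

/-- A pointwise bounded sequence of functions on a countable set has a pointwise convergent
subsequence. -/
theorem exists_subseq_tendsto_of_countable {ι : Type*} [Countable ι] (f : ℕ → ι → ℝ) (b : ι → ℝ)
    (h0 : ∀ n i, 0 ≤ f n i) (hb : ∀ n i, f n i ≤ b i) :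
    ∃ (l : ι → ℝ) (φ : ℕ → ℕ), StrictMono φ ∧
      ∀ i, Filter.Tendsto (fun n => f (φ n) i) Filter.atTop (nhds (l i)) := by
  have hK : IsCompact (Set.univ.pi fun i => Set.Icc 0 (b i)) :=
    isCompact_univ_pi fun i => isCompact_Icc
  obtain ⟨l, -, φ, hφ, hl⟩ := hK.tendsto_subseq (x := f) fun n i _ => ⟨h0 n i, hb n i⟩
  exact ⟨l, φ, hφ, fun i => (tendsto_pi_nhds.1 hl) i⟩

/-- A bounded equi-Lipschitz sequence has a pointwise convergent subsequence. -/
theorem exists_subseq_tendsto_of_lipschitz {f : ℕ → Plane → ℝ} {L : NNReal} {B : ℝ}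
    (hL : ∀ n, LipschitzWith L (f n)) (h0 : ∀ n x, 0 ≤ f n x) (hB : ∀ n x, f n x ≤ B) :
    ∃ (v : Plane → ℝ) (φ : ℕ → ℕ), StrictMono φ ∧
      ∀ x, Filter.Tendsto (fun n => f (φ n) x) Filter.atTop (nhds (v x)) := by
  obtain ⟨l, φ, hφ, hl⟩ := exists_subseq_tendsto_of_countable
    (fun n (i : ℕ) => f n (TopologicalSpace.denseSeq Plane i)) (fun _ => B)
    (fun n i => h0 n _) (fun n i => hB n _)
  have hc : ∀ x, ∃ a, Filter.Tendsto (fun n => f (φ n) x) Filter.atTop (nhds a) := by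
    intro x
    refine cauchySeq_tendsto_of_complete (Metric.cauchySeq_iff'.2 fun δ hδ => ?_)
    -- Chosen so that passing from `x` to a point of the dense sequence costs at most `δ / 4`,
    -- twice; adding `1` to `L` avoids division by zero.
    set η := δ / (4 * (L + 1)) with hη
    have hL0 : (0 : ℝ) ≤ L := L.2
    have hη0 : 0 < η := by positivity
    obtain ⟨_, hy, i, rfl⟩ := Metric.dense_iff.1 (TopologicalSpace.denseRange_denseSeq Plane)
      x η hη0
    set q := TopologicalSpace.denseSeq Plane i with hq
    obtain ⟨N, hN⟩ := Metric.cauchySeq_iff'.1 (hl i).cauchySeq (δ / 2) (by positivity)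
    refine ⟨N, fun n hn => ?_⟩
    have h1 : ∀ m, dist (f (φ m) x) (f (φ m) q) ≤ δ / 4 := by
      intro m
      have hd : dist x q ≤ η := by rw [dist_comm]; exact (Metric.mem_ball.1 hy).le
      calc dist (f (φ m) x) (f (φ m) q) ≤ L * dist x q := (hL _).dist_le_mul _ _
        _ ≤ (L + 1) * η := by
          have := mul_le_mul_of_nonneg_left hd hL0
          nlinarith
        _ = δ / 4 := by rw [hη]; field_simp
    have h2 := hN n hn
    have h3 := dist_triangle4 (f (φ n) x) (f (φ n) q) (f (φ N) q) (f (φ N) x)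
    have h4 := h1 N
    rw [dist_comm] at h4
    linarith [h1 n]
  choose v hv using hc
  exact ⟨v, φ, hφ, hv⟩

/-- A competitor with the least second moment. -/
theorem exists_isCompetitor_isMin {w : Plane → ℝ} {L : NNReal} {R B : ℝ}
    (hw : IsCompetitor w L R B w) : ∃ v, IsCompetitor w L R B v ∧
      ∀ v', IsCompetitor w L R B v' → ∫ x, ‖x‖ ^ 2 * v x ≤ ∫ x, ‖x‖ ^ 2 * v' x := by
  set S := (fun v : Plane → ℝ => ∫ x, ‖x‖ ^ 2 * v x) '' {v | IsCompetitor w L R B v} with hS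
  have hbdd : BddBelow S := ⟨0, by
    rintro _ ⟨v, hv, rfl⟩
    exact integral_nonneg fun x => mul_nonneg (sq_nonneg _) (IsCompetitor.nonneg hv x)⟩
  obtain ⟨u, -, hu, huS⟩ := exists_seq_tendsto_sInf (S := S) ⟨_, w, hw, rfl⟩ hbdd
  choose f hf hfu using huS
  obtain ⟨v, φ, hφ, hv⟩ := exists_subseq_tendsto_of_lipschitz
    (fun n => (hf n).lipschitz) (fun n => (hf n).nonneg) (fun n => (hf n).le_bound)
  have hvc : IsCompetitor w L R B v := IsCompetitor.of_tendsto (fun n => hf (φ n)) hv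
  refine ⟨v, hvc, fun v' hv' => ?_⟩
  have hlim : Filter.Tendsto (fun n => ∫ x, ‖x‖ ^ 2 * f (φ n) x) Filter.atTop
      (nhds (∫ x, ‖x‖ ^ 2 * v x)) := by
    refine tendsto_integral_of_dominated_convergence
      ((Metric.closedBall (0 : Plane) R).indicator fun _ => R ^ 2 * B) (fun n => ?_) ?_
      (fun n => Filter.Eventually.of_forall fun x => ?_)
      (Filter.Eventually.of_forall fun x => (hv x).const_mul _)
    · exact (hf (φ n)).integrable_norm_sq_mul.1
    · exact (integrable_indicator_iff measurableSet_closedBall).2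
        (integrableOn_const measure_closedBall_lt_top.ne)
    · rw [Real.norm_of_nonneg (mul_nonneg (sq_nonneg _) ((hf (φ n)).nonneg x))]
      by_cases hx : x ∈ Metric.closedBall (0 : Plane) R
      · rw [Set.indicator_of_mem hx]
        rw [mem_closedBall_zero_iff] at hx
        exact mul_le_mul (pow_le_pow_left₀ (norm_nonneg _) hx 2) ((hf (φ n)).le_bound x)
          ((hf (φ n)).nonneg x) (sq_nonneg _)
      · rw [Set.indicator_of_notMem hx, (hf (φ n)).support x (by simpa using hx), mul_zero]
  have h1 : ∫ x, ‖x‖ ^ 2 * v x = sInf S := by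
    refine tendsto_nhds_unique hlim ?_
    simp only [hfu]
    exact hu.comp hφ.tendsto_atTop
  rw [h1]
  exact csInf_le hbdd ⟨v', hv', rfl⟩

/-- A competitor with the least second moment does not increase under reflections away from the
origin. -/
theorem le_lineReflection_of_isMin {w v : Plane → ℝ} {L : NNReal} {R B : ℝ}
    (hv : IsCompetitor w L R B v)
    (hmin : ∀ v', IsCompetitor w L R B v' → ∫ x, ‖x‖ ^ 2 * v x ≤ ∫ x, ‖x‖ ^ 2 * v' x)
    {e : Plane} (he : ‖e‖ = 1) {d : ℝ} (hd : 0 < d) {x : Plane} (hx : inner ℝ e x < d) :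
    v (lineReflection e d x) ≤ v x := by
  set σ := lineReflection e d with hσ
  have hp := hv.polarize he hd
  set p := polarize e d v with hpdef
  have hσc : Continuous σ := continuous_lineReflection e d
  have hvc := hv.lipschitz.continuous
  have hpc := hp.lipschitz.continuous
  have hsym : ∀ {u : Plane → ℝ}, IsCompetitor w L R B u →
      Integrable (fun x => ‖x‖ ^ 2 * u x + ‖σ x‖ ^ 2 * u (σ x)) ∧
      ∫ x, (‖x‖ ^ 2 * u x + ‖σ x‖ ^ 2 * u (σ x)) = 2 * ∫ x, ‖x‖ ^ 2 * u x := by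
    intro u hu
    have i1 := hu.integrable_norm_sq_mul
    have i2 : Integrable fun x => ‖σ x‖ ^ 2 * u (σ x) :=
      (measurePreserving_lineReflection he d).integrable_comp_of_integrable i1
    refine ⟨i1.add i2, ?_⟩
    rw [integral_add i1 i2, integral_comp_lineReflection he d (fun x => ‖x‖ ^ 2 * u x), two_mul]
  -- The decrease of the second moment under polarization, summed over the pair `{x, σ x}`. It is
  -- pointwise nonnegative, and minimality makes its integral nonpositive, so by continuity it
  -- vanishes identically.
  set g : Plane → ℝ := fun x => (‖x‖ ^ 2 * v x + ‖σ x‖ ^ 2 * v (σ x)) -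
    (‖x‖ ^ 2 * p x + ‖σ x‖ ^ 2 * p (σ x)) with hg
  have hgc : Continuous g := by fun_prop
  have hσn : ∀ x, ‖σ x‖ ^ 2 = ‖x‖ ^ 2 - 4 * d * (inner ℝ e x - d) := norm_lineReflection_sq he d
  have hg1 : ∀ x, inner ℝ e x ≤ d → g x = 4 * d * (d - inner ℝ e x) * (max (v x) (v (σ x)) - v x) := by
    intro x hx
    simp only [hg, hpdef, hσ, polarize_of_le hx, polarize_lineReflection_of_le he hx]
    have := max_add_min (v x) (v (lineReflection e d x))
    have h2 : min (v x) (v (lineReflection e d x)) =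
      v x + v (lineReflection e d x) - max (v x) (v (lineReflection e d x)) := by linarith
    have h3 := hσn x
    rw [hσ] at h3
    rw [h2, h3]
    ring
  have hg2 : ∀ x, d ≤ inner ℝ e x → g x = 4 * d * (inner ℝ e x - d) * (v x - min (v x) (v (σ x))) := by
    intro x hx
    simp only [hg, hpdef, hσ, polarize_of_ge hx, polarize_lineReflection_of_ge he hx]
    have := max_add_min (v x) (v (lineReflection e d x))
    have h2 : max (v x) (v (lineReflection e d x)) =
      v x + v (lineReflection e d x) - min (v x) (v (lineReflection e d x)) := by linarith
    have h3 := hσn x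
    rw [hσ] at h3
    rw [h2, h3]
    ring
  have hg0 : 0 ≤ g := by
    intro x
    rcases le_total (inner ℝ e x) d with hx | hx
    · rw [hg1 x hx]
      exact mul_nonneg (mul_nonneg (by positivity) (sub_nonneg.2 hx))
        (sub_nonneg.2 (le_max_left _ _))
    · rw [hg2 x hx]
      exact mul_nonneg (mul_nonneg (by positivity) (sub_nonneg.2 hx))
        (sub_nonneg.2 (min_le_left _ _))
  have hgi : Integrable g := (hsym hv).1.sub (hsym hp).1
  have hint : ∫ x, g x = 0 := by
    refine le_antisymm ?_ (integral_nonneg hg0)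
    rw [hg, integral_sub (hsym hv).1 (hsym hp).1, (hsym hv).2, (hsym hp).2]
    linarith [hmin p hp]
  have hzero : g = 0 := by
    rw [integral_eq_zero_iff_of_nonneg hg0 hgi] at hint
    exact (Continuous.ae_eq_iff_eq volume hgc continuous_zero).1 hint
  have h := congrFun hzero x
  rw [hg1 x hx.le, Pi.zero_apply, mul_eq_zero] at h
  rcases h with h | h
  · have : 0 < 4 * d * (d - inner ℝ e x) := by
      have := sub_pos.2 hx
      positivity
    exact absurd h this.ne'
  · rw [← sub_eq_zero.1 h]
    exact le_max_right _ _

/-- The line is the perpendicular bisector of `p` and `q`. Since `p` is nearer to the origin than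
`q`, the origin lies strictly on the side of `p`, which is `0 < d`. -/
theorem lineReflection_bisector {p q : Plane} (h : ‖p‖ < ‖q‖) :
    ∃ e d, ‖e‖ = 1 ∧ 0 < d ∧ inner ℝ e p < d ∧ lineReflection e d p = q := by
  have hne : q - p ≠ 0 := by
    rw [sub_ne_zero]
    rintro rfl
    exact lt_irrefl _ h
  have hr : 0 < ‖q - p‖ := norm_pos_iff.2 hne
  set e := ‖q - p‖⁻¹ • (q - p) with he
  have he1 : ‖e‖ = 1 := by rw [he, norm_smul, norm_inv, norm_norm, inv_mul_cancel₀ hr.ne']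
  have hqp : q - p = ‖q - p‖ • e := by rw [he, smul_smul, mul_inv_cancel₀ hr.ne', one_smul]
  have h1 : inner ℝ e (q - p) = ‖q - p‖ := by
    rw [hqp, inner_smul_right, real_inner_self_eq_norm_sq, he1, norm_smul, he1]
    simp
  have h2 : ‖q‖ ^ 2 = ‖p‖ ^ 2 + 2 * ‖q - p‖ * inner ℝ e p + ‖q - p‖ ^ 2 := by
    have h3 : q = p + ‖q - p‖ • e := by rw [← hqp]; abel
    conv_lhs => rw [h3]
    rw [norm_add_sq_real, inner_smul_right, real_inner_comm, norm_smul, he1, norm_norm]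
    ring
  refine ⟨e, inner ℝ e p + ‖q - p‖ / 2, he1, ?_, by linarith, ?_⟩
  · have h3 : ‖p‖ ^ 2 < ‖q‖ ^ 2 := pow_lt_pow_left₀ h (norm_nonneg _) two_ne_zero
    by_contra hc
    have : 2 * ‖q - p‖ * (inner ℝ e p + ‖q - p‖ / 2) ≤ 0 :=
      mul_nonpos_of_nonneg_of_nonpos (by positivity) (not_lt.1 hc)
    nlinarith
  · have h3 : lineReflection e (inner ℝ e p + ‖q - p‖ / 2) p = p + ‖q - p‖ • e := by
      rw [lineReflection]
      module
    rw [h3, ← hqp]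
    abel

/-- Symmetric decreasing rearrangement of a Lipschitz function with compact support. -/
theorem exists_radial_of_lipschitz {w : Plane → ℝ} {L : NNReal} (hL : LipschitzWith L w)
    (hc : HasCompactSupport w) (h0 : ∀ x, 0 ≤ w x) :
    ∃ v : Plane → ℝ, Continuous v ∧ (∀ x, 0 ≤ v x) ∧ (∀ x y, ‖x‖ ≤ ‖y‖ → v y ≤ v x) ∧
      (∀ n : ℕ, 0 < n → ∫⁻ x, ENNReal.ofReal (v x ^ n) = ∫⁻ x, ENNReal.ofReal (w x ^ n)) ∧
      ∀ ε, gapEnergy ε v ≤ gapEnergy ε w := by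
  obtain ⟨B, hB⟩ := hc.exists_bound_of_continuous hL.continuous
  obtain ⟨R, hR⟩ := hc.isBounded.subset_closedBall (0 : Plane)
  have hw : IsCompetitor w L R B w := ⟨h0, fun x => (le_abs_self _).trans (hB x), hL,
    fun x hx => image_eq_zero_of_notMem_tsupport fun h => by
      have := hR h
      rw [mem_closedBall_zero_iff] at this
      linarith, fun _ _ => rfl, fun _ => le_rfl⟩
  obtain ⟨v, hv, hmin⟩ := exists_isCompetitor_isMin hw
  have hvc := hv.lipschitz.continuous
  have hlt : ∀ x y, ‖x‖ < ‖y‖ → v y ≤ v x := by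
    intro x y hxy
    obtain ⟨e, d, he, hd, hx, hσ⟩ := lineReflection_bisector hxy
    rw [← hσ]
    exact le_lineReflection_of_isMin hv hmin he hd hx
  refine ⟨v, hvc, hv.nonneg, fun x y hxy => ?_, hv.lintegral_pow, hv.gapEnergy_le⟩
  rcases hxy.lt_or_eq with h | h
  · exact hlt x y h
  · rcases eq_or_ne y 0 with rfl | hy
    · rw [norm_zero, norm_eq_zero] at h
      rw [h]
    -- For points of equal norm, `y` is pushed outward to `t • y` with `t > 1`, and continuity
    -- brings it back.
    have hlim : Filter.Tendsto (fun t : ℝ => v (t • y)) (nhdsWithin 1 (Set.Ioi 1))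
        (nhds (v ((1 : ℝ) • y))) := by
      refine Filter.Tendsto.mono_left ?_ nhdsWithin_le_nhds
      exact Continuous.tendsto (by fun_prop) _
    rw [one_smul] at hlim
    refine le_of_tendsto hlim ?_
    filter_upwards [self_mem_nhdsWithin] with t ht
    refine hlt x _ ?_
    have ht' : (1 : ℝ) < t := ht
    rw [norm_smul, Real.norm_of_nonneg (by linarith), h]
    have := norm_pos_iff.2 hy
    nlinarith

/-! ### Mollification and approximation by Lipschitz functions of compact support -/

/-- A Lipschitz probability density supported in the unit disc. -/
structure IsKernel (ρ : Plane → ℝ) (C : NNReal) : Prop where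
  nonneg : ∀ x, 0 ≤ ρ x
  lipschitz : LipschitzWith C ρ
  support : ∀ x, 1 < ‖x‖ → ρ x = 0
  integral_eq_one : ∫ x, ρ x = 1

/-- The average of the translates of `w` with weight `ρ`. -/
def mollify (ρ w : Plane → ℝ) (x : Plane) : ℝ := ∫ t, ρ t * w (x - t)

/-- The measure with density `ρ`. -/
def kernelMeasure (ρ : Plane → ℝ) : Measure Plane :=
  volume.withDensity fun t => ENNReal.ofReal (ρ t)

theorem mollify_eq_integral_sub (ρ w : Plane → ℝ) (x : Plane) :
    mollify ρ w x = ∫ y, ρ (x - y) * w y := by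
  rw [mollify, ← integral_sub_left_eq_self _ _ x]
  simp

namespace IsKernel

variable {ρ w : Plane → ℝ} {C : NNReal}

theorem hasCompactSupport (h : IsKernel ρ C) : HasCompactSupport ρ := by
  refine HasCompactSupport.of_support_subset_isCompact (isCompact_closedBall (0 : Plane) 1) ?_
  intro x hx
  by_contra hx'
  exact hx (h.support x (by simpa using hx'))

theorem integrable (h : IsKernel ρ C) : Integrable ρ :=
  h.lipschitz.continuous.integrable_of_hasCompactSupport h.hasCompactSupport

theorem isProbabilityMeasure (h : IsKernel ρ C) : IsProbabilityMeasure (kernelMeasure ρ) := by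
  refine ⟨?_⟩
  rw [kernelMeasure, withDensity_apply _ MeasurableSet.univ, setLIntegral_univ,
    ← ofReal_integral_eq_lintegral_ofReal h.integrable (Filter.Eventually.of_forall h.nonneg),
    h.integral_eq_one, ENNReal.ofReal_one]

theorem mollify_eq (h : IsKernel ρ C) (w : Plane → ℝ) (x : Plane) :
    mollify ρ w x = ∫ t, w (x - t) ∂(kernelMeasure ρ) := by
  have hm := h.lipschitz.continuous.measurable
  rw [kernelMeasure, integral_withDensity_eq_integral_toReal_smul (by fun_prop)
    (Filter.Eventually.of_forall fun _ => ENNReal.ofReal_lt_top)]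
  simp only [ENNReal.toReal_ofReal (h.nonneg _), smul_eq_mul, mollify]

theorem integrable_translate (h : IsKernel ρ C) (hw : MemLp w 2 volume) (x : Plane) :
    Integrable (fun t => ρ t * w (x - t)) := by
  have h1 : MemLp (fun t => w (x - t)) 2 volume :=
    hw.comp_measurePreserving (Measure.measurePreserving_sub_left volume x)
  exact (h1.locallyIntegrable (by norm_num)).integrable_smul_left_of_hasCompactSupport
    h.lipschitz.continuous h.hasCompactSupport

theorem integrable_kernelMeasure (h : IsKernel ρ C) (hw : MemLp w 2 volume) (x : Plane) :
    Integrable (fun t => w (x - t)) (kernelMeasure ρ) := by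
  have hm := h.lipschitz.continuous.measurable
  rw [kernelMeasure, integrable_withDensity_iff_integrable_smul' (by fun_prop)
    (Filter.Eventually.of_forall fun _ => ENNReal.ofReal_lt_top)]
  simpa only [ENNReal.toReal_ofReal (h.nonneg _), smul_eq_mul] using h.integrable_translate hw x

/-- Jensen's inequality for the probability measure `kernelMeasure ρ`, then Fubini and translation
invariance. The same argument applied to differences gives `gapEnergy_mollify_le`. -/
theorem lintegral_mollify_pow_le (h : IsKernel ρ C) (hw : Measurable w) {p : ℕ} (hp : 2 ≤ p) :
    ∫⁻ x, ‖mollify ρ w x‖ₑ ^ p ≤ ∫⁻ x, ‖w x‖ₑ ^ p := by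
  have := h.isProbabilityMeasure
  have hm : Measurable fun q : Plane × Plane => ‖w (q.1 - q.2)‖ₑ ^ p := by fun_prop
  calc ∫⁻ x, ‖mollify ρ w x‖ₑ ^ p
      ≤ ∫⁻ x, ∫⁻ t, ‖w (x - t)‖ₑ ^ p ∂(kernelMeasure ρ) := by
        refine lintegral_mono fun x => ?_
        rw [h.mollify_eq]
        exact enorm_integral_pow_le (Measurable.aestronglyMeasurable (by fun_prop)) hp
    _ = ∫⁻ t, ∫⁻ x, ‖w (x - t)‖ₑ ^ p ∂volume ∂(kernelMeasure ρ) :=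
        lintegral_lintegral_swap hm.aemeasurable
    _ = ∫⁻ _ : Plane, ∫⁻ x, ‖w x‖ₑ ^ p ∂volume ∂(kernelMeasure ρ) := by
        refine lintegral_congr fun t => ?_
        exact lintegral_sub_right_eq_self (fun x => ‖w x‖ₑ ^ p) t
    _ = _ := by simp

theorem gapEnergy_mollify_le (h : IsKernel ρ C) (hw : Measurable w) (hw2 : MemLp w 2 volume)
    (ε : ℝ) : gapEnergy ε (mollify ρ w) ≤ gapEnergy ε w := by
  have := h.isProbabilityMeasure
  refine lintegral_mono fun k => ?_
  have hm : Measurable fun q : Plane × Plane => ‖w (q.1 + k - q.2) - w (q.1 - q.2)‖ₑ ^ 2 := by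
    fun_prop
  calc ∫⁻ x, ‖mollify ρ w (x + k) - mollify ρ w x‖ₑ ^ 2
      ≤ ∫⁻ x, ∫⁻ t, ‖w (x + k - t) - w (x - t)‖ₑ ^ 2 ∂(kernelMeasure ρ) := by
        refine lintegral_mono fun x => ?_
        rw [h.mollify_eq, h.mollify_eq, ← integral_sub (h.integrable_kernelMeasure hw2 _)
          (h.integrable_kernelMeasure hw2 _)]
        exact enorm_integral_pow_le (Measurable.aestronglyMeasurable (by fun_prop)) le_rfl
    _ = ∫⁻ t, ∫⁻ x, ‖w (x + k - t) - w (x - t)‖ₑ ^ 2 ∂volume ∂(kernelMeasure ρ) :=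
        lintegral_lintegral_swap hm.aemeasurable
    _ = ∫⁻ _ : Plane, ∫⁻ x, ‖w (x + k) - w x‖ₑ ^ 2 ∂volume ∂(kernelMeasure ρ) := by
        refine lintegral_congr fun t => ?_
        rw [← lintegral_sub_right_eq_self (fun x => ‖w (x + k) - w x‖ₑ ^ 2) t]
        simp only [sub_add_eq_add_sub]
    _ = _ := by simp

theorem mollify_nonneg (h : IsKernel ρ C) (hw0 : ∀ x, 0 ≤ w x) (x : Plane) : 0 ≤ mollify ρ w x :=
  integral_nonneg fun _ => mul_nonneg (h.nonneg _) (hw0 _)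

/-- The difference of two translates of `ρ` is bounded by the Lipschitz constant and lives on two
unit discs. There `|w| ≤ 1 + w²`, whose integral is bounded independently of their centres. -/
theorem exists_lipschitzWith_mollify (h : IsKernel ρ C)
    (hw2 : MemLp w 2 volume) : ∃ L : NNReal, LipschitzWith L (mollify ρ w) := by
  set I := ∫⁻ y, ‖w y‖ₑ ^ 2 with hI
  have hIfin : I ≠ ⊤ := by
    have := eLpNorm_nnreal_pow_eq_lintegral (μ := (volume : Measure Plane)) (f := w)
      (p := 2) (by norm_num)
    have h2 : I = eLpNorm w 2 volume ^ 2 := by simpa using this.symm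
    rw [h2]
    exact ENNReal.pow_ne_top hw2.2.ne
  set V := volume (Metric.closedBall (0 : Plane) 1) with hV
  set M := V + V + I with hM
  have hMfin : M ≠ ⊤ := ENNReal.add_ne_top.2 ⟨ENNReal.add_ne_top.2
    ⟨measure_closedBall_lt_top.ne, measure_closedBall_lt_top.ne⟩, hIfin⟩
  have hint : ∀ x, Integrable fun y => ρ (x - y) * w y := fun x => by
    have := (h.integrable_translate hw2 x).comp_sub_left x
    simpa using this
  refine ⟨C * M.toNNReal, fun x x' => ?_⟩
  rw [edist_eq_enorm_sub, mollify_eq_integral_sub, mollify_eq_integral_sub,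
    ← integral_sub (hint x) (hint x')]
  have hS : MeasurableSet (Metric.closedBall x 1 ∪ Metric.closedBall x' 1) :=
    measurableSet_closedBall.union measurableSet_closedBall
  calc ‖∫ y, (ρ (x - y) * w y - ρ (x' - y) * w y)‖ₑ
      ≤ ∫⁻ y, ‖ρ (x - y) * w y - ρ (x' - y) * w y‖ₑ := enorm_integral_le_lintegral_enorm _
    _ ≤ ∫⁻ y, (C * edist x x') *
          ((Metric.closedBall x 1 ∪ Metric.closedBall x' 1).indicator 1 y + ‖w y‖ₑ ^ 2) := by
        refine lintegral_mono fun y => ?_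
        by_cases hy : y ∈ Metric.closedBall x 1 ∪ Metric.closedBall x' 1
        · rw [Set.indicator_of_mem hy, ← sub_mul, enorm_mul]
          refine mul_le_mul' ?_ ?_
          · rw [← edist_eq_enorm_sub]
            refine (h.lipschitz _ _).trans (le_of_eq ?_)
            rw [edist_sub_right]
          · rcases le_total ‖w y‖ₑ 1 with h1 | h1
            · exact h1.trans (by simp)
            · calc ‖w y‖ₑ = ‖w y‖ₑ * 1 := (mul_one _).symm
                _ ≤ ‖w y‖ₑ * ‖w y‖ₑ := by gcongr
                _ ≤ _ := by rw [sq]; exact le_add_self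
        · simp only [Set.mem_union, Metric.mem_closedBall, not_or, not_le] at hy
          rw [h.support (x - y) (by rw [← dist_eq_norm, dist_comm]; exact hy.1),
            h.support (x' - y) (by rw [← dist_eq_norm, dist_comm]; exact hy.2)]
          simp
    _ = (C * edist x x') * (volume (Metric.closedBall x 1 ∪ Metric.closedBall x' 1) + I) := by
        rw [lintegral_const_mul' _ _ (by finiteness),
          lintegral_add_left (measurable_one.indicator hS), lintegral_indicator_one hS]
    _ ≤ (C * edist x x') * M := by
        have hV' : ∀ z : Plane, volume (Metric.closedBall z 1) = V := fun z =>
          Measure.addHaar_closedBall_center volume z 1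
        have hle := measure_union_le (μ := volume) (Metric.closedBall x 1) (Metric.closedBall x' 1)
        rw [hV', hV'] at hle
        exact mul_le_mul_right (add_le_add_left hle I) _
    _ = _ := by
        rw [ENNReal.coe_mul, ENNReal.coe_toNNReal hMfin]
        ring

/-- By Jensen, the square of the average at `x` is at most the supremum of `ρ` times the integral of
`w²` over the unit disc around `x`, and far out this is part of the tail of an integrable function.
-/
theorem exists_mollify_lt (h : IsKernel ρ C) (hw : Measurable w) (hw2 : MemLp w 2 volume)
    {δ : ℝ} (hδ : 0 < δ) : ∃ R : ℝ, ∀ x, R < ‖x‖ → mollify ρ w x < δ := by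
  have := h.isProbabilityMeasure
  obtain ⟨B, hB⟩ := h.hasCompactSupport.exists_bound_of_continuous h.lipschitz.continuous
  have hB0 : 0 ≤ B := (norm_nonneg _).trans (hB 0)
  have hi : Integrable fun y => w y ^ 2 := hw2.integrable_sq
  have hanti : Antitone fun n : ℕ => (Metric.ball (0 : Plane) n)ᶜ := fun m n hmn =>
    Set.compl_subset_compl.2 (Metric.ball_subset_ball (by exact_mod_cast hmn))
  have hlim := tendsto_setIntegral_of_antitone
    (fun n => measurableSet_ball.compl) hanti ⟨0, hi.integrableOn⟩
  have hempty : ⋂ n : ℕ, (Metric.ball (0 : Plane) n)ᶜ = ∅ := by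
    rw [← Set.compl_iUnion, Metric.iUnion_ball_nat, Set.compl_univ]
  rw [hempty, setIntegral_empty] at hlim
  obtain ⟨n, hn⟩ := ((hlim.eventually_lt_const (u := δ ^ 2 / (B + 1)) (by positivity))).exists
  refine ⟨n + 1, fun x hx => ?_⟩
  by_contra hge
  have hjensen : ‖mollify ρ w x‖ₑ ^ 2 ≤ ∫⁻ t, ‖w (x - t)‖ₑ ^ 2 ∂(kernelMeasure ρ) := by
    rw [h.mollify_eq]
    exact enorm_integral_pow_le (Measurable.aestronglyMeasurable (by fun_prop)) le_rfl
  have hm := h.lipschitz.continuous.measurable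
  have hup : ∫⁻ t, ‖w (x - t)‖ₑ ^ 2 ∂(kernelMeasure ρ) ≤
      ENNReal.ofReal (B * (δ ^ 2 / (B + 1))) := by
    rw [kernelMeasure, lintegral_withDensity_eq_lintegral_mul _ (by fun_prop) (by fun_prop)]
    calc _ = ∫⁻ t, ENNReal.ofReal (ρ t) * ‖w (x - t)‖ₑ ^ 2 := rfl
      _ = ∫⁻ y, ENNReal.ofReal (ρ (x - y)) * ‖w y‖ₑ ^ 2 := by
          rw [← lintegral_sub_left_eq_self _ x]
          simp
      _ ≤ ∫⁻ y, (Metric.ball (0 : Plane) n)ᶜ.indicator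
            (fun y => ENNReal.ofReal B * ‖w y‖ₑ ^ 2) y := by
          refine lintegral_mono fun y => ?_
          by_cases hy : y ∈ (Metric.ball (0 : Plane) n)ᶜ
          · rw [Set.indicator_of_mem hy]
            gcongr
            exact (le_abs_self _).trans (hB _)
          · simp only [Set.mem_compl_iff, not_not, mem_ball_zero_iff] at hy
            rw [h.support, ENNReal.ofReal_zero, zero_mul]
            · exact zero_le
            · have := norm_add_le (x - y) y
              rw [sub_add_cancel] at this
              linarith
      _ = ENNReal.ofReal B * ENNReal.ofReal (∫ y in (Metric.ball (0 : Plane) n)ᶜ, w y ^ 2) := by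
          rw [lintegral_indicator measurableSet_ball.compl,
            lintegral_const_mul' _ _ ENNReal.ofReal_ne_top, ofReal_integral_eq_lintegral_ofReal
            hi.integrableOn (Filter.Eventually.of_forall fun _ => sq_nonneg _)]
          simp only [enorm_sq_eq_ofReal_sq]
      _ ≤ _ := by
          rw [← ENNReal.ofReal_mul hB0]
          exact ENNReal.ofReal_le_ofReal (by gcongr)
  have h1 := hjensen.trans hup
  rw [enorm_sq_eq_ofReal_sq, ENNReal.ofReal_le_ofReal_iff (by positivity)] at h1
  have h2 : B * (δ ^ 2 / (B + 1)) < δ ^ 2 := by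
    rw [mul_div_assoc', div_lt_iff₀ (by positivity)]
    nlinarith [sq_pos_of_pos hδ]
  nlinarith [not_lt.1 hge]

end IsKernel

/-- Normalized bump functions concentrating at the origin. -/
def bump (n : ℕ) : ContDiffBump (0 : Plane) where
  rIn := 1 / (2 * (n + 1))
  rOut := 1 / (n + 1)
  rIn_pos := by positivity
  rIn_lt_rOut := by
    refine one_div_lt_one_div_of_lt (by positivity) ?_
    have : (0 : ℝ) ≤ n := n.cast_nonneg
    linarith

theorem exists_isKernel_bump (n : ℕ) : ∃ C, IsKernel ((bump n).normed volume) C := by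
  obtain ⟨C, hC⟩ := ContDiff.lipschitzWith_of_hasCompactSupport (𝕂 := ℝ) (n := 1)
    ((bump n).hasCompactSupport_normed (μ := volume)) (bump n).contDiff_normed one_ne_zero
  refine ⟨C, (bump n).nonneg_normed, hC, fun x hx => ?_, (bump n).integral_normed⟩
  have h1 : x ∉ Function.support ((bump n).normed volume) := by
    rw [(bump n).support_normed_eq]
    simp only [bump, mem_ball_zero_iff, not_lt]
    refine le_trans ?_ hx.le
    rw [div_le_one (by positivity)]
    have : (0 : ℝ) ≤ n := n.cast_nonneg
    linarith
  simpa using h1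

theorem ae_tendsto_mollify_bump {w : Plane → ℝ} (hw2 : MemLp w 2 volume) :
    ∀ᵐ x, Filter.Tendsto (fun n => mollify ((bump n).normed volume) w x) Filter.atTop
      (nhds (w x)) := by
  -- Lebesgue differentiation for these averages needs a bounded ratio of outer to inner radius,
  -- here `2`.
  refine ContDiffBump.ae_convolution_tendsto_right_of_locallyIntegrable (φ := bump) (K := 2)
    ?_ ?_ (hw2.locallyIntegrable (by norm_num))
  · exact tendsto_one_div_add_atTop_nhds_zero_nat
  · refine Filter.Eventually.of_forall fun n => le_of_eq ?_
    simp only [bump]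
    field_simp

/-- Approximation of a nonnegative function of finite energy from below by Lipschitz functions of
compact support. -/
theorem exists_lipschitz_approx {w : Plane → ℝ} (hw : Measurable w) (hw0 : ∀ x, 0 ≤ w x)
    (hw2 : MemLp w 2 volume) {θ : ENNReal} (hθ : θ < ∫⁻ x, ENNReal.ofReal (w x ^ 4)) :
    ∃ (f : Plane → ℝ) (L : NNReal), LipschitzWith L f ∧ HasCompactSupport f ∧ (∀ x, 0 ≤ f x) ∧
      (∀ ε, gapEnergy ε f ≤ gapEnergy ε w) ∧
      (∀ p : ℕ, 2 ≤ p → ∫⁻ x, ENNReal.ofReal (f x ^ p) ≤ ∫⁻ x, ENNReal.ofReal (w x ^ p)) ∧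
      θ < ∫⁻ x, ENNReal.ofReal (f x ^ 4) := by
  choose C hC using exists_isKernel_bump
  set m : ℕ → Plane → ℝ := fun n => mollify ((bump n).normed volume) w with hm
  -- Mollifications tend to zero at infinity, so subtracting a positive constant and taking the
  -- positive part gives compact support. This enlarges neither differences nor values.
  set f : ℕ → Plane → ℝ := fun n x => max (m n x - 1 / ((n : ℝ) + 1)) 0 with hf
  have hδ : ∀ n : ℕ, 0 < 1 / ((n : ℝ) + 1) := fun n => by positivity
  have hmL : ∀ n, ∃ L : NNReal, LipschitzWith L (m n) := fun n =>
    (hC n).exists_lipschitzWith_mollify hw2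
  have hm0 : ∀ n x, 0 ≤ m n x := fun n => (hC n).mollify_nonneg hw0
  have hdiff : ∀ n x y, |f n x - f n y| ≤ |m n x - m n y| := by
    intro n x y
    refine (abs_max_sub_max_le_abs _ _ _).trans (le_of_eq ?_)
    ring_nf
  have hfL : ∀ n, ∃ L : NNReal, LipschitzWith L (f n) := by
    intro n
    obtain ⟨L, hL⟩ := hmL n
    exact ⟨L, LipschitzWith.of_dist_le_mul fun x y => (hdiff n x y).trans (hL.dist_le_mul x y)⟩
  have hfm : ∀ n, Measurable (f n) := fun n => (hfL n).choose_spec.continuous.measurable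
  have hlim : ∀ᵐ x, Filter.Tendsto (fun n => f n x) Filter.atTop (nhds (w x)) := by
    filter_upwards [ae_tendsto_mollify_bump hw2] with x hx
    have h1 := (hx.sub tendsto_one_div_add_atTop_nhds_zero_nat).max
      (tendsto_const_nhds (x := (0 : ℝ)))
    rwa [sub_zero, max_eq_left (hw0 x)] at h1
  have hfatou : ∫⁻ x, ENNReal.ofReal (w x ^ 4) ≤
      Filter.liminf (fun n => ∫⁻ x, ENNReal.ofReal (f n x ^ 4)) Filter.atTop := by
    refine le_trans (le_of_eq ?_) (lintegral_liminf_le fun n => by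
      have := hfm n
      fun_prop)
    refine lintegral_congr_ae ?_
    filter_upwards [hlim] with x hx
    exact (((ENNReal.continuous_ofReal.tendsto _).comp (hx.pow 4)).liminf_eq).symm
  obtain ⟨n, hn⟩ := (Filter.eventually_lt_of_lt_liminf (hθ.trans_le hfatou)).exists
  obtain ⟨L, hL⟩ := hfL n
  obtain ⟨R, hR⟩ := (hC n).exists_mollify_lt hw hw2 (hδ n)
  refine ⟨f n, L, hL, ?_, fun x => le_max_right _ _, fun ε => ?_, fun p hp => ?_, hn⟩
  · refine HasCompactSupport.of_support_subset_isCompact (isCompact_closedBall (0 : Plane) R) ?_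
    intro x hx
    by_contra hx'
    refine hx (max_eq_right ?_)
    have := hR x (by simpa using hx')
    simp only [hm]
    linarith
  · exact (gapEnergy_mono (hdiff n) ε).trans ((hC n).gapEnergy_mollify_le hw hw2 ε)
  · have hen : ∀ {a : ℝ}, 0 ≤ a → ENNReal.ofReal (a ^ p) = ‖a‖ₑ ^ p := fun {a} ha => by
      rw [← ofReal_norm, Real.norm_of_nonneg ha, ENNReal.ofReal_pow ha]
    calc ∫⁻ x, ENNReal.ofReal (f n x ^ p) ≤ ∫⁻ x, ‖m n x‖ₑ ^ p := by
          refine lintegral_mono fun x => ?_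
          rw [← hen (hm0 n x)]
          refine ENNReal.ofReal_le_ofReal (pow_le_pow_left₀ (le_max_right _ _) ?_ p)
          exact max_le (by linarith [hδ n]) (hm0 n x)
      _ ≤ ∫⁻ x, ‖w x‖ₑ ^ p := (hC n).lintegral_mollify_pow_le hw hp
      _ = _ := lintegral_congr fun x => (hen (hw0 x)).symm

/-! ### Compactness of radially nonincreasing functions -/

/-- Helly's selection theorem for sequences of nonincreasing functions. -/
theorem exists_subseq_tendsto_of_antitone {F : ℕ → ℝ → ℝ} {b : ℝ → ℝ}
    (hF : ∀ n, Antitone (F n)) (h0 : ∀ n s, 0 ≤ F n s) (hb : ∀ n s, F n s ≤ b s) :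
    ∃ (u : ℝ → ℝ) (φ : ℕ → ℕ), StrictMono φ ∧ Antitone u ∧ (∀ s, 0 ≤ u s) ∧
      {s | ¬ Filter.Tendsto (fun n => F (φ n) s) Filter.atTop (nhds (u s))}.Countable := by
  obtain ⟨l, φ, hφ, hl⟩ := exists_subseq_tendsto_of_countable (fun n (q : ℚ) => F n q)
    (fun q => b q) (fun n q => h0 n q) (fun n q => hb n q)
  have hl0 : ∀ q, 0 ≤ l q := fun q => ge_of_tendsto' (hl q) fun n => h0 _ _
  have hne : ∀ s : ℝ, Nonempty {q : ℚ // (q : ℝ) < s} := fun s =>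
    let ⟨q, hq⟩ := exists_rat_lt s
    ⟨⟨q, hq⟩⟩
  -- The limits at rational points define a monotone function, and the sequence is squeezed to it
  -- wherever that function is continuous, that is, off a countable set.
  set u : ℝ → ℝ := fun s => ⨅ q : {q : ℚ // (q : ℝ) < s}, l q with hu
  have hbdd : ∀ s : ℝ, BddBelow (Set.range fun q : {q : ℚ // (q : ℝ) < s} => l q) := fun s =>
    ⟨0, by rintro _ ⟨q, rfl⟩; exact hl0 q⟩
  have hul : ∀ {s : ℝ} {q : ℚ}, (q : ℝ) < s → u s ≤ l q := fun {s q} h =>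
    ciInf_le (hbdd s) ⟨q, h⟩
  have hanti : Antitone u := fun s t hst =>
    have := hne s
    le_ciInf fun q => hul (q.2.trans_le hst)
  refine ⟨u, φ, hφ, hanti, fun s => Real.iInf_nonneg fun q => hl0 q,
    hanti.countable_not_continuousAt.mono fun s hs => ?_⟩
  simp only [Set.mem_ofPred_eq] at hs ⊢
  contrapose! hs
  rw [tendsto_order]
  constructor
  · intro a ha
    have h1 := (hs.eventually_const_lt ha).filter_mono (nhdsWithin_le_nhds (s := Set.Ioi s))
    obtain ⟨t, hat, hst⟩ := (h1.and self_mem_nhdsWithin).exists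
    obtain ⟨q, hsq, hqt⟩ := exists_rat_btwn (show s < t from hst)
    filter_upwards [(hl q).eventually_const_lt (hat.trans_le (hul hqt))] with n hn
    exact hn.trans_le (hF _ hsq.le)
  · intro a ha
    have := hne s
    obtain ⟨q, hq⟩ := exists_lt_of_ciInf_lt ha
    filter_upwards [(hl q).eventually_lt_const hq] with n hn
    exact (hF _ q.2.le).trans_lt hn

/-- On the disc of radius `‖x‖` the function is at least `f x`, so this disc alone contributes the
left-hand side to the `L²` integral. -/
theorem radial_bound {f : Plane → ℝ} (h0 : ∀ x, 0 ≤ f x)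
    (hr : ∀ x y, ‖x‖ ≤ ‖y‖ → f y ≤ f x) (h2 : ∫⁻ x, ENNReal.ofReal (f x ^ 2) ≤ 1) (x : Plane) :
    f x ^ 2 * (Real.pi * ‖x‖ ^ 2) ≤ 1 := by
  have hpi := Real.pi_pos
  have h : ENNReal.ofReal (f x ^ 2) * ENNReal.ofReal (Real.pi * ‖x‖ ^ 2) ≤ 1 := by
    rw [← volume_ball_eq 0 (norm_nonneg x), ← setLIntegral_const]
    refine le_trans (setLIntegral_mono' measurableSet_ball fun y hy => ?_)
      ((setLIntegral_le_lintegral _ _).trans h2)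
    refine ENNReal.ofReal_le_ofReal (pow_le_pow_left₀ (h0 x) (hr y x ?_) 2)
    exact (mem_ball_zero_iff.1 hy).le
  rw [← ENNReal.ofReal_mul (sq_nonneg _), ← ENNReal.ofReal_one,
    ENNReal.ofReal_le_ofReal_iff zero_le_one] at h
  exact h

/-- A sequence of radially nonincreasing functions bounded in `L²` has a subsequence converging
almost everywhere to a radial function. -/
theorem exists_subseq_tendsto_of_radial {f : ℕ → Plane → ℝ} (h0 : ∀ n x, 0 ≤ f n x)
    (hr : ∀ n x y, ‖x‖ ≤ ‖y‖ → f n y ≤ f n x)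
    (h2 : ∀ n, ∫⁻ x, ENNReal.ofReal (f n x ^ 2) ≤ 1) :
    ∃ (v : Plane → ℝ) (φ : ℕ → ℕ), StrictMono φ ∧ Measurable v ∧ (∀ x, 0 ≤ v x) ∧
      (∀ x y, ‖x‖ = ‖y‖ → v x = v y) ∧
      ∀ᵐ x, Filter.Tendsto (fun n => f (φ n) x) Filter.atTop (nhds (v x)) := by
  -- Logarithmic radii turn the positive radii into the whole line, where Helly's theorem is stated;
  -- the origin is a null set.
  set p : ℝ → Plane := fun s => EuclideanSpace.single 0 (Real.exp s) with hp
  have hpn : ∀ s, ‖p s‖ = Real.exp s := fun s => by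
    simp [hp, abs_of_pos (Real.exp_pos s)]
  have hb : ∀ n s, f n (p s) ≤ 1 + 1 / (Real.pi * Real.exp s ^ 2) := by
    intro n s
    have h := radial_bound (h0 n) (hr n) (h2 n) (p s)
    have hpi := Real.pi_pos
    rw [hpn, ← le_div_iff₀ (by positivity)] at h
    nlinarith [sq_nonneg (f n (p s) - 1), h0 n (p s)]
  obtain ⟨u, φ, hφ, hu, hu0, hcount⟩ := exists_subseq_tendsto_of_antitone
    (F := fun n s => f n (p s)) (fun n s t hst => hr n _ _ (by
      rw [hpn, hpn]; exact Real.exp_le_exp.2 hst)) (fun n s => h0 n _) hb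
  refine ⟨fun x => u (Real.log ‖x‖), φ, hφ, hu.measurable.comp (by fun_prop), fun x => hu0 _,
    fun x y hxy => congrArg (fun t => u (Real.log t)) hxy, ?_⟩
  set N := {s | ¬ Filter.Tendsto (fun n => f (φ n) (p s)) Filter.atTop (nhds (u s))} with hN
  -- Convergence fails for countably many radii at most, and each gives a circle of measure zero.
  have hnull : volume ({0} ∪ ⋃ s ∈ N, Metric.sphere (0 : Plane) (Real.exp s)) = 0 := by
    rw [measure_union_null_iff]
    refine ⟨measure_singleton _, (measure_biUnion_null_iff hcount).2 fun s _ => ?_⟩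
    exact Measure.addHaar_sphere _ _ _
  refine measure_mono_null (fun x hx => ?_) hnull
  by_contra hx'
  simp only [Set.mem_union, Set.mem_singleton_iff, Set.mem_iUnion, mem_sphere_zero_iff_norm,
    not_or, not_exists] at hx'
  have hx0 : 0 < ‖x‖ := norm_pos_iff.2 hx'.1
  have hsN : Real.log ‖x‖ ∉ N := fun h => hx'.2 _ h (Real.exp_log hx0).symm
  simp only [hN, Set.mem_ofPred_eq, not_not] at hsN
  refine hx ?_
  have heq : ∀ n, f n x = f n (p (Real.log ‖x‖)) := fun n => by
    have hn : ‖p (Real.log ‖x‖)‖ = ‖x‖ := by rw [hpn, Real.exp_log hx0]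
    exact le_antisymm (hr n _ _ hn.le) (hr n _ _ hn.ge)
  simpa only [Set.mem_ofPred_eq, heq] using hsN

/-- If `η t² ≤ 1`, then `t⁴` is at most `1 / η²`; otherwise `η t⁶` outweighs `t⁴`. The term `η t²`
plays the corresponding role for small `t`, in `truncate_eq_zero`. -/
theorem truncate_le {η t : ℝ} (hη : 0 < η) : max (t ^ 4 - η * t ^ 6 - η * t ^ 2) 0 ≤ 1 / η ^ 2 := by
  refine max_le ?_ (by positivity)
  rw [le_div_iff₀ (by positivity)]
  rcases le_total (η * t ^ 2) 1 with h | h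
  · have h1 : (η * t ^ 2) ^ 2 ≤ 1 := pow_le_one₀ (by positivity) h
    have h2 : 0 ≤ (η * t ^ 6 + η * t ^ 2) * η ^ 2 := by positivity
    nlinarith
  · have h1 : t ^ 4 ≤ η * t ^ 6 := by nlinarith [mul_le_mul_of_nonneg_left h (sq_nonneg (t ^ 2))]
    have h2 : 0 ≤ η * t ^ 2 * η ^ 2 := by positivity
    nlinarith [sq_nonneg η]

theorem truncate_eq_zero {η t : ℝ} (hη : 0 < η) (ht : t ^ 2 ≤ η) :
    max (t ^ 4 - η * t ^ 6 - η * t ^ 2) 0 = 0 := by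
  refine max_eq_right ?_
  have h1 : t ^ 4 ≤ η * t ^ 2 := by nlinarith [mul_le_mul_of_nonneg_right ht (sq_nonneg t)]
  have h2 : 0 ≤ η * t ^ 6 := by positivity
  linarith

/-- No mass of the fourth power is lost under almost everywhere convergence of radially
nonincreasing functions bounded in `L²` and `L⁶`. -/
theorem one_le_lintegral_pow_four_of_tendsto {f : ℕ → Plane → ℝ} {v : Plane → ℝ}
    (hm : ∀ n, Measurable (f n)) (h0 : ∀ n x, 0 ≤ f n x) (hv0 : ∀ x, 0 ≤ v x)
    (hr : ∀ n x y, ‖x‖ ≤ ‖y‖ → f n y ≤ f n x)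
    (h2 : ∀ n, ∫⁻ x, ENNReal.ofReal (f n x ^ 2) ≤ 1)
    (h4 : ∀ n, ∫⁻ x, ENNReal.ofReal (f n x ^ 4) = 1) {S : ℝ}
    (h6 : ∀ n, ∫⁻ x, ENNReal.ofReal (f n x ^ 6) ≤ ENNReal.ofReal S)
    (hlim : ∀ᵐ x, Filter.Tendsto (fun n => f n x) Filter.atTop (nhds (v x))) :
    1 ≤ ∫⁻ x, ENNReal.ofReal (v x ^ 4) := by
  have hpi := Real.pi_pos
  set I := ∫⁻ x, ENNReal.ofReal (v x ^ 4) with hI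
  have key : ∀ η : ℝ, 0 < η → 1 ≤ I + ENNReal.ofReal η * (ENNReal.ofReal S + 1) := by
    intro η hη
    -- The fourth power with large and small values removed. Replacing `t ^ 4` by `ψ t` costs at
    -- most `η * (S + 1)` in the integral, by the `L⁶` and `L²` bounds, and `ψ` is bounded, so
    -- dominated convergence becomes available.
    set ψ : ℝ → ℝ := fun t => max (t ^ 4 - η * t ^ 6 - η * t ^ 2) 0 with hψ
    have hψc : Continuous ψ := by fun_prop
    -- Outside this radius `radial_bound` gives `f n x ^ 2 ≤ η`, where `ψ` vanishes.
    set R := Real.sqrt (1 / (Real.pi * η)) with hR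
    have hR2 : R ^ 2 = 1 / (Real.pi * η) := Real.sq_sqrt (by positivity)
    have hT : Filter.Tendsto (fun n => ∫⁻ x, ENNReal.ofReal (ψ (f n x))) Filter.atTop
        (nhds (∫⁻ x, ENNReal.ofReal (ψ (v x)))) := by
      refine tendsto_lintegral_of_dominated_convergence
        ((Metric.closedBall (0 : Plane) R).indicator fun _ => ENNReal.ofReal (1 / η ^ 2))
        (fun n => by have := hm n; fun_prop)
        (fun n => Filter.Eventually.of_forall fun x => ?_) ?_ ?_
      · by_cases hx : x ∈ Metric.closedBall (0 : Plane) R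
        · rw [Set.indicator_of_mem hx]
          exact ENNReal.ofReal_le_ofReal (truncate_le hη)
        · rw [Set.indicator_of_notMem hx]
          rw [mem_closedBall_zero_iff, not_le] at hx
          have h3 := radial_bound (h0 n) (hr n) (h2 n) x
          have h5 : f n x ^ 2 ≤ η := by
            have hx2 : R ^ 2 < ‖x‖ ^ 2 := pow_lt_pow_left₀ hx (Real.sqrt_nonneg _) two_ne_zero
            rw [hR2, div_lt_iff₀ (by positivity)] at hx2
            by_contra hc
            have hc' := not_le.1 hc
            have hxp : 0 < Real.pi * ‖x‖ ^ 2 := by nlinarith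
            nlinarith [mul_lt_mul_of_pos_right hc' hxp]
          simp only [hψ, truncate_eq_zero hη h5, ENNReal.ofReal_zero, le_refl]
      · rw [lintegral_indicator measurableSet_closedBall, setLIntegral_const]
        exact ENNReal.mul_ne_top ENNReal.ofReal_ne_top measure_closedBall_lt_top.ne
      · filter_upwards [hlim] with x hx
        exact (ENNReal.continuous_ofReal.tendsto _).comp ((hψc.tendsto _).comp hx)
    have hle : ∀ n, 1 ≤ (∫⁻ x, ENNReal.ofReal (ψ (f n x))) +
        ENNReal.ofReal η * (ENNReal.ofReal S + 1) := by
      intro n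
      have hmn := hm n
      calc (1 : ENNReal) = ∫⁻ x, ENNReal.ofReal (f n x ^ 4) := (h4 n).symm
        _ ≤ ∫⁻ x, (ENNReal.ofReal (ψ (f n x)) + ENNReal.ofReal η *
              (ENNReal.ofReal (f n x ^ 6) + ENNReal.ofReal (f n x ^ 2))) := by
            refine lintegral_mono fun x => ?_
            have hx := h0 n x
            rw [← ENNReal.ofReal_add (by positivity) (by positivity),
              ← ENNReal.ofReal_mul hη.le, ← ENNReal.ofReal_add (le_max_right _ _)
              (by positivity)]
            refine ENNReal.ofReal_le_ofReal ?_
            have : f n x ^ 4 - η * f n x ^ 6 - η * f n x ^ 2 ≤ ψ (f n x) := le_max_left _ _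
            linarith
        _ = (∫⁻ x, ENNReal.ofReal (ψ (f n x))) + ENNReal.ofReal η *
              ((∫⁻ x, ENNReal.ofReal (f n x ^ 6)) + ∫⁻ x, ENNReal.ofReal (f n x ^ 2)) := by
            rw [lintegral_add_left (by fun_prop), lintegral_const_mul _ (by fun_prop),
              lintegral_add_left (by fun_prop)]
        _ ≤ _ := by
            gcongr
            · exact h6 n
            · exact h2 n
    have h1 := ge_of_tendsto' (hT.add tendsto_const_nhds) hle
    refine h1.trans ?_
    refine add_le_add (lintegral_mono fun x => ENNReal.ofReal_le_ofReal ?_) le_rfl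
    refine max_le ?_ (pow_nonneg (hv0 x) 4)
    have : 0 ≤ η * v x ^ 6 + η * v x ^ 2 := by have := hv0 x; positivity
    linarith
  have hlim0 : Filter.Tendsto (fun η : ℝ => I + ENNReal.ofReal η * (ENNReal.ofReal S + 1))
      (nhdsWithin 0 (Set.Ioi 0)) (nhds (I + ENNReal.ofReal 0 * (ENNReal.ofReal S + 1))) := by
    refine Filter.Tendsto.mono_left ?_ nhdsWithin_le_nhds
    refine tendsto_const_nhds.add (ENNReal.Tendsto.mul_const
      (ENNReal.continuous_ofReal.tendsto 0) (Or.inr (by finiteness)))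
  rw [ENNReal.ofReal_zero, zero_mul, add_zero] at hlim0
  refine ge_of_tendsto hlim0 ?_
  filter_upwards [self_mem_nhdsWithin] with η hη
  exact key η hη

theorem lintegral_pow_le_of_tendsto {f : ℕ → Plane → ℝ} {v : Plane → ℝ}
    (hm : ∀ n, Measurable (f n))
    (hlim : ∀ᵐ x, Filter.Tendsto (fun n => f n x) Filter.atTop (nhds (v x))) (p : ℕ)
    {c : ℕ → ENNReal} {b : ENNReal} (hc : ∀ n, ∫⁻ x, ENNReal.ofReal (f n x ^ p) ≤ c n)
    (hcb : Filter.Tendsto c Filter.atTop (nhds b)) :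
    ∫⁻ x, ENNReal.ofReal (v x ^ p) ≤ b := by
  calc ∫⁻ x, ENNReal.ofReal (v x ^ p)
      ≤ Filter.liminf (fun n => ∫⁻ x, ENNReal.ofReal (f n x ^ p)) Filter.atTop := by
        refine le_trans (le_of_eq ?_) (lintegral_liminf_le fun n => by
          have := hm n
          fun_prop)
        refine lintegral_congr_ae ?_
        filter_upwards [hlim] with x hx
        exact (((ENNReal.continuous_ofReal.tendsto _).comp (hx.pow p)).liminf_eq).symm
    _ ≤ Filter.liminf c Filter.atTop := Filter.liminf_le_liminf (Filter.Eventually.of_forall hc)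
    _ = b := hcb.liminf_eq

/-- Compactness of normalized radially nonincreasing functions with convergent energy bounds. -/
theorem exists_radial_limit {f : ℕ → Plane → ℝ} {A S : ℕ → ℝ} {a s : ℝ}
    (hm : ∀ n, Measurable (f n)) (h0 : ∀ n x, 0 ≤ f n x)
    (hr : ∀ n x y, ‖x‖ ≤ ‖y‖ → f n y ≤ f n x)
    (h2 : ∀ n, ∫⁻ x, ENNReal.ofReal (f n x ^ 2) ≤ 1)
    (h4 : ∀ n, ∫⁻ x, ENNReal.ofReal (f n x ^ 4) = 1)
    (h6 : ∀ n, ∫⁻ x, ENNReal.ofReal (f n x ^ 6) ≤ ENNReal.ofReal (S n))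
    (hA : ∀ n, EnergyLE (f n) (A n)) (hAa : Filter.Tendsto A Filter.atTop (nhds a))
    (hSs : Filter.Tendsto S Filter.atTop (nhds s)) :
    ∃ v : Plane → ℝ, Measurable v ∧ (∀ x, 0 ≤ v x) ∧ (∀ x y, ‖x‖ = ‖y‖ → v x = v y) ∧
      ∫⁻ x, ENNReal.ofReal (v x ^ 2) ≤ 1 ∧ 1 ≤ ∫⁻ x, ENNReal.ofReal (v x ^ 4) ∧
      ∫⁻ x, ENNReal.ofReal (v x ^ 6) ≤ ENNReal.ofReal s ∧ EnergyLE v a := by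
  obtain ⟨v, φ, hφ, hvm, hv0, hvr, hlim⟩ := exists_subseq_tendsto_of_radial h0 hr h2
  have hφt := hφ.tendsto_atTop
  obtain ⟨B, hB⟩ := hSs.bddAbove_range
  refine ⟨v, hvm, hv0, hvr, ?_, ?_, ?_, fun ε hε => ?_⟩
  · exact lintegral_pow_le_of_tendsto (fun n => hm (φ n)) hlim 2 (fun n => h2 (φ n))
      tendsto_const_nhds
  · exact one_le_lintegral_pow_four_of_tendsto (fun n => hm (φ n)) (fun n => h0 (φ n)) hv0
      (fun n => hr (φ n)) (fun n => h2 (φ n)) (fun n => h4 (φ n)) (S := B)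
      (fun n => (h6 (φ n)).trans (ENNReal.ofReal_le_ofReal (hB ⟨_, rfl⟩))) hlim
  · exact lintegral_pow_le_of_tendsto (fun n => hm (φ n)) hlim 6 (fun n => h6 (φ n))
      ((ENNReal.continuous_ofReal.tendsto _).comp (hSs.comp hφt))
  · exact gapEnergy_le_of_tendsto (fun n => hm (φ n)) hlim (fun n => hA (φ n) ε hε)
      ((ENNReal.continuous_ofReal.tendsto _).comp (((hAa.comp hφt).pow 2).const_mul _))

/-! ### The functional, normalization and minimizing sequences -/

theorem lintegral_norm_pow {F : Type*} [NormedAddCommGroup F] (u : Plane → F) {n : ℕ}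
    (hn : n ≠ 0) : ∫⁻ x, ENNReal.ofReal (‖u x‖ ^ n) = eLpNorm u n volume ^ n := by
  have h := eLpNorm_nnreal_pow_eq_lintegral (μ := (volume : Measure Plane)) (f := u)
    (p := (n : NNReal)) (by exact_mod_cast hn)
  simp only [NNReal.coe_natCast, ENNReal.rpow_natCast, ENNReal.coe_natCast] at h
  rw [h]
  refine lintegral_congr fun x => ?_
  rw [← ofReal_norm, ENNReal.ofReal_pow (norm_nonneg _)]

theorem LpNorm_pow_eq {F : Type*} [NormedAddCommGroup F] (u : Plane → F) {n : ℕ}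
    (hn : n ≠ 0) : LpNorm n u ^ n = (∫⁻ x, ENNReal.ofReal (‖u x‖ ^ n)).toReal := by
  rw [lintegral_norm_pow u hn, ENNReal.toReal_pow, LpNorm]

theorem LpNorm_nonneg {F : Type*} [NormedAddCommGroup F] (p : ENNReal) (u : Plane → F) :
    0 ≤ LpNorm p u := ENNReal.toReal_nonneg

theorem functionalF_nonneg {𝕜 : Type*} [RCLike 𝕜] (α : ℝ) (u : Plane → 𝕜) :
    0 ≤ functionalF α u := by
  have := LpNorm_nonneg 2 (weakGradient u)
  have := LpNorm_nonneg 2 u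
  have := LpNorm_nonneg 6 u
  have := LpNorm_nonneg 4 u
  unfold functionalF
  positivity

/-- With `p = 1 / (1 + α)` and `q = α / (2 * (1 + α))` the exponents of the squared gradient norm
and of the power integrals are `p`, `p + q` and `q`. The relation `p + 2 * q = 1` is equivalent to
invariance under scaling of values and of the variable. -/
theorem functionalF_eq {𝕜 : Type*} [RCLike 𝕜] {α : ℝ} (hα : 0 < α) (u : Plane → 𝕜) :
    functionalF α u = (LpNorm 2 (weakGradient u) ^ 2) ^ (1 / (1 + α)) *
      (∫⁻ x, ENNReal.ofReal (‖u x‖ ^ 2)).toReal ^ (1 / (1 + α) + α / (2 * (1 + α))) *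
      (∫⁻ x, ENNReal.ofReal (‖u x‖ ^ 6)).toReal ^ (α / (2 * (1 + α))) /
      (∫⁻ x, ENNReal.ofReal (‖u x‖ ^ 4)).toReal := by
  have h2 := LpNorm_pow_eq u (n := 2) (by norm_num)
  have h4 := LpNorm_pow_eq u (n := 4) (by norm_num)
  have h6 := LpNorm_pow_eq u (n := 6) (by norm_num)
  rw [← h2, ← h4, ← h6, functionalF]
  simp only [← Real.rpow_natCast_mul (LpNorm_nonneg _ _), Nat.cast_ofNat]
  congr 4
  · ring
  · field_simp
  · field_simp
    norm_num

theorem memLp_two_of_lintegral {v : Plane → ℝ} (hv : Measurable v) (h0 : ∀ x, 0 ≤ v x)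
    (h2 : ∫⁻ x, ENNReal.ofReal (v x ^ 2) ≠ ⊤) : MemLp v 2 volume := by
  refine ⟨hv.aestronglyMeasurable, lt_top_iff_ne_top.2 fun h => h2 ?_⟩
  have := lintegral_norm_pow v (n := 2) (by norm_num)
  simp only [Real.norm_of_nonneg (h0 _), Nat.cast_ofNat, h] at this
  rw [this]
  simp

/-- Every nonzero `H¹` function can be replaced by a normalized radially nonincreasing function
with almost no larger value of the functional. -/
theorem exists_normalized_radial {𝕜 : Type*} [RCLike 𝕜] {α : ℝ} (hα : 0 < α) {u : Plane → 𝕜}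
    (hu : u ∈ nonzeroH1 𝕜) {c : ℝ} (hc : functionalF α u < c) :
    ∃ (f : Plane → ℝ) (E T : ℝ), Measurable f ∧ (∀ x, 0 ≤ f x) ∧
      (∀ x y, ‖x‖ ≤ ‖y‖ → f y ≤ f x) ∧ ∫⁻ x, ENNReal.ofReal (f x ^ 2) ≤ 1 ∧
      ∫⁻ x, ENNReal.ofReal (f x ^ 4) = 1 ∧ ∫⁻ x, ENNReal.ofReal (f x ^ 6) ≤ ENNReal.ofReal T ∧
      0 ≤ E ∧ 0 ≤ T ∧ EnergyLE f (Real.sqrt E) ∧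
      E ^ (1 / (1 + α)) * T ^ (α / (2 * (1 + α))) ≤ c := by
  obtain ⟨⟨hu2, g, hg, hgw⟩, hune⟩ := hu
  have hc0 : 0 < c := (functionalF_nonneg α u).trans_lt hc
  set p := 1 / (1 + α) with hp
  set q := α / (2 * (1 + α)) with hq
  have hp0 : 0 < p := by positivity
  have hq0 : 0 < q := by positivity
  have hpq : p + 2 * q = 1 := by rw [hp, hq]; field_simp
  have hen := hgw.energyLE hu2 hg
  rw [← LpNorm_weakGradient hg hgw] at hen
  set G := LpNorm 2 (weakGradient u) with hG
  obtain ⟨u', hu'm, huu'⟩ := hu2.1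
  set w : Plane → ℝ := fun x => ‖u' x‖ with hw
  have hwm : Measurable w := hu'm.norm.measurable
  have hw0 : ∀ x, 0 ≤ w x := fun x => norm_nonneg _
  have hwint : ∀ n : ℕ, ∫⁻ x, ENNReal.ofReal (w x ^ n) = ∫⁻ x, ENNReal.ofReal (‖u x‖ ^ n) := by
    intro n
    refine lintegral_congr_ae ?_
    filter_upwards [huu'] with x hx
    rw [hx]
  have hwE : EnergyLE w G := hen.of_gapEnergy_le fun ε => by
    rw [gapEnergy_congr_ae huu']
    exact gapEnergy_mono (fun x y => by
      simpa [hw] using abs_norm_sub_norm_le (u' x) (u' y)) ε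
  have hw2 : MemLp w 2 volume := (hu2.ae_eq huu').norm
  have hfin2 : ∫⁻ x, ENNReal.ofReal (w x ^ 2) ≠ ⊤ := by
    rw [hwint, lintegral_norm_pow u (by norm_num)]
    exact ENNReal.pow_ne_top hu2.2.ne
  have hfin4 : ∫⁻ x, ENNReal.ofReal (w x ^ 4) ≠ ⊤ :=
    ne_top_of_le_ne_top (ENNReal.mul_ne_top ENNReal.ofReal_ne_top hfin2)
      (lintegral_pow_add_two_le hwm hw0 hwE hfin2 (q := 2) (by norm_num))
  have hfin6 : ∫⁻ x, ENNReal.ofReal (w x ^ 6) ≠ ⊤ :=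
    ne_top_of_le_ne_top (ENNReal.mul_ne_top ENNReal.ofReal_ne_top hfin4)
      (lintegral_pow_add_two_le hwm hw0 hwE hfin2 (q := 4) (by norm_num))
  set N2 := (∫⁻ x, ENNReal.ofReal (w x ^ 2)).toReal with hN2
  set N4 := (∫⁻ x, ENNReal.ofReal (w x ^ 4)).toReal with hN4
  set N6 := (∫⁻ x, ENNReal.ofReal (w x ^ 6)).toReal with hN6
  have hN2' : 0 ≤ N2 := ENNReal.toReal_nonneg
  have hN6' : 0 ≤ N6 := ENNReal.toReal_nonneg
  have hN40 : 0 < N4 := by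
    refine ENNReal.toReal_pos (fun h => hune ?_) hfin4
    rw [lintegral_eq_zero_iff (by fun_prop)] at h
    filter_upwards [h, huu'] with x hx hxu
    simp only [Pi.zero_apply, ENNReal.ofReal_eq_zero] at hx
    have h1 : w x ^ 4 = 0 := le_antisymm hx (pow_nonneg (hw0 x) 4)
    rw [hxu]
    exact norm_eq_zero.1 (pow_eq_zero_iff (by norm_num) |>.1 h1)
  set X := (G ^ 2) ^ p * N2 ^ (p + q) * N6 ^ q with hX
  have hX0 : 0 ≤ X := by positivity
  have hF : functionalF α u = X / N4 := by
    rw [functionalF_eq hα]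
    simp only [← hwint, hX, hG, hN2, hN4, hN6, hp, hq]
  -- The strict inequality `functionalF α u < c` leaves room for the fourth-power integral to
  -- decrease in the approximation; the numerator only decreases.
  have hθ : X / c < N4 := by
    rw [hF, div_lt_iff₀ hN40] at hc
    rw [div_lt_iff₀ hc0]
    linarith
  have hθ' : ENNReal.ofReal (X / c) < ∫⁻ x, ENNReal.ofReal (w x ^ 4) := by
    rw [← ENNReal.ofReal_toReal hfin4]
    exact (ENNReal.ofReal_lt_ofReal_iff hN40).2 hθ
  obtain ⟨k, L, hkL, hkc, hk0, hkE, hkp, hk4⟩ := exists_lipschitz_approx hwm hw0 hw2 hθ'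
  obtain ⟨v, hvc, hv0, hvr, hvp, hvE⟩ := exists_radial_of_lipschitz hkL hkc hk0
  have hvm := hvc.measurable
  have hvE' : EnergyLE v G := hwE.of_gapEnergy_le fun ε => (hvE ε).trans (hkE ε)
  have hv2 : ∫⁻ x, ENNReal.ofReal (v x ^ 2) ≤ ∫⁻ x, ENNReal.ofReal (w x ^ 2) :=
    (hvp 2 (by norm_num)).trans_le (hkp 2 le_rfl)
  have hv4 : ∫⁻ x, ENNReal.ofReal (v x ^ 4) ≤ ∫⁻ x, ENNReal.ofReal (w x ^ 4) :=
    (hvp 4 (by norm_num)).trans_le (hkp 4 (by norm_num))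
  have hv6 : ∫⁻ x, ENNReal.ofReal (v x ^ 6) ≤ ∫⁻ x, ENNReal.ofReal (w x ^ 6) :=
    (hvp 6 (by norm_num)).trans_le (hkp 6 (by norm_num))
  have hv4θ : ENNReal.ofReal (X / c) < ∫⁻ x, ENNReal.ofReal (v x ^ 4) := by
    rw [hvp 4 (by norm_num)]; exact hk4
  have hf2 := ne_top_of_le_ne_top hfin2 hv2
  have hf4 := ne_top_of_le_ne_top hfin4 hv4
  have hf6 := ne_top_of_le_ne_top hfin6 hv6
  set Q2 := (∫⁻ x, ENNReal.ofReal (v x ^ 2)).toReal with hQ2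
  set Q4 := (∫⁻ x, ENNReal.ofReal (v x ^ 4)).toReal with hQ4
  set Q6 := (∫⁻ x, ENNReal.ofReal (v x ^ 6)).toReal with hQ6
  have hQ2N : Q2 ≤ N2 := ENNReal.toReal_mono hfin2 hv2
  have hQ6N : Q6 ≤ N6 := ENNReal.toReal_mono hfin6 hv6
  have hQ60 : 0 ≤ Q6 := ENNReal.toReal_nonneg
  have hQ4θ : X / c < Q4 := (ENNReal.ofReal_lt_iff_lt_toReal (by positivity) hf4).1 hv4θ
  have hQ40 : 0 < Q4 := (by positivity : 0 ≤ X / c).trans_lt hQ4θ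
  have hQ20 : 0 < Q2 := by
    refine ENNReal.toReal_pos (fun h => ?_) hf2
    have h1 := lintegral_pow_add_two_le hvm hv0 hvE' hf2 (q := 2) (by norm_num)
    rw [h, mul_zero, nonpos_iff_eq_zero] at h1
    rw [hQ4, h1] at hQ40
    exact lt_irrefl _ hQ40
  -- The scalings solve `l² m⁻² Q2 = 1` and `l⁴ m⁻² Q4 = 1`.
  set l := Real.sqrt (Q2 / Q4) with hl
  set m := Real.sqrt (Q2 ^ 2 / Q4) with hm
  have hl2 : l ^ 2 = Q2 / Q4 := Real.sq_sqrt (by positivity)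
  have hm2 : m ^ 2 = Q2 ^ 2 / Q4 := Real.sq_sqrt (by positivity)
  have hl0 : 0 < l := Real.sqrt_pos.2 (by positivity)
  have hm0 : 0 < m := Real.sqrt_pos.2 (by positivity)
  have hscale : ∀ n : ℕ, ∫⁻ x, ENNReal.ofReal (v x ^ n) ≠ ⊤ →
      ∫⁻ x, ENNReal.ofReal ((l * v (m • x)) ^ n) =
        ENNReal.ofReal (l ^ n * (m ^ 2)⁻¹ * (∫⁻ x, ENNReal.ofReal (v x ^ n)).toReal) := by
    intro n hn
    simp_rw [mul_pow, ENNReal.ofReal_mul (pow_nonneg hl0.le n)]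
    rw [lintegral_const_mul' _ _ ENNReal.ofReal_ne_top,
      lintegral_comp_smul hm0.ne' (fun x => ENNReal.ofReal (v x ^ n)), mul_assoc,
      ENNReal.ofReal_mul (by positivity), ENNReal.ofReal_mul (by positivity),
      ENNReal.ofReal_toReal hn, inv_pow]
  refine ⟨fun x => l * v (m • x), l ^ 2 * G ^ 2, Q2 * Q6 / Q4 ^ 2, by fun_prop,
    fun x => mul_nonneg hl0.le (hv0 _), fun x y hxy => ?_, ?_, ?_, ?_, by positivity,
    by positivity, ?_, ?_⟩
  · refine mul_le_mul_of_nonneg_left (hvr _ _ ?_) hl0.le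
    rw [norm_smul, norm_smul]
    gcongr
  · rw [hscale 2 hf2, ← hQ2, hl2, hm2]
    refine le_of_eq ?_
    rw [ENNReal.ofReal_eq_one]
    field_simp
  · rw [hscale 4 hf4, ← hQ4, show l ^ 4 = (l ^ 2) ^ 2 by ring, hl2, hm2, ENNReal.ofReal_eq_one]
    field_simp
  · rw [hscale 6 hf6, ← hQ6, show l ^ 6 = (l ^ 2) ^ 3 by ring, hl2, hm2]
    refine ENNReal.ofReal_le_ofReal (le_of_eq ?_)
    field_simp
  · rw [← mul_pow, Real.sqrt_sq (mul_nonneg hl0.le (LpNorm_nonneg _ _))]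
    exact (hvE'.comp_smul hm0).const_mul l
  · rw [hl2]
    have h1 : (Q2 / Q4 * G ^ 2) ^ p * (Q2 * Q6 / Q4 ^ 2) ^ q =
        (G ^ 2) ^ p * Q2 ^ (p + q) * Q6 ^ q / Q4 := by
      rw [Real.mul_rpow (by positivity) (by positivity), Real.div_rpow hQ20.le hQ40.le,
        Real.div_rpow (by positivity) (by positivity), Real.mul_rpow hQ20.le hQ60,
        Real.rpow_add hQ20, ← Real.rpow_natCast_mul hQ40.le]
      have h2 : Q4 = Q4 ^ p * Q4 ^ (((2 : ℕ) : ℝ) * q) := by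
        rw [← Real.rpow_add hQ40, Nat.cast_ofNat, hpq, Real.rpow_one]
      conv_rhs => rw [h2]
      field_simp
    rw [h1, div_le_iff₀ hQ40]
    have h3 : (G ^ 2) ^ p * Q2 ^ (p + q) * Q6 ^ q ≤ X := by
      rw [hX]
      gcongr
    rw [div_lt_iff₀ hc0] at hQ4θ
    linarith

/-- A bump function, whose classical gradient is a weak gradient by integration by parts.
Nonemptiness lets the infimum be approached by actual values of the functional. -/
theorem nonzeroH1_nonempty (𝕜 : Type*) [RCLike 𝕜] : (nonzeroH1 𝕜).Nonempty := by
  set φ : Plane → ℝ := ⇑(bump 0) with hφdef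
  have hφ : ContDiff ℝ ∞ φ := (bump 0).contDiff
  have hc : HasCompactSupport φ := (bump 0).hasCompactSupport
  have hfc := hφ.continuous_fderiv (by simp)
  set g : Plane → Plane := fun x => WithLp.toLp 2 fun i => fderiv ℝ φ x (EuclideanSpace.single i 1)
    with hg
  have hgc : Continuous g := by fun_prop
  have hgs : HasCompactSupport g := (hc.fderiv ℝ).comp_left (g := fun D : Plane →L[ℝ] ℝ =>
    (WithLp.toLp 2 fun i => D (EuclideanSpace.single i 1) : Plane)) (by ext; simp)
  have hφ2 : MemLp φ 2 volume := hφ.continuous.memLp_of_hasCompactSupport hc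
  have hg2 : MemLp g 2 volume := hgc.memLp_of_hasCompactSupport hgs
  have hw : IsWeakGradient φ g := by
    intro ψ hψ hψc i
    have hψf := hψ.continuous_fderiv (by simp)
    have h := integral_mul_fderiv_eq_neg_fderiv_mul_of_integrable (μ := (volume : Measure Plane))
      (f := φ) (g := ψ) (v := EuclideanSpace.single i 1) ?_ ?_ ?_ ?_ ?_
    · simp only [smul_eq_mul, hg]
      simp only [mul_comm _ (φ _), mul_comm (ψ _)]
      exact h
    · refine Continuous.integrable_of_hasCompactSupport (by
        have := hψ.continuous
        fun_prop) (hψc.mul_left)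
    · refine Continuous.integrable_of_hasCompactSupport (by
        have := hφ.continuous
        fun_prop) (hc.mul_right)
    · refine Continuous.integrable_of_hasCompactSupport (hφ.continuous.mul hψ.continuous)
        (hc.mul_right)
    · exact fun x _ => (hφ.differentiable (by simp)) x
    · exact fun x _ => (hψ.differentiable (by simp)) x
  refine ⟨fun x => (φ x : 𝕜),
    ((hw.energyLE hφ2 hg2).memH1_ofReal 𝕜 (LpNorm_nonneg _ _) hφ2).1, fun h => ?_⟩
  have h1 : (fun x => (φ x : 𝕜)) = 0 := by
    refine (Continuous.ae_eq_iff_eq volume ?_ continuous_const).1 h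
    have := hφ.continuous
    fun_prop
  have h2 := congrFun h1 0
  simp only [Pi.zero_apply, RCLike.ofReal_eq_zero] at h2
  have h3 : φ 0 = 1 := (bump 0).one_of_mem_closedBall (by simp [(bump 0).rIn_pos.le])
  linarith

/-- A normalized minimizing sequence, with convergent energy and `L⁶` bounds. -/
theorem exists_minimizing_sequence (𝕜 : Type*) [RCLike 𝕜] {α : ℝ} (hα : 0 < α) :
    ∃ (f : ℕ → Plane → ℝ) (A T : ℕ → ℝ) (a t : ℝ), (∀ n, Measurable (f n)) ∧
      (∀ n x, 0 ≤ f n x) ∧ (∀ n x y, ‖x‖ ≤ ‖y‖ → f n y ≤ f n x) ∧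
      (∀ n, ∫⁻ x, ENNReal.ofReal (f n x ^ 2) ≤ 1) ∧
      (∀ n, ∫⁻ x, ENNReal.ofReal (f n x ^ 4) = 1) ∧
      (∀ n, ∫⁻ x, ENNReal.ofReal (f n x ^ 6) ≤ ENNReal.ofReal (T n)) ∧
      (∀ n, EnergyLE (f n) (A n)) ∧ Filter.Tendsto A Filter.atTop (nhds a) ∧
      Filter.Tendsto T Filter.atTop (nhds t) ∧ 0 ≤ a ∧ 0 ≤ t ∧
      (a ^ 2) ^ (1 / (1 + α)) * t ^ (α / (2 * (1 + α))) ≤ infimumC 𝕜 α := by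
  have hbdd : BddBelow (functionalF α '' nonzeroH1 𝕜) := ⟨0, by
    rintro _ ⟨u, -, rfl⟩
    exact functionalF_nonneg α u⟩
  have hne : (functionalF α '' nonzeroH1 𝕜).Nonempty := (nonzeroH1_nonempty 𝕜).image _
  set C := infimumC 𝕜 α with hC
  have hC0 : 0 ≤ C := le_csInf hne (by
    rintro _ ⟨u, -, rfl⟩
    exact functionalF_nonneg α u)
  have hex : ∀ n : ℕ, ∃ u ∈ nonzeroH1 𝕜, functionalF α u < C + 1 / ((n : ℝ) + 1) := by
    intro n
    obtain ⟨_, ⟨u, hu, rfl⟩, hlt⟩ := exists_lt_of_csInf_lt hne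
      (show sInf (functionalF α '' nonzeroH1 𝕜) < C + 1 / ((n : ℝ) + 1) from
        lt_add_of_pos_right _ (by positivity))
    exact ⟨u, hu, hlt⟩
  choose u hu hlt using hex
  choose f E T hfm hf0 hfr hf2 hf4 hf6 hE0 hT0 hfE hET using
    fun n => exists_normalized_radial hα (hu n) (hlt n)
  set p := 1 / (1 + α) with hp
  set q := α / (2 * (1 + α)) with hq
  have hp0 : 0 < p := by positivity
  have hq0 : 0 < q := by positivity
  have hK : 0 < sobolevConst 2 := by
    have := levelConst_pos
    unfold sobolevConst
    positivity
  -- Neither factor of the bounded product `E n ^ p * T n ^ q` can degenerate to zero, so each is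
  -- also bounded above. For `E` this is the Gagliardo–Nirenberg inequality `1 = ∫ f⁴ ≤ K E ∫ f² ≤ K
  -- E`.
  have hElow : ∀ n, 1 / sobolevConst 2 ≤ E n := by
    intro n
    have h1 := lintegral_pow_add_two_le (hfm n) (hf0 n) (hfE n)
      (ne_top_of_le_ne_top ENNReal.one_ne_top (hf2 n)) (q := 2) (by norm_num)
    rw [hf4 n, Real.sq_sqrt (hE0 n)] at h1
    have h2 : (1 : ENNReal) ≤ ENNReal.ofReal (sobolevConst 2 * E n) := by
      refine h1.trans ?_
      calc _ ≤ ENNReal.ofReal (sobolevConst 2 * E n) * 1 := by gcongr; exact hf2 n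
        _ = _ := mul_one _
    rw [ENNReal.one_le_ofReal] at h2
    rw [div_le_iff₀ hK]
    linarith
  -- Integrate `2 f⁴ ≤ f² + f⁶`, which is `f² (f² - 1)² ≥ 0`.
  have hTlow : ∀ n, 1 ≤ T n := by
    intro n
    have hmn := hfm n
    have h1 : (2 : ENNReal) ≤ 1 + ENNReal.ofReal (T n) := by
      calc (2 : ENNReal) = 2 * ∫⁻ x, ENNReal.ofReal (f n x ^ 4) := by rw [hf4 n, mul_one]
        _ = ∫⁻ x, 2 * ENNReal.ofReal (f n x ^ 4) := by
            rw [lintegral_const_mul _ (by fun_prop)]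
        _ ≤ ∫⁻ x, (ENNReal.ofReal (f n x ^ 2) + ENNReal.ofReal (f n x ^ 6)) := by
            refine lintegral_mono fun x => ?_
            have hx := hf0 n x
            rw [two_mul_ofReal, ← ENNReal.ofReal_add (by positivity) (by positivity)]
            refine ENNReal.ofReal_le_ofReal ?_
            nlinarith [mul_nonneg (sq_nonneg (f n x)) (sq_nonneg (f n x ^ 2 - 1))]
        _ = (∫⁻ x, ENNReal.ofReal (f n x ^ 2)) + ∫⁻ x, ENNReal.ofReal (f n x ^ 6) :=
            lintegral_add_left (by fun_prop) _
        _ ≤ _ := add_le_add (hf2 n) (hf6 n)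
    rw [← ENNReal.ofReal_one, ← ENNReal.ofReal_add zero_le_one (hT0 n),
      ← ENNReal.ofReal_ofNat 2, ENNReal.ofReal_le_ofReal_iff (by linarith [hT0 n])] at h1
    linarith
  have hCn : ∀ n : ℕ, C + 1 / ((n : ℝ) + 1) ≤ C + 1 := fun n => by
    have : 1 / ((n : ℝ) + 1) ≤ 1 := by
      rw [div_le_one (by positivity)]
      linarith [n.cast_nonneg (α := ℝ)]
    linarith
  have hEup : ∀ n, E n ≤ (C + 1) ^ p⁻¹ := by
    intro n
    rw [Real.le_rpow_inv_iff_of_pos (hE0 n) (by linarith) hp0]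
    refine le_trans ?_ ((hET n).trans (hCn n))
    exact le_mul_of_one_le_right (Real.rpow_nonneg (hE0 n) _)
      (Real.one_le_rpow (hTlow n) hq0.le)
  have hTup : ∀ n, T n ≤ ((C + 1) / (1 / sobolevConst 2) ^ p) ^ q⁻¹ := by
    intro n
    rw [Real.le_rpow_inv_iff_of_pos (hT0 n) (by positivity) hq0, le_div_iff₀ (by positivity)]
    refine le_trans ?_ ((hET n).trans (hCn n))
    rw [mul_comm]
    gcongr
    · exact Real.rpow_nonneg (hT0 n) _
    · exact hElow n
  obtain ⟨⟨e, t⟩, het, φ, hφ, hlim⟩ := (isCompact_Icc.prod isCompact_Icc).tendsto_subseq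
    (x := fun n => (E n, T n)) (s := Set.Icc (1 / sobolevConst 2) ((C + 1) ^ p⁻¹) ×ˢ
      Set.Icc 1 (((C + 1) / (1 / sobolevConst 2) ^ p) ^ q⁻¹))
    (fun n => ⟨⟨hElow n, hEup n⟩, ⟨hTlow n, hTup n⟩⟩)
  have he : Filter.Tendsto (fun n => E (φ n)) Filter.atTop (nhds e) :=
    (continuous_fst.tendsto _).comp hlim
  have ht : Filter.Tendsto (fun n => T (φ n)) Filter.atTop (nhds t) :=
    (continuous_snd.tendsto _).comp hlim
  have he0 : 0 ≤ e := ge_of_tendsto' he fun n => hE0 _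
  have ht0 : 0 ≤ t := ge_of_tendsto' ht fun n => hT0 _
  refine ⟨fun n => f (φ n), fun n => Real.sqrt (E (φ n)), fun n => T (φ n), Real.sqrt e, t,
    fun n => hfm _, fun n => hf0 _, fun n => hfr _, fun n => hf2 _, fun n => hf4 _, fun n => hf6 _,
    fun n => hfE _, (Real.continuous_sqrt.tendsto _).comp he, ht, Real.sqrt_nonneg _, ht0, ?_⟩
  rw [Real.sq_sqrt he0]
  have h1 : Filter.Tendsto (fun n => E (φ n) ^ p * T (φ n) ^ q) Filter.atTop
      (nhds (e ^ p * t ^ q)) :=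
    (he.rpow_const (Or.inr hp0.le)).mul (ht.rpow_const (Or.inr hq0.le))
  have h2 : Filter.Tendsto (fun n => C + 1 / ((φ n : ℝ) + 1)) Filter.atTop (nhds (C + 0)) :=
    tendsto_const_nhds.add (tendsto_one_div_add_atTop_nhds_zero_nat.comp hφ.tendsto_atTop)
  rw [add_zero] at h2
  exact le_of_tendsto_of_tendsto' h1 h2 fun n => hET (φ n)

end GagliardoNirenberg

end

/-! ### Attainment of the infimum -/

theorem theorem3p1 (𝕜 : Type*) [RCLike 𝕜] (α : ℝ) (hα : 0 < α) :
    ∃ v : GagliardoNirenberg.Plane → ℝ,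
      (∀ x, 0 ≤ v x) ∧
      (∀ x y, ‖x‖ = ‖y‖ → v x = v y) ∧
      (fun x => (v x : 𝕜)) ∈ GagliardoNirenberg.nonzeroH1 𝕜 ∧
      GagliardoNirenberg.functionalF α (fun x => (v x : 𝕜)) = GagliardoNirenberg.infimumC 𝕜 α ∧
      IsLeast (GagliardoNirenberg.functionalF α '' GagliardoNirenberg.nonzeroH1 𝕜)
        (GagliardoNirenberg.infimumC 𝕜 α) := by
  open GagliardoNirenberg in
  obtain ⟨f, A, T, a, t, hfm, hf0, hfr, hf2, hf4, hf6, hfA, hAa, hTt, ha, ht, hle⟩ :=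
    exists_minimizing_sequence 𝕜 hα
  obtain ⟨v, hvm, hv0, hvr, hv2, hv4, hv6, hvE⟩ :=
    exists_radial_limit hfm hf0 hfr hf2 hf4 hf6 hfA hAa hTt
  have hfin2 : ∫⁻ x, ENNReal.ofReal (v x ^ 2) ≠ ⊤ := ne_top_of_le_ne_top ENNReal.one_ne_top hv2
  have hfin4 : ∫⁻ x, ENNReal.ofReal (v x ^ 4) ≠ ⊤ :=
    ne_top_of_le_ne_top (ENNReal.mul_ne_top ENNReal.ofReal_ne_top hfin2)
      (lintegral_pow_add_two_le hvm hv0 hvE hfin2 (q := 2) (by norm_num))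
  obtain ⟨hH1, hgrad⟩ := hvE.memH1_ofReal 𝕜 ha (memLp_two_of_lintegral hvm hv0 hfin2)
  have hmem : (fun x => (v x : 𝕜)) ∈ nonzeroH1 𝕜 := by
    refine ⟨hH1, fun h => ?_⟩
    have h0 : ∫⁻ x, ENNReal.ofReal (v x ^ 4) = 0 := by
      rw [lintegral_eq_zero_iff (by fun_prop)]
      filter_upwards [h] with x hx
      have hx' : v x = 0 := by simpa using hx
      simp [hx']
    rw [h0] at hv4
    exact absurd hv4 (by simp)
  have hbdd : BddBelow (functionalF α '' nonzeroH1 𝕜) := ⟨0, by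
    rintro _ ⟨u, -, rfl⟩
    exact functionalF_nonneg α u⟩
  have hnorm : ∀ x, ‖(v x : 𝕜)‖ = v x := fun x => by
    rw [RCLike.norm_ofReal, abs_of_nonneg (hv0 x)]
  -- No equality of norms in the limit is needed: the three norms in the numerator are bounded above
  -- by their limiting bounds, and the denominator is at least `1`.
  have hval : functionalF α (fun x => (v x : 𝕜)) ≤ infimumC 𝕜 α := by
    refine le_trans ?_ hle
    rw [functionalF_eq hα]
    simp only [hnorm]
    have h2 : (∫⁻ x, ENNReal.ofReal (v x ^ 2)).toReal ≤ 1 :=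
      ENNReal.toReal_le_of_le_ofReal zero_le_one (by simpa using hv2)
    have h4 : 1 ≤ (∫⁻ x, ENNReal.ofReal (v x ^ 4)).toReal := by
      have := ENNReal.toReal_mono hfin4 hv4
      simpa using this
    have h6 : (∫⁻ x, ENNReal.ofReal (v x ^ 6)).toReal ≤ t :=
      ENNReal.toReal_le_of_le_ofReal ht hv6
    have hg0 := LpNorm_nonneg 2 (weakGradient fun x => (v x : 𝕜))
    refine (div_le_self (by positivity) h4).trans ?_
    calc _ ≤ (a ^ 2) ^ (1 / (1 + α)) * 1 * t ^ (α / (2 * (1 + α))) := by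
          gcongr
          exact Real.rpow_le_one ENNReal.toReal_nonneg h2 (by positivity)
      _ = _ := by rw [mul_one]
  have heq := le_antisymm hval (csInf_le hbdd ⟨_, hmem, rfl⟩)
  exact ⟨v, hv0, hvr, hmem, heq, ⟨_, hmem, heq⟩, fun b hb => csInf_le hbdd hb⟩
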